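/- Let $R$ be a unital commutative ring and let $C$ be an octonion algebra over $R$, i.e. a unital, not necessarily associative $R$-algebra whose underlying module is projective of constant rank $8$, endowed with a regular multiplicative quadratic form $q$ (with polar form $b_q$). For an $R$-ring $S$ (a unital, commutative, associative $R$-algebra) write $C_S=S\otimes_R C$, let $q_S$ be the extension of $q$ to $C_S$, and let $\overline{x}=b_q(x,1)1-x$ be the natural involution of $C_S$. Put $$\mathbf S_C(S)=\{c\in C_S: q_S(c)=1\},$$ $$\mathbf{RT}(C)(S)=\{(t_1,t_2,t_3)\in\mathbf{SO}(q)(S)^3:\ t_1(xy)=\overline{t_2(\overline x)}\ \overline{t_3(\overline y)}\ \text{ for all }x,y\in C_S\},$$ $$\Pi_S:\mathbf{RT}(C)(S)\to\mathbf S_C(S)^2,\qquad \mathbf t=(t_1,t_2,t_3)\mapsto(t_3(1),t_2(1)),$$ and let $\mathbf{Aut}(C)(S)$ be the group of $S$-algebra automorphisms of $C_S$; for $g\in\mathbf{Aut}(C)(S)$ write $\mathbf tg=(t_1g,t_2g,t_3g)$. Let $a,b\in\mathbf S_C(R)$ and let $C^{a,b}$ be the $R$-module $C$ with the multiplication $x*y=(xa)(by)$.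 Put $\mathbf E^{a,b}(S)=\Pi_S^{-1}(a_S,b_S)$. The twist $\mathbf E^{a,b}\wedge^{\mathbf{Aut}(C)}\mathbf W(C)$ is the fppf sheaf associated to the functor $S\mapsto(\mathbf E^{a,b}(S)\times C_S)/\!\sim$ on $R$-rings, where $(\mathbf t,x)\sim(\mathbf t g,g^{-1}(x))$ for $g\in\mathbf{Aut}(C)(S)$, with the operations induced by $$(\mathbf t,x)+(\mathbf t',x')=(\mathbf t,\,x+t_1^{-1}t_1'(x')),\qquad s(\mathbf t,x)=(\mathbf t,sx),\qquad (\mathbf t,x)\cdot(\mathbf t',x')=(\mathbf t,\,x\,t_1^{-1}t_1'(x')).$$ **Theorem.** 1. There is a faithfully flat $R$-ring $T$ of finite presentation with $\mathbf E^{a,b}(T)\neq\emptyset$, and for every $R$-ring $S$ and all $\mathbf t,\mathbf t'\in\mathbf E^{a,b}(S)$ there is exactly one $g\in\mathbf{Aut}(C)(S)$ with $\mathbf t'=\mathbf tg$. 2. With the operations above, $\mathbf E^{a,b}\wedge^{\mathbf{Aut}(C)}\mathbf W(C)$ is an fppf sheaf of unital (not necessarily associative) algebras. The functor $\mathbf W(C^{a,b}):S\mapsto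 S\otimes_R C^{a,b}$ is an fppf sheaf. 3. The maps $\Theta_S^{a,b}:\mathbf E^{a,b}(S)\times C_S\to C_S^{a,b}$, $(\mathbf t,x)\mapsto t_1(x)$, induce one and only one morphism of functors on $R$-rings $$\widehat\Theta^{a,b}:\mathbf E^{a,b}\wedge^{\mathbf{Aut}(C)}\mathbf W(C)\longrightarrow\mathbf W(C^{a,b}),$$ and $\widehat\Theta^{a,b}$ is an isomorphism of fppf sheaves of algebras, natural in $S$. -/

import Mathlib

open CategoryTheory Opposite TensorProduct

universe u v w

/-! ### The fppf topology on affine schemes over `R` -/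

section FppfTopology

variable {R : Type u} [CommRing R]

/-- A sieve on `Spec S` (an object of the opposite of the category of `R`-rings) is an fppf
covering sieve if it contains a finite, jointly surjective family `Spec Tᵢ ⟶ Spec S` of flat
morphisms of finite presentation. -/
def IsFppfCover {X : (CommAlgCat.{u} R)ᵒᵖ} (Z : Sieve X) : Prop :=
  ∃ (ι : Type) (_ : Finite ι) (T : ι → CommAlgCat.{u} R) (φ : ∀ i, X.unop ⟶ T i),
    (∀ i, Z (φ i).op) ∧
    (∀ i, (φ i).hom.toRingHom.Flat ∧ (φ i).hom.toRingHom.FinitePresentation) ∧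
    ∀ p : PrimeSpectrum X.unop, ∃ i, p ∈ Set.range (PrimeSpectrum.comap (φ i).hom.toRingHom)

theorem PrimeSpectrum.mem_range_comap_includeLeft {A B T : Type u} [CommRing A] [CommRing B]
    [CommRing T] [Algebra A B] [Algebra A T] (q : PrimeSpectrum B)
    (h : PrimeSpectrum.comap (algebraMap A B) q ∈
      Set.range (PrimeSpectrum.comap (algebraMap A T))) :
    q ∈ Set.range (PrimeSpectrum.comap (algebraMap B (B ⊗[A] T))) := by
  obtain ⟨p, hp⟩ : ∃ p, PrimeSpectrum.comap (algebraMap A B) q = p := ⟨_, rfl⟩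
  have hp' : p.asIdeal = q.asIdeal.comap (algebraMap A B) := by rw [← hp]; rfl
  rw [hp] at h
  rw [← PrimeSpectrum.nontrivial_iff_mem_rangeComap] at h ⊢
  let : Algebra p.asIdeal.ResidueField q.asIdeal.ResidueField :=
    (Ideal.ResidueField.map p.asIdeal q.asIdeal (algebraMap A B) hp').toAlgebra
  have : IsScalarTower A p.asIdeal.ResidueField q.asIdeal.ResidueField :=
    IsScalarTower.of_algebraMap_eq fun x => by
      rw [RingHom.algebraMap_toAlgebra, Ideal.ResidueField.map_algebraMap,
        ← IsScalarTower.algebraMap_apply]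
  have e : q.asIdeal.ResidueField ⊗[B] (B ⊗[A] T) ≃+
      q.asIdeal.ResidueField ⊗[p.asIdeal.ResidueField] (p.asIdeal.ResidueField ⊗[A] T) :=
    ((AlgebraTensorModule.cancelBaseChange A B B q.asIdeal.ResidueField T).toAddEquiv.trans
      (AlgebraTensorModule.cancelBaseChange A p.asIdeal.ResidueField p.asIdeal.ResidueField
        q.asIdeal.ResidueField T).symm.toAddEquiv)
  have : Nontrivial (q.asIdeal.ResidueField ⊗[p.asIdeal.ResidueField]
      (p.asIdeal.ResidueField ⊗[A] T)) := inferInstance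
  exact e.toEquiv.nontrivial

variable (R) in
/-- The fppf topology on the opposite of the category of `R`-rings. -/
def affineFppfTopology : GrothendieckTopology (CommAlgCat.{u} R)ᵒᵖ where
  sieves X := {Z | IsFppfCover Z}
  top_mem' X := ⟨Unit, inferInstance, fun _ => X.unop, fun _ => 𝟙 _, fun _ => trivial,
    fun _ => ⟨RingHom.Flat.id _, RingHom.FinitePresentation.id _⟩, fun p => ⟨(), p, rfl⟩⟩
  pullback_stable' := by
    rintro X Y Z f ⟨ι, hι, T, φ, hZ, hφ, hs⟩
    let : Algebra X.unop Y.unop := f.unop.hom.toRingHom.toAlgebra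
    let (i : ι) : Algebra X.unop (T i) := (φ i).hom.toRingHom.toAlgebra
    have : IsScalarTower R X.unop Y.unop :=
      IsScalarTower.of_algebraMap_eq fun r => (f.unop.hom.commutes r).symm
    have (i : ι) : IsScalarTower R X.unop (T i) :=
      IsScalarTower.of_algebraMap_eq fun r => ((φ i).hom.commutes r).symm
    have (i : ι) : Module.Flat X.unop (T i) := (hφ i).1
    have (i : ι) : Algebra.FinitePresentation X.unop (T i) := (hφ i).2
    refine ⟨ι, hι, fun i => CommAlgCat.of R (Y.unop ⊗[X.unop] T i), fun i =>
      CommAlgCat.ofHom ((Algebra.TensorProduct.includeLeft :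
        Y.unop →ₐ[X.unop] Y.unop ⊗[X.unop] T i).restrictScalars R), fun i => ?_, fun i => ?_,
      fun q => ?_⟩
    · have key := Z.downward_closed (hZ i) (CommAlgCat.ofHom
        ((Algebra.TensorProduct.includeRight :
        T i →ₐ[X.unop] Y.unop ⊗[X.unop] T i).restrictScalars R)).op
      rw [Sieve.pullback_apply]
      convert key using 1
      rw [← op_comp, ← Quiver.Hom.op_unop f, ← op_comp]
      congr 1
      ext s
      exact (Algebra.TensorProduct.tmul_one_eq_one_tmul (A := Y.unop) (B := T i) s)
    · exact ⟨show (algebraMap Y.unop (Y.unop ⊗[X.unop] T i)).Flat from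
          RingHom.flat_algebraMap_iff.2 inferInstance,
        show (algebraMap Y.unop (Y.unop ⊗[X.unop] T i)).FinitePresentation from
          RingHom.finitePresentation_algebraMap.2 inferInstance⟩
    · obtain ⟨i, hi⟩ := hs (PrimeSpectrum.comap (algebraMap X.unop Y.unop) q)
      exact ⟨i, PrimeSpectrum.mem_range_comap_includeLeft (T := T i) q hi⟩
  transitive' := by
    rintro X Z ⟨ι, hι, T, φ, hZ, hφ, hs⟩ Z' hZ'
    choose κ hκ U ψ hU hψ ht using fun i => hZ' (hZ i)
    refine ⟨Σ i, κ i, inferInstance, fun j => U j.1 j.2, fun j => φ j.1 ≫ ψ j.1 j.2,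
      fun j => hU j.1 j.2, fun j => ?_, fun p => ?_⟩
    · exact ⟨RingHom.Flat.comp (hφ j.1).1 (hψ j.1 j.2).1, (hψ j.1 j.2).2.comp (hφ j.1).2⟩
    · obtain ⟨i, q, rfl⟩ := hs p
      obtain ⟨k, r, rfl⟩ := ht i q
      exact ⟨⟨i, k⟩, r, rfl⟩

/-- A functor on `R`-rings, regarded as a presheaf on affine schemes over `R`. -/
abbrev asPresheaf (G : CommAlgCat.{u} R ⥤ Type w) : (CommAlgCat.{u} R)ᵒᵖᵒᵖ ⥤ Type w :=
  unopUnop _ ⋙ G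

/-- A functor on `R`-rings is an fppf sheaf. -/
def IsFppfSheaf (G : CommAlgCat.{u} R ⥤ Type w) : Prop :=
  Presheaf.IsSheaf (affineFppfTopology R) (asPresheaf G)

/-- The fppf sheaf associated to a functor on `R`-rings, again as a functor on `R`-rings. -/
noncomputable def fppfSheafify (G : CommAlgCat.{u} R ⥤ Type (u + 1)) :
    CommAlgCat.{u} R ⥤ Type (u + 1) :=
  opOp _ ⋙ sheafify (affineFppfTopology R) (asPresheaf G)

/-- The canonical map from a functor to its associated fppf sheaf. -/
noncomputable def toFppfSheafify (G : CommAlgCat.{u} R ⥤ Type (u + 1)) : G ⟶ fppfSheafify G :=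
  (opOp _).whiskerLeft (toSheafify (affineFppfTopology R) (asPresheaf G))

theorem isFppfSheaf_fppfSheafify (G : CommAlgCat.{u} R ⥤ Type (u + 1)) :
    IsFppfSheaf (fppfSheafify G) :=
  (presheafToSheaf (affineFppfTopology R) _ |>.obj (asPresheaf G)).property

end FppfTopology

/-! ### Algebra operations on functors and on associated sheaves -/

section AlgebraOps

variable {R : Type u} [CommRing R]

/-- Functorial operations of addition, multiplication and multiplication by scalars on a functor
on `R`-rings. No zero section is required: a functor with empty values can carry such
operations. -/
structure AlgebraOps (G : CommAlgCat.{u} R ⥤ Type w) where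
  add (S : CommAlgCat.{u} R) : G.obj S → G.obj S → G.obj S
  mul (S : CommAlgCat.{u} R) : G.obj S → G.obj S → G.obj S
  smul (S : CommAlgCat.{u} R) : S → G.obj S → G.obj S
  map_add {S T : CommAlgCat.{u} R} (φ : S ⟶ T) (x y : G.obj S) :
    G.map φ (add S x y) = add T (G.map φ x) (G.map φ y)
  map_mul {S T : CommAlgCat.{u} R} (φ : S ⟶ T) (x y : G.obj S) :
    G.map φ (mul S x y) = mul T (G.map φ x) (G.map φ y)
  map_smul {S T : CommAlgCat.{u} R} (φ : S ⟶ T) (s : S) (x : G.obj S) :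
    G.map φ (smul S s x) = smul T (φ.hom s) (G.map φ x)

/-- A morphism of functors on `R`-rings compatible with the given algebra operations. -/
structure AlgebraOps.IsHom {G : CommAlgCat.{u} R ⥤ Type w} {H : CommAlgCat.{u} R ⥤ Type w}
    (A : AlgebraOps G) (B : AlgebraOps H) (f : G ⟶ H) : Prop where
  app_add (S : CommAlgCat.{u} R) (x y : G.obj S) :
    f.app S (A.add S x y) = B.add S (f.app S x) (f.app S y)
  app_mul (S : CommAlgCat.{u} R) (x y : G.obj S) :
    f.app S (A.mul S x y) = B.mul S (f.app S x) (f.app S y)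
  app_smul (S : CommAlgCat.{u} R) (s : S) (x : G.obj S) :
    f.app S (A.smul S s x) = B.smul S s (f.app S x)

/-- The operations make every `G(S)` a unital, not necessarily associative `S`-algebra. -/
def AlgebraOps.IsUnitalAlgebra {G : CommAlgCat.{u} R ⥤ Type w} (A : AlgebraOps G) : Prop :=
  ∀ S : CommAlgCat.{u} R, ∃ (_ : NonAssocRing (G.obj S)) (_ : Module S (G.obj S)),
    IsScalarTower S (G.obj S) (G.obj S) ∧ SMulCommClass S (G.obj S) (G.obj S) ∧
    (∀ x y : G.obj S, x + y = A.add S x y) ∧ (∀ x y : G.obj S, x * y = A.mul S x y) ∧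
    ∀ (s : S) (x : G.obj S), s • x = A.smul S s x

/-- The product of two set-valued presheaves. -/
abbrev presheafProd {𝒞 : Type v} [Category.{u} 𝒞] (P Q : 𝒞ᵒᵖ ⥤ Type w) : 𝒞ᵒᵖ ⥤ Type w where
  obj X := P.obj X × Q.obj X
  map f := TypeCat.ofHom fun x => (P.map f x.1, Q.map f x.2)

/-- The product of two morphisms of presheaves. -/
abbrev presheafProdMap {𝒞 : Type v} [Category.{u} 𝒞] {P P' Q Q' : 𝒞ᵒᵖ ⥤ Type w} (f : P ⟶ P')
    (g : Q ⟶ Q') : presheafProd P Q ⟶ presheafProd P' Q' where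
  app X := TypeCat.ofHom fun x => (f.app X x.1, g.app X x.2)
  naturality X Y h := by
    refine ConcreteCategory.hom_ext _ _ fun (x : P.obj X × Q.obj X) => ?_
    exact congrArg₂ Prod.mk (NatTrans.naturality_apply f h x.1) (NatTrans.naturality_apply g h x.2)

theorem W_presheafProdMap (J : GrothendieckTopology (CommAlgCat.{u} R)ᵒᵖ)
    {P P' Q Q' : (CommAlgCat.{u} R)ᵒᵖᵒᵖ ⥤ Type (u + 1)} (f : P ⟶ P') (g : Q ⟶ Q')
    (hf : J.W f) (hg : J.W g) : J.W (presheafProdMap f g) := by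
  rw [J.W_iff_isLocallyBijective] at hf hg ⊢
  obtain ⟨hf₁, hf₂⟩ := hf
  obtain ⟨hg₁, hg₂⟩ := hg
  refine ⟨⟨fun {X} x y h => ?_⟩, ⟨fun {U} s => ?_⟩⟩
  · change P.obj X × Q.obj X at x y
    refine J.superset_covering ?_ (J.intersection_covering
      (Presheaf.equalizerSieve_mem J f x.1 y.1 (show f.app X x.1 = f.app X y.1 from
        congrArg Prod.fst h))
      (Presheaf.equalizerSieve_mem J g x.2 y.2 (show g.app X x.2 = g.app X y.2 from
        congrArg Prod.snd h)))
    rintro Y i ⟨h₁, h₂⟩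
    exact Prod.ext h₁ h₂
  · refine J.superset_covering ?_ (J.intersection_covering
      (Presheaf.imageSieve_mem J f (U := op U) s.1) (Presheaf.imageSieve_mem J g (U := op U) s.2))
    rintro Y i ⟨⟨t₁, h₁⟩, ⟨t₂, h₂⟩⟩
    exact ⟨(t₁, t₂), Prod.ext h₁ h₂⟩

/-- The binary operation given by a map out of a product of presheaves. -/
def presheafProdApp {𝒞 : Type v} [Category.{u} 𝒞] {P Q F : 𝒞ᵒᵖ ⥤ Type w}
    (m : presheafProd P Q ⟶ F) (X : 𝒞ᵒᵖ) (x : P.obj X) (y : Q.obj X) : F.obj X :=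
  m.app X ((x, y) : P.obj X × Q.obj X)

theorem map_presheafProdApp {𝒞 : Type v} [Category.{u} 𝒞] {P Q F : 𝒞ᵒᵖ ⥤ Type w}
    (m : presheafProd P Q ⟶ F) {X Y : 𝒞ᵒᵖ} (h : X ⟶ Y) (x : P.obj X) (y : Q.obj X) :
    F.map h (presheafProdApp m X x y) = presheafProdApp m Y (P.map h x) (Q.map h y) :=
  (NatTrans.naturality_apply m h ((x, y) : P.obj X × Q.obj X)).symm

/-- The unique extension of a map `P × Q ⟶ F` to `P' × Q' ⟶ F`, where `F` is a sheaf and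
`P ⟶ P'`, `Q ⟶ Q'` become isomorphisms after sheafification. -/
noncomputable def extendBinary (J : GrothendieckTopology (CommAlgCat.{u} R)ᵒᵖ)
    {P P' Q Q' F : (CommAlgCat.{u} R)ᵒᵖᵒᵖ ⥤ Type (u + 1)} (f : P ⟶ P') (g : Q ⟶ Q')
    (hf : J.W f) (hg : J.W g) (hF : Presheaf.IsSheaf J F) (m : presheafProd P Q ⟶ F) :
    presheafProd P' Q' ⟶ F :=
  (Equiv.ofBijective _ (W_presheafProdMap J f g hf hg F hF)).symm m

theorem extendBinary_spec (J : GrothendieckTopology (CommAlgCat.{u} R)ᵒᵖ)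
    {P P' Q Q' F : (CommAlgCat.{u} R)ᵒᵖᵒᵖ ⥤ Type (u + 1)} (f : P ⟶ P') (g : Q ⟶ Q')
    (hf : J.W f) (hg : J.W g) (hF : Presheaf.IsSheaf J F) (m : presheafProd P Q ⟶ F) :
    presheafProdMap f g ≫ extendBinary J f g hf hg hF m = m :=
  (Equiv.ofBijective _ (W_presheafProdMap J f g hf hg F hF)).apply_symm_apply m

theorem extendBinary_apply (J : GrothendieckTopology (CommAlgCat.{u} R)ᵒᵖ)
    {P P' Q Q' F : (CommAlgCat.{u} R)ᵒᵖᵒᵖ ⥤ Type (u + 1)} (f : P ⟶ P') (g : Q ⟶ Q')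
    (hf : J.W f) (hg : J.W g) (hF : Presheaf.IsSheaf J F) (m : presheafProd P Q ⟶ F)
    (X : (CommAlgCat.{u} R)ᵒᵖᵒᵖ) (x : P.obj X) (y : Q.obj X) :
    presheafProdApp (extendBinary J f g hf hg hF m) X (f.app X x) (g.app X y) =
      presheafProdApp m X x y := by
  conv_rhs => rw [← extendBinary_spec J f g hf hg hF m]
  rfl

/-- The presheaf `Spec S ↦ S`. -/
def scalarPresheaf (R : Type u) [CommRing R] : (CommAlgCat.{u} R)ᵒᵖᵒᵖ ⥤ Type (u + 1) :=
  asPresheaf (forget (CommAlgCat.{u} R) ⋙ uliftFunctor.{u + 1})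

namespace AlgebraOps

variable {G : CommAlgCat.{u} R ⥤ Type (u + 1)} (A : AlgebraOps G)

/-- Addition followed by the canonical map to the associated sheaf. -/
noncomputable def addHom : presheafProd (asPresheaf G) (asPresheaf G) ⟶
    sheafify (affineFppfTopology R) (asPresheaf G) where
  app X := TypeCat.ofHom fun x =>
    (toSheafify (affineFppfTopology R) (asPresheaf G)).app X (A.add X.unop.unop x.1 x.2)
  naturality X Y f := by
    ext x
    refine Eq.trans ?_ (NatTrans.naturality_apply (toSheafify _ (asPresheaf G)) f _)
    exact congrArg _ (A.map_add f.unop.unop x.1 x.2).symm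

/-- Multiplication followed by the canonical map to the associated sheaf. -/
noncomputable def mulHom : presheafProd (asPresheaf G) (asPresheaf G) ⟶
    sheafify (affineFppfTopology R) (asPresheaf G) where
  app X := TypeCat.ofHom fun x =>
    (toSheafify (affineFppfTopology R) (asPresheaf G)).app X (A.mul X.unop.unop x.1 x.2)
  naturality X Y f := by
    ext x
    refine Eq.trans ?_ (NatTrans.naturality_apply (toSheafify _ (asPresheaf G)) f _)
    exact congrArg _ (A.map_mul f.unop.unop x.1 x.2).symm

/-- Scalar multiplication followed by the canonical map to the associated sheaf. -/
noncomputable def smulHom : presheafProd (scalarPresheaf R) (asPresheaf G) ⟶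
    sheafify (affineFppfTopology R) (asPresheaf G) where
  app X := TypeCat.ofHom fun x =>
    (toSheafify (affineFppfTopology R) (asPresheaf G)).app X
      (A.smul X.unop.unop (ULift.down x.1) x.2)
  naturality X Y f := by
    ext x
    refine Eq.trans ?_ (NatTrans.naturality_apply (toSheafify _ (asPresheaf G)) f _)
    exact congrArg _ (A.map_smul f.unop.unop (ULift.down x.1) x.2).symm

/-- The operations on the associated sheaf induced by the operations on a functor: the unique
functorial operations compatible with the canonical map. -/
noncomputable def sheafify : AlgebraOps (fppfSheafify G) :=
  let J := affineFppfTopology R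
  let η := toSheafify J (asPresheaf G)
  let hη : J.W η := J.W_toSheafify _
  let hF := (presheafToSheaf J _ |>.obj (asPresheaf G)).property
  let add := extendBinary J η η hη hη hF A.addHom
  let mul := extendBinary J η η hη hη hF A.mulHom
  let smul := extendBinary J (𝟙 (scalarPresheaf R)) η (MorphismProperty.id_mem _ _) hη hF A.smulHom
  { add S := presheafProdApp add (op (op S))
    mul S := presheafProdApp mul (op (op S))
    smul S s := presheafProdApp smul (op (op S)) (ULift.up s)
    map_add φ := map_presheafProdApp add φ.op.op
    map_mul φ := map_presheafProdApp mul φ.op.op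
    map_smul φ s := map_presheafProdApp smul φ.op.op (ULift.up s) }

/-- The canonical map to the associated sheaf is compatible with the operations. -/
theorem isHom_toFppfSheafify : A.IsHom A.sheafify (toFppfSheafify G) where
  app_add S x y := (extendBinary_apply (affineFppfTopology R) _ _ _ _ _ A.addHom
    (op (op S)) x y).symm
  app_mul S x y := (extendBinary_apply (affineFppfTopology R) _ _ _ _ _ A.mulHom
    (op (op S)) x y).symm
  app_smul S s x := (extendBinary_apply (affineFppfTopology R) (𝟙 (scalarPresheaf R)) _ _ _ _
    A.smulHom (op (op S)) (ULift.up s) x).symm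

end AlgebraOps

end AlgebraOps

/-! ### Octonion algebras -/

section Octonions

/-- An octonion algebra over `R`: a unital, not necessarily associative `R`-algebra whose
underlying module is projective of constant rank `8`, endowed with a regular multiplicative
quadratic form. Regular means that the polar form identifies the module with its dual. -/
class OctonionAlgebra (R : Type u) (C : Type v) [CommRing R] [NonAssocRing C] [Module R C]
    [IsScalarTower R C C] [SMulCommClass R C C] where
  finite : Module.Finite R C
  projective : Module.Projective R C
  rank_eq : ∀ p : PrimeSpectrum R, Module.rankAtStalk C p = 8
  /-- The norm form. -/
  norm : QuadraticForm R C
  norm_mul : ∀ x y : C, norm (x * y) = norm x * norm y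
  regular : Function.Bijective (QuadraticMap.polarBilin norm : C →ₗ[R] C →ₗ[R] R)

/-- A quadratic form on a projective module comes from a (not necessarily symmetric) bilinear
form. -/
theorem QuadraticForm.exists_bilin {R : Type u} {M : Type v} [CommRing R] [AddCommGroup M]
    [Module R M] [Module.Projective R M] (q : QuadraticForm R M) :
    ∃ B : LinearMap.BilinForm R M, LinearMap.BilinMap.toQuadraticMap B = q := by
  obtain ⟨s, hs⟩ := Module.projective_lifting_property
    (Finsupp.linearCombination R (id : M → M)) LinearMap.id
    (fun x => ⟨Finsupp.single x 1, by simp⟩)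
  obtain ⟨B, hB⟩ := LinearMap.BilinMap.toQuadraticMap_surjective
    (q.comp (Finsupp.linearCombination R (id : M → M)))
  refine ⟨B.compl₁₂ s s, ?_⟩
  ext x
  have h := congrArg (fun Q => Q (s x)) hB
  simp only [LinearMap.BilinMap.toQuadraticMap_apply, QuadraticMap.comp_apply] at h
  rw [LinearMap.BilinMap.toQuadraticMap_apply, LinearMap.compl₁₂_apply, h]
  exact congrArg q (LinearMap.congr_fun hs x)

/-- The base change to `S` of a quadratic form on a projective module (`2` need not be
invertible). -/
noncomputable def QuadraticForm.extendScalars {R : Type u} {M : Type v} [CommRing R]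
    [AddCommGroup M] [Module R M] [Module.Projective R M] (q : QuadraticForm R M)
    (S : Type w) [CommRing S] [Algebra R S] : QuadraticForm S (S ⊗[R] M) :=
  LinearMap.BilinMap.toQuadraticMap
    (LinearMap.BilinForm.baseChange S q.exists_bilin.choose)

theorem QuadraticForm.extendScalars_tmul {R : Type u} {M : Type v} [CommRing R]
    [AddCommGroup M] [Module R M] [Module.Projective R M] (q : QuadraticForm R M)
    (S : Type w) [CommRing S] [Algebra R S] (s : S) (x : M) :
    q.extendScalars S (s ⊗ₜ x) = s * s * algebraMap R S (q x) := by
  have h := congrArg (fun Q => Q x) q.exists_bilin.choose_spec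
  simp only [LinearMap.BilinMap.toQuadraticMap_apply] at h
  rw [QuadraticForm.extendScalars, LinearMap.BilinMap.toQuadraticMap_apply,
    LinearMap.BilinForm.baseChange_tmul, h, Algebra.smul_def, mul_comm]

section Restrict

variable {R : Type u} [CommRing R]
variable {S T U : Type u} [CommRing S] [Algebra R S] [CommRing T] [Algebra R T] [CommRing U]
  [Algebra R U] (φ : S →ₐ[R] T) (ψ : T →ₐ[R] U)

/-- The map `M_S → M_T` induced by a morphism `S → T` of `R`-rings. -/
noncomputable def restr (M : Type u) [AddCommGroup M] [Module R M] (φ : S →ₐ[R] T) :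
    S ⊗[R] M →ₗ[R] T ⊗[R] M :=
  φ.toLinearMap.rTensor M

theorem restr_tmul (M : Type u) [AddCommGroup M] [Module R M] (s : S) (x : M) :
    restr M φ (s ⊗ₜ[R] x) = φ s ⊗ₜ[R] x := rfl

theorem restr_smul (M : Type u) [AddCommGroup M] [Module R M] (s : S) (x : S ⊗[R] M) :
    restr M φ (s • x) = φ s • restr M φ x := by
  induction x with
  | zero => simp
  | add x y hx hy => simp [smul_add, hx, hy]
  | tmul s' x => simp [restr_tmul, TensorProduct.smul_tmul']

theorem restr_comp (M : Type u) [AddCommGroup M] [Module R M] (x : S ⊗[R] M) :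
    restr M (ψ.comp φ) x = restr M ψ (restr M φ x) := by
  induction x with
  | zero => simp
  | add x y hx hy => simp [hx, hy]
  | tmul s' x => simp [restr_tmul]

theorem restr_id (M : Type u) [AddCommGroup M] [Module R M] (x : S ⊗[R] M) :
    restr M (AlgHom.id R S) x = x := by
  induction x with
  | zero => simp
  | add x y hx hy => simp [hx, hy]
  | tmul s' x => simp [restr_tmul]

theorem restr_mul (A : Type u) [NonUnitalNonAssocRing A] [Module R A] [IsScalarTower R A A]
    [SMulCommClass R A A] (x y : S ⊗[R] A) : restr A φ (x * y) = restr A φ x * restr A φ y := by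
  induction x with
  | zero => simp
  | add x x' hx hx' => simp [add_mul, hx, hx']
  | tmul s x =>
    induction y with
    | zero => simp
    | add y y' hy hy' => simp [mul_add, hy, hy']
    | tmul t y => simp [restr_tmul, Algebra.TensorProduct.tmul_mul_tmul]

/-- The base change to `T` of an `S`-linear endomorphism of `M_S`. -/
noncomputable def extendEnd (M : Type u) [AddCommGroup M] [Module R M] (φ : S →ₐ[R] T)
    (f : S ⊗[R] M →ₗ[S] S ⊗[R] M) : T ⊗[R] M →ₗ[T] T ⊗[R] M :=
  LinearMap.liftBaseChange T
    (restr M φ ∘ₗ f.restrictScalars R ∘ₗ TensorProduct.mk R S M 1)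

theorem extendEnd_restr (M : Type u) [AddCommGroup M] [Module R M]
    (f : S ⊗[R] M →ₗ[S] S ⊗[R] M) (x : S ⊗[R] M) :
    extendEnd M φ f (restr M φ x) = restr M φ (f x) := by
  induction x with
  | zero => simp
  | add x y hx hy => simp [hx, hy]
  | tmul s x =>
    rw [restr_tmul, extendEnd, LinearMap.liftBaseChange_tmul]
    have : s ⊗ₜ[R] x = s • ((1 : S) ⊗ₜ[R] x) := by rw [TensorProduct.smul_tmul', smul_eq_mul, mul_one]
    rw [this, map_smul, restr_smul]
    rfl

theorem extendEnd_ext (M : Type u) [AddCommGroup M] [Module R M] {N : Type u} [AddCommGroup N]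
    [Module T N] {f g : T ⊗[R] M →ₗ[T] N} (φ : S →ₐ[R] T)
    (h : ∀ x : S ⊗[R] M, f (restr M φ x) = g (restr M φ x)) : f = g := by
  refine LinearMap.ext fun x => ?_
  induction x with
  | zero => simp
  | add x y hx hy => simp [hx, hy]
  | tmul t x =>
    have : t ⊗ₜ[R] x = t • restr M φ ((1 : S) ⊗ₜ[R] x) := by
      rw [restr_tmul, map_one, TensorProduct.smul_tmul', smul_eq_mul, mul_one]
    rw [this, map_smul, map_smul, h]

/-- The base change to `T` of an `S`-linear automorphism of `M_S`. -/
noncomputable def extendAut (M : Type u) [AddCommGroup M] [Module R M] (φ : S →ₐ[R] T)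
    (f : S ⊗[R] M ≃ₗ[S] S ⊗[R] M) : T ⊗[R] M ≃ₗ[T] T ⊗[R] M :=
  LinearEquiv.ofLinearMap (extendEnd M φ f) (extendEnd M φ f.symm)
    (extendEnd_ext M φ fun x => by simp [extendEnd_restr])
    (extendEnd_ext M φ fun x => by simp [extendEnd_restr])

theorem extendAut_restr (M : Type u) [AddCommGroup M] [Module R M]
    (f : S ⊗[R] M ≃ₗ[S] S ⊗[R] M) (x : S ⊗[R] M) :
    extendAut M φ f (restr M φ x) = restr M φ (f x) :=
  extendEnd_restr φ M f x

theorem extendAut_symm_restr (M : Type u) [AddCommGroup M] [Module R M]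
    (f : S ⊗[R] M ≃ₗ[S] S ⊗[R] M) (x : S ⊗[R] M) :
    (extendAut M φ f).symm (restr M φ x) = restr M φ (f.symm x) :=
  extendEnd_restr φ M f.symm x

theorem extendAut_comp (M : Type u) [AddCommGroup M] [Module R M]
    (f : S ⊗[R] M ≃ₗ[S] S ⊗[R] M) :
    extendAut M (ψ.comp φ) f = extendAut M ψ (extendAut M φ f) :=
  LinearEquiv.toLinearMap_injective <| extendEnd_ext M (ψ.comp φ) fun x => by
    rw [LinearEquiv.coe_coe, LinearEquiv.coe_coe, extendAut_restr, restr_comp, restr_comp,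
      extendAut_restr, extendAut_restr]

theorem extendAut_mul (M : Type u) [AddCommGroup M] [Module R M]
    (f g : S ⊗[R] M ≃ₗ[S] S ⊗[R] M) :
    extendAut M φ (f * g) = extendAut M φ f * extendAut M φ g :=
  LinearEquiv.toLinearMap_injective <| extendEnd_ext M φ fun x => by
    simp [extendAut_restr]

theorem extendAut_id (M : Type u) [AddCommGroup M] [Module R M]
    (f : S ⊗[R] M ≃ₗ[S] S ⊗[R] M) : extendAut M (AlgHom.id R S) f = f :=
  LinearEquiv.toLinearMap_injective <| extendEnd_ext M (AlgHom.id R S) fun x => by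
    rw [LinearEquiv.coe_coe, LinearEquiv.coe_coe, extendAut_restr, restr_id, restr_id]

end Restrict

/-- The group `Aut(C)(S)` of `S`-algebra automorphisms of `C_S`. -/
def octonionAut (R : Type u) (C : Type u) [CommRing R] [NonAssocRing C] [Module R C]
    [IsScalarTower R C C] [SMulCommClass R C C] (S : Type u) [CommRing S] [Algebra R S] :
    Subgroup (S ⊗[R] C ≃ₗ[S] S ⊗[R] C) where
  carrier := {g | ∀ x y, g (x * y) = g x * g y}
  mul_mem' {g h} hg hh x y := by
    change g (h (x * y)) = g (h x) * g (h y)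
    rw [hh, hg]
  one_mem' _ _ := rfl
  inv_mem' {g} hg x y := by
    change g.symm (x * y) = g.symm x * g.symm y
    rw [LinearEquiv.symm_apply_eq, hg, g.apply_symm_apply, g.apply_symm_apply]

theorem octonionAut.extendAut_mem {R C S T : Type u} [CommRing R] [NonAssocRing C] [Module R C]
    [IsScalarTower R C C] [SMulCommClass R C C] [CommRing S] [Algebra R S] [CommRing T] [Algebra R T]
    {g : S ⊗[R] C ≃ₗ[S] S ⊗[R] C} (hg : g ∈ octonionAut R C S)
    (φ : S →ₐ[R] T) : extendAut C φ g ∈ octonionAut R C T := by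
  have key : (LinearMap.mul T (T ⊗[R] C)).compr₂ (extendAut C φ g).toLinearMap =
      (LinearMap.mul T (T ⊗[R] C)).compl₁₂ (extendAut C φ g).toLinearMap
        (extendAut C φ g).toLinearMap := by
    refine extendEnd_ext C φ fun x => extendEnd_ext C φ fun y => ?_
    simp only [LinearMap.compr₂_apply, LinearMap.compl₁₂_apply, LinearMap.mul_apply',
      LinearEquiv.coe_coe]
    rw [← restr_mul, extendAut_restr, extendAut_restr, extendAut_restr, hg, restr_mul]
  exact fun x y => LinearMap.congr_fun (LinearMap.congr_fun key x) y

theorem restr_one {R C S T : Type u} [CommRing R] [NonAssocRing C] [Module R C]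
    [CommRing S] [Algebra R S] [CommRing T] [Algebra R T] (φ : S →ₐ[R] T) : restr C φ (1 : S ⊗[R] C) = 1 := by
  change restr C φ ((1 : S) ⊗ₜ[R] (1 : C)) = (1 : T) ⊗ₜ[R] (1 : C)
  rw [restr_tmul, map_one]

/-- The isotope `C^{a,b}`: the module `C` with the multiplication `x * y = (xa)(by)`. -/
@[nolint unusedArguments]
def Isotope {C : Type u} (_a _b : C) : Type u := C

namespace Isotope

variable {R C : Type u} [CommRing R] [NonAssocRing C] [Module R C] (a b : C)

instance : AddCommGroup (Isotope a b) := inferInstanceAs (AddCommGroup C)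

instance : Module R (Isotope a b) := inferInstanceAs (Module R C)

variable (R) in
/-- The identity map from `C` to its isotope, as a linear equivalence. -/
def of : C ≃ₗ[R] Isotope a b := LinearEquiv.refl R C

instance : NonUnitalNonAssocRing (Isotope a b) where
  mul x y := (((show C from x) * a) * (b * (show C from y)) : C)
  left_distrib x y z := by
    change (((show C from x) * a) * (b * ((show C from y) + (show C from z))) : C) =
      ((show C from x) * a) * (b * (show C from y)) + ((show C from x) * a) * (b * (show C from z))
    rw [mul_add, mul_add]
  right_distrib x y z := by
    change ((((show C from x) + (show C from y)) * a) * (b * (show C from z)) : C) =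
      ((show C from x) * a) * (b * (show C from z)) + ((show C from y) * a) * (b * (show C from z))
    rw [add_mul, add_mul]
  zero_mul x := by
    change (((0 : C) * a) * (b * (show C from x)) : C) = 0
    rw [zero_mul, zero_mul]
  mul_zero x := by
    change (((show C from x) * a) * (b * (0 : C)) : C) = 0
    rw [mul_zero, mul_zero]

theorem of_mul_of (x y : C) : of R a b x * of R a b y = of R a b ((x * a) * (b * y)) := rfl

instance [IsScalarTower R C C] : IsScalarTower R (Isotope a b) (Isotope a b) where
  smul_assoc r x y := by
    change (((r • (show C from x)) * a) * (b * (show C from y)) : C) =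
      r • (((show C from x) * a) * (b * (show C from y)))
    rw [smul_mul_assoc, smul_mul_assoc]

instance [SMulCommClass R C C] [IsScalarTower R C C] : SMulCommClass R (Isotope a b) (Isotope a b) where
  smul_comm r x y := by
    change r • (((show C from x) * a) * (b * (show C from y)) : C) =
      ((show C from x) * a) * (b * (r • (show C from y)))
    rw [mul_smul_comm, mul_smul_comm]

end Isotope

variable (R : Type u) (C : Type u) [CommRing R] [NonAssocRing C] [Module R C]
  [IsScalarTower R C C] [SMulCommClass R C C] [OctonionAlgebra R C]

instance OctonionAlgebra.instFinite : Module.Finite R C := OctonionAlgebra.finite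

instance OctonionAlgebra.instProjective : Module.Projective R C := OctonionAlgebra.projective

/-- The unit sphere of `C`, that is the set of elements of norm `1`. -/
def unitSphere : Set C := {c | OctonionAlgebra.norm (R := R) c = 1}

/-- The natural involution `x ↦ b(x, 1)1 - x` of an octonion algebra. -/
def octonionConj : C →ₗ[R] C :=
  ((QuadraticMap.polarBilin (OctonionAlgebra.norm (R := R) (C := C))).flip 1).smulRight (1 : C) -
    LinearMap.id

/-- The norm form `q_S` of `C_S`. -/
noncomputable def normOver (S : Type u) [CommRing S] [Algebra R S] : QuadraticForm S (S ⊗[R] C) :=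
  (OctonionAlgebra.norm (R := R) (C := C)).extendScalars S

/-- The natural involution of `C_S`. -/
noncomputable def conjOver (S : Type u) [CommRing S] [Algebra R S] : S ⊗[R] C →ₗ[S] S ⊗[R] C :=
  (octonionConj R C).baseChange S

variable {R}

theorem restr_conjOver {S T : Type u} [CommRing S] [Algebra R S] [CommRing T] [Algebra R T]
    (φ : S →ₐ[R] T) (x : S ⊗[R] C) :
    restr C φ (conjOver R C S x) = conjOver R C T (restr C φ x) := by
  induction x with
  | zero => simp
  | add x y hx hy => simp [hx, hy]
  | tmul s x => rfl

/-- An isometry `t` of a quadratic module acts trivially on the centre of the even Clifford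
algebra. -/
def ActsTriviallyOnCentre {S M : Type u} [CommRing S] [AddCommGroup M] [Module S M]
    (q : QuadraticForm S M) (t : M ≃ₗ[S] M) : Prop :=
  ∃ ht : ∀ x, q (t x) = q x,
    ∀ z ∈ CliffordAlgebra.even q, (∀ w ∈ CliffordAlgebra.even q, z * w = w * z) →
      CliffordAlgebra.map (⟨t, ht⟩ : q →qᵢ q) z = z

/-- `t` belongs to `SO(q_C)(S)`, the kernel of the Dickson homomorphism: it is an isometry and,
over every `S`-ring, it acts trivially on the centre of the even Clifford algebra. -/
def IsSpecialOrthogonal (S : Type u) [CommRing S] [Algebra R S]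
    (t : S ⊗[R] C ≃ₗ[S] S ⊗[R] C) : Prop :=
  ∀ (T : Type u) [CommRing T] [Algebra R T] (φ : S →ₐ[R] T),
    ActsTriviallyOnCentre (normOver R C T) (extendAut C φ t)

variable (R) in
/-- The group `RT(C)(S)` of related triples. -/
@[ext]
structure RelatedTriple (S : Type u) [CommRing S] [Algebra R S] where
  t₁ : S ⊗[R] C ≃ₗ[S] S ⊗[R] C
  t₂ : S ⊗[R] C ≃ₗ[S] S ⊗[R] C
  t₃ : S ⊗[R] C ≃ₗ[S] S ⊗[R] C
  so₁ : IsSpecialOrthogonal C S t₁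
  so₂ : IsSpecialOrthogonal C S t₂
  so₃ : IsSpecialOrthogonal C S t₃
  related : ∀ x y : S ⊗[R] C, t₁ (x * y) =
    conjOver R C S (t₂ (conjOver R C S x)) * conjOver R C S (t₃ (conjOver R C S y))

section BaseChange

variable {C} {S T U : Type u} [CommRing S] [Algebra R S] [CommRing T] [Algebra R T]
  [CommRing U] [Algebra R U]

theorem IsSpecialOrthogonal.extendAut {t : S ⊗[R] C ≃ₗ[S] S ⊗[R] C}
    (ht : IsSpecialOrthogonal C S t) (φ : S →ₐ[R] T) :
    IsSpecialOrthogonal C T (extendAut C φ t) := by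
  intro U _ _ ψ
  rw [← extendAut_comp]
  exact ht U (ψ.comp φ)

/-- The map `RT(C)(S) → RT(C)(T)` induced by a morphism `S → T` of `R`-rings. -/
noncomputable def RelatedTriple.map (φ : S →ₐ[R] T) (t : RelatedTriple R C S) : RelatedTriple R C T where
  t₁ := extendAut C φ t.t₁
  t₂ := extendAut C φ t.t₂
  t₃ := extendAut C φ t.t₃
  so₁ := t.so₁.extendAut φ
  so₂ := t.so₂.extendAut φ
  so₃ := t.so₃.extendAut φ
  related := by
    have key : (LinearMap.mul T (T ⊗[R] C)).compr₂ (extendAut C φ t.t₁).toLinearMap =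
        (LinearMap.mul T (T ⊗[R] C)).compl₁₂
          (conjOver R C T ∘ₗ (extendAut C φ t.t₂).toLinearMap ∘ₗ conjOver R C T)
          (conjOver R C T ∘ₗ (extendAut C φ t.t₃).toLinearMap ∘ₗ conjOver R C T) := by
      refine extendEnd_ext C φ fun x => extendEnd_ext C φ fun y => ?_
      simp only [LinearMap.compr₂_apply, LinearMap.compl₁₂_apply, LinearMap.mul_apply',
        LinearEquiv.coe_coe, LinearMap.comp_apply]
      rw [← restr_mul, extendAut_restr, t.related, restr_mul, ← restr_conjOver, ← restr_conjOver,
        extendAut_restr, extendAut_restr, restr_conjOver, restr_conjOver]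
    exact fun x y => LinearMap.congr_fun (LinearMap.congr_fun key x) y

end BaseChange

/-! ### The isotope and the torsor -/

variable {C}

variable (R) in
/-- The fibre `Π⁻¹(a, b)(S)` of the map `t ↦ (t₃(1), t₂(1))` from `RT(C)` to `S_C × S_C`. -/
def PiFibre (S : Type u) [CommRing S] [Algebra R S] (a b : C) : Type u :=
  {t : RelatedTriple R C S // t.t₃ 1 = (1 : S) ⊗ₜ[R] a ∧ t.t₂ 1 = (1 : S) ⊗ₜ[R] b}

section BaseChange

variable {S T U : Type u} [CommRing S] [Algebra R S] [CommRing T] [Algebra R T]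
  {a b : C}

/-- The map `Π⁻¹(a, b)(S) → Π⁻¹(a, b)(T)` induced by a morphism `S → T` of `R`-rings. -/
noncomputable def PiFibre.map (φ : S →ₐ[R] T) (t : PiFibre R S a b) : PiFibre R T a b :=
  ⟨t.1.map φ, by
    change extendAut C φ t.1.t₃ 1 = _
    rw [← restr_one φ, extendAut_restr, t.2.1, restr_tmul, map_one], by
    change extendAut C φ t.1.t₂ 1 = _
    rw [← restr_one φ, extendAut_restr, t.2.2, restr_tmul, map_one]⟩

/-- `t' = tg`, where an automorphism `g` of `C_S` is identified with the triple `(g, g, g)`. -/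
def PiFibre.IsTranslate (t : PiFibre R S a b) (g : S ⊗[R] C ≃ₗ[S] S ⊗[R] C) (t' : PiFibre R S a b) :
    Prop :=
  t'.1.t₁ = t.1.t₁ * g ∧ t'.1.t₂ = t.1.t₂ * g ∧ t'.1.t₃ = t.1.t₃ * g

end BaseChange

variable (R) in
/-- The relation `(t, x) ∼ (tg, g⁻¹(x))`, for automorphisms `g` of `C_S`. -/
def twistSetoid (S : Type u) [CommRing S] [Algebra R S] (a b : C) :
    Setoid (PiFibre R S a b × (S ⊗[R] C)) where
  r p p' := ∃ g ∈ octonionAut R C S, PiFibre.IsTranslate p.1 g p'.1 ∧ p.2 = g p'.2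
  iseqv :=
    { refl p := ⟨1, one_mem _, ⟨rfl, rfl, rfl⟩, rfl⟩
      symm := by
        rintro p p' ⟨g, hg, ⟨h₁, h₂, h₃⟩, hx⟩
        refine ⟨g⁻¹, inv_mem hg, ⟨by rw [h₁, mul_inv_cancel_right], by
          rw [h₂, mul_inv_cancel_right], by rw [h₃, mul_inv_cancel_right]⟩, ?_⟩
        rw [hx]
        exact (g.symm_apply_apply _).symm
      trans := by
        rintro p p' p'' ⟨g, hg, ⟨h₁, h₂, h₃⟩, hx⟩ ⟨g', hg', ⟨h₁', h₂', h₃'⟩, hx'⟩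
        exact ⟨g * g', mul_mem hg hg', ⟨by rw [h₁', h₁, mul_assoc], by rw [h₂', h₂, mul_assoc], by
          rw [h₃', h₃, mul_assoc]⟩, by rw [hx, hx']; rfl⟩ }

end Octonions

/-! ### The twist and the isotope as functors on `R`-rings -/

section Twist

variable {R C : Type u} [CommRing R] [NonAssocRing C] [Module R C]
  [IsScalarTower R C C] [SMulCommClass R C C]

variable (R) in
/-- The functor `W(A) : S ↦ A_S = S ⊗ A` of an `R`-algebra `A` (lifted to a larger universe). -/
noncomputable def algebraFunctor (A : Type u) [NonUnitalNonAssocRing A] [Module R A] :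
    CommAlgCat.{u} R ⥤ Type (u + 1) where
  obj S := ULift.{u + 1} (S ⊗[R] A)
  map φ := TypeCat.ofHom fun x => ULift.up (restr A φ.hom x.down)
  map_id S := by
    ext x
    exact restr_id A x.down
  map_comp φ ψ := by
    ext x
    exact restr_comp φ.hom ψ.hom A x.down

variable (R) in
/-- The algebra operations of `A_S`. -/
noncomputable def algebraFunctorOps (A : Type u) [NonUnitalNonAssocRing A] [Module R A]
    [IsScalarTower R A A] [SMulCommClass R A A] : AlgebraOps (algebraFunctor R A) where
  add _ x y := ULift.up (x.down + y.down)
  mul _ x y := ULift.up (x.down * y.down)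
  smul _ s x := ULift.up (s • x.down)
  map_add φ x y := congrArg ULift.up (map_add (restr A φ.hom) x.down y.down)
  map_mul φ x y := congrArg ULift.up (restr_mul φ.hom A x.down y.down)
  map_smul φ s x := congrArg ULift.up (restr_smul φ.hom A s x.down)

variable [OctonionAlgebra R C]

section Ops

variable {S : Type u} [CommRing S] [Algebra R S] {a b : C}

/-- The pairs `(t, x)` with `t ∈ Π⁻¹(a, b)(S)` and `x ∈ C_S`, modulo `(t, x) ∼ (tg, g⁻¹(x))`. -/
def PreTwist (R : Type u) {C : Type u} [CommRing R] [NonAssocRing C] [Module R C]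
    [IsScalarTower R C C] [SMulCommClass R C C] [OctonionAlgebra R C]
    (S : Type u) [CommRing S] [Algebra R S] (a b : C) : Type u :=
  Quotient (twistSetoid R S a b)

namespace PreTwist

/-- The class of a pair `(t, x)`. -/
def mk (t : PiFibre R S a b) (x : S ⊗[R] C) : PreTwist R S a b :=
  Quotient.mk (twistSetoid R S a b) (t, x)

/-- `(t, x) + (t', x') = (t, x + t₁⁻¹t₁'(x'))`. -/
def add : PreTwist R S a b → PreTwist R S a b → PreTwist R S a b :=
  Quotient.map₂ (fun p p' => (p.1, p.2 + p.1.1.t₁.symm (p'.1.1.t₁ p'.2))) (by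
    rintro ⟨t, x⟩ ⟨u, y⟩ ⟨g, hg, ht, hx⟩ ⟨t', x'⟩ ⟨u', y'⟩ ⟨g', hg', ht', hx'⟩
    refine ⟨g, hg, ht, ?_⟩
    dsimp only at ht hx ht' hx' ⊢
    rw [hx, hx', map_add, ht.1, ht'.1]
    congr 1
    rw [LinearEquiv.symm_apply_eq]
    exact ((t.1.t₁ * g).apply_symm_apply _).symm)

/-- `(t, x) · (t', x') = (t, x t₁⁻¹t₁'(x'))`. -/
def mul : PreTwist R S a b → PreTwist R S a b → PreTwist R S a b :=
  Quotient.map₂ (fun p p' => (p.1, p.2 * p.1.1.t₁.symm (p'.1.1.t₁ p'.2))) (by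
    rintro ⟨t, x⟩ ⟨u, y⟩ ⟨g, hg, ht, hx⟩ ⟨t', x'⟩ ⟨u', y'⟩ ⟨g', hg', ht', hx'⟩
    refine ⟨g, hg, ht, ?_⟩
    dsimp only at ht hx ht' hx' ⊢
    rw [hx, hx', hg, ht.1, ht'.1]
    congr 1
    rw [LinearEquiv.symm_apply_eq]
    exact ((t.1.t₁ * g).apply_symm_apply _).symm)

/-- `s(t, x) = (t, sx)`. -/
def smul (s : S) : PreTwist R S a b → PreTwist R S a b :=
  Quotient.map (fun p => (p.1, s • p.2)) (by
    rintro ⟨t, x⟩ ⟨u, y⟩ ⟨g, hg, ht, hx⟩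
    refine ⟨g, hg, ht, ?_⟩
    dsimp only at hx ⊢
    rw [hx, map_smul])

/-- The map induced by a morphism `S → T` of `R`-rings. -/
noncomputable def map {T : Type u} [CommRing T] [Algebra R T] (φ : S →ₐ[R] T) :
    PreTwist R S a b → PreTwist R T a b :=
  Quotient.map (fun p => (p.1.map φ, restr C φ p.2)) (by
    rintro ⟨t, x⟩ ⟨u, y⟩ ⟨g, hg, ⟨h₁, h₂, h₃⟩, hx⟩
    refine ⟨extendAut C φ g, octonionAut.extendAut_mem hg φ, ⟨?_, ?_, ?_⟩, ?_⟩
    · exact (congrArg (extendAut C φ) h₁).trans (extendAut_mul φ C _ _)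
    · exact (congrArg (extendAut C φ) h₂).trans (extendAut_mul φ C _ _)
    · exact (congrArg (extendAut C φ) h₃).trans (extendAut_mul φ C _ _)
    · dsimp only at hx ⊢
      rw [hx, extendAut_restr])

end PreTwist

end Ops

variable (R) in
/-- The functor whose associated fppf sheaf is the twist of `C` by `Π⁻¹(a, b)`:
`S ↦ (Π⁻¹(a, b)(S) × C_S)/∼` (lifted to a larger universe). -/
noncomputable def preTwistFunctor (a b : C) : CommAlgCat.{u} R ⥤ Type (u + 1) where
  obj S := ULift.{u + 1} (PreTwist R S a b)
  map φ := TypeCat.ofHom fun x => ULift.up (PreTwist.map φ.hom x.down)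
  map_id S := by
    ext ⟨x⟩
    obtain ⟨⟨t, x⟩, rfl⟩ := Quotient.exists_rep x
    refine congrArg (fun z => Quotient.mk (twistSetoid R S a b) z) (Prod.ext (Subtype.ext
      (RelatedTriple.ext ?_ ?_ ?_)) (restr_id C x))
    all_goals exact extendAut_id C _
  map_comp {S T U} φ ψ := by
    ext ⟨x⟩
    obtain ⟨⟨t, x⟩, rfl⟩ := Quotient.exists_rep x
    refine congrArg (fun z => Quotient.mk (twistSetoid R U a b) z) (Prod.ext (Subtype.ext
      (RelatedTriple.ext ?_ ?_ ?_)) (restr_comp φ.hom ψ.hom C x))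
    all_goals exact extendAut_comp φ.hom ψ.hom C _

variable (R) in
/-- The operations on `(Π⁻¹(a, b)(S) × C_S)/∼`. -/
noncomputable def preTwistOps (a b : C) : AlgebraOps (preTwistFunctor R a b) where
  add _ x y := ULift.up (x.down.add y.down)
  mul _ x y := ULift.up (x.down.mul y.down)
  smul _ s x := ULift.up (x.down.smul s)
  map_add {S T} φ x y := by
    obtain ⟨x⟩ := x
    obtain ⟨y⟩ := y
    obtain ⟨⟨t, x⟩, rfl⟩ := Quotient.exists_rep x
    obtain ⟨⟨u, y⟩, rfl⟩ := Quotient.exists_rep y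
    refine congrArg (fun z => ULift.up (Quotient.mk (twistSetoid R T a b) (t.map φ.hom, z))) ?_
    refine (map_add (restr C φ.hom) _ _).trans (congrArg (restr C φ.hom x + ·) ?_)
    change _ = (extendAut C φ.hom t.1.t₁).symm (extendAut C φ.hom u.1.t₁ (restr C φ.hom y))
    rw [extendAut_restr, extendAut_symm_restr]
  map_mul {S T} φ x y := by
    obtain ⟨x⟩ := x
    obtain ⟨y⟩ := y
    obtain ⟨⟨t, x⟩, rfl⟩ := Quotient.exists_rep x
    obtain ⟨⟨u, y⟩, rfl⟩ := Quotient.exists_rep y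
    refine congrArg (fun z => ULift.up (Quotient.mk (twistSetoid R T a b) (t.map φ.hom, z))) ?_
    refine (restr_mul φ.hom C _ _).trans (congrArg (restr C φ.hom x * ·) ?_)
    change _ = (extendAut C φ.hom t.1.t₁).symm (extendAut C φ.hom u.1.t₁ (restr C φ.hom y))
    rw [extendAut_restr, extendAut_symm_restr]
  map_smul {S T} φ s x := by
    obtain ⟨x⟩ := x
    obtain ⟨⟨t, x⟩, rfl⟩ := Quotient.exists_rep x
    exact congrArg (fun z => ULift.up (Quotient.mk (twistSetoid R T a b) (t.map φ.hom, z)))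
      (restr_smul φ.hom C s x)

variable (R) in
/-- The twist of `C` by `Π⁻¹(a, b)`: the fppf sheaf associated to
`S ↦ (Π⁻¹(a, b)(S) × C_S)/∼`. -/
noncomputable def twist (a b : C) : CommAlgCat.{u} R ⥤ Type (u + 1) :=
  fppfSheafify (preTwistFunctor R a b)

variable (R) in
/-- The algebra operations of the twist. -/
noncomputable def twistOps (a b : C) : AlgebraOps (twist R a b) :=
  (preTwistOps R a b).sheafify

/-- The section of the twist over `S` defined by a pair `(t, x)`. -/
noncomputable def twistClass {a b : C} (S : CommAlgCat.{u} R) (t : PiFibre R S a b)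
    (x : S ⊗[R] C) : (twist R a b).obj S :=
  (toFppfSheafify (preTwistFunctor R a b)).app S (ULift.up (PreTwist.mk t x))

/-- An element of `C_S`, regarded as an element of `(C^{a,b})_S`, that is of `W(C^{a,b})(S)`. -/
noncomputable def toIsotope (a b : C) (S : CommAlgCat.{u} R) (x : S ⊗[R] C) :
    (algebraFunctor R (Isotope a b)).obj S :=
  ULift.up ((Isotope.of R a b).toLinearMap.baseChange S x)

end Twist

/-! Conjugating `t₂` and `t₃` by the involution turns a related triple into an autotopy `t₁(xy) =
t₂(x)t₃(y)` whose three components are isometries, and the fibre over `(a, b)` prescribes the values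
at `1` of `t₂` and `t₃`. Two autotopies with the same values differ by `g = t₁⁻¹t₁'`; putting `1` in
either factor shows that `g` is also `t₂⁻¹t₂'` and `t₃⁻¹t₃'`, so it is an automorphism
(`IsIsometricAutotopy.eq_mul`). This is the torsor property.

Points of the fibre exist Zariski locally. The Moufang identities make multiplications into
autotopies, and two of them composed carry the pair of values `(1, z)` to `(1, w)` once some
octonion of invertible norm is orthogonal to `1` and `z w̄` (`IsReachable.trans_one`). A route
through an auxiliary `w` works near every prime, by dimension counts over the residue field
(`exists_transitivity_data`), and a finite product of localisations collects the local solutions.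

The components must moreover be special orthogonal, and this is automatic. The Clifford algebra of
the norm acts on `C × C`, and `(t₁, t₃)` intertwines this action with its twist by `t₂`. The centre
of the even part acts by right multiplication with nuclear elements. These behave as scalars and so
commute with `(t₁, t₃)`; since the action is faithful on the even part, `t₂` fixes the centre
(`IsIsometricAutotopy.actsTriviallyOnCentre`). Rotating the autotopy treats the other components.

Finally `t₁(x)a = t₂(x)` and `b t₁(y) = t₃(y)` for the conjugated components, so `t₁` is an
isomorphism from `C_S` onto the isotope. On classes of pairs, `(t, x) ↦ t₁(x)` is injective by the
torsor property and locally surjective by local existence. Its target is a sheaf by faithfully flat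
descent, so it becomes an isomorphism after sheafification (`W_preTwistHom`, `exists_twistIso`),
which also carries the unital algebra structure back to the twist. -/

/-! ### Identities in octonion algebras -/

section OctonionIdentities

variable (R : Type u) {C : Type u} [CommRing R] [NonAssocRing C] [Module R C]
  [IsScalarTower R C C] [SMulCommClass R C C] [OctonionAlgebra R C]

/-- The norm of an octonion. -/
abbrev octNorm (x : C) : R := OctonionAlgebra.norm (R := R) (C := C) x

/-- The polar form of the norm of an octonion algebra. -/
def octPolar (x y : C) : R := QuadraticMap.polarBilin (OctonionAlgebra.norm (R := R) (C := C)) x y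

namespace OctonionAlgebra

theorem polar_eq (x y : C) : octPolar R x y = octNorm R (x + y) - octNorm R x - octNorm R y := rfl

theorem norm_add (x y : C) : octNorm R (x + y) = octNorm R x + octNorm R y + octPolar R x y := by
  rw [polar_eq]; ring

theorem norm_smul (r : R) (x : C) : octNorm R (r • x) = r * r * octNorm R x :=
  QuadraticMap.map_smul _ r x

theorem norm_mul' (x y : C) : octNorm R (x * y) = octNorm R x * octNorm R y :=
  OctonionAlgebra.norm_mul x y

theorem polar_comm (x y : C) : octPolar R x y = octPolar R y x := QuadraticMap.polar_comm _ x y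

@[simp] theorem polar_add_left (x y z : C) :
    octPolar R (x + y) z = octPolar R x z + octPolar R y z := QuadraticMap.polar_add_left _ _ _ _

@[simp] theorem polar_add_right (x y z : C) :
    octPolar R x (y + z) = octPolar R x y + octPolar R x z := QuadraticMap.polar_add_right _ _ _ _

@[simp] theorem polar_sub_left (x y z : C) :
    octPolar R (x - y) z = octPolar R x z - octPolar R y z := QuadraticMap.polar_sub_left _ _ _ _

@[simp] theorem polar_sub_right (x y z : C) :
    octPolar R x (y - z) = octPolar R x y - octPolar R x z := QuadraticMap.polar_sub_right _ _ _ _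

@[simp] theorem polar_neg_right (x y : C) : octPolar R x (-y) = -octPolar R x y :=
  QuadraticMap.polar_neg_right _ _ _

@[simp] theorem polar_smul_left (r : R) (x y : C) : octPolar R (r • x) y = r * octPolar R x y :=
  QuadraticMap.polar_smul_left _ _ _ _

@[simp] theorem polar_smul_right (r : R) (x y : C) : octPolar R x (r • y) = r * octPolar R x y :=
  QuadraticMap.polar_smul_right _ _ _ _

@[simp] theorem polar_zero_left (x : C) : octPolar R 0 x = 0 := QuadraticMap.polar_zero_left _ _

@[simp] theorem polar_zero_right (x : C) : octPolar R x 0 = 0 := QuadraticMap.polar_zero_right _ _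

theorem polar_self (x : C) : octPolar R x x = 2 * octNorm R x := by
  rw [octPolar, QuadraticMap.polarBilin_apply_apply, QuadraticMap.polar_self, two_nsmul, two_mul]

variable {R} in
theorem polar_ext {x y : C} (h : ∀ z, octPolar R x z = octPolar R y z) : x = y :=
  OctonionAlgebra.regular.1 (LinearMap.ext h)

theorem exists_polar_eq (f : C →ₗ[R] R) : ∃ x : C, ∀ y, octPolar R x y = f y := by
  obtain ⟨x, hx⟩ := OctonionAlgebra.regular.2 f
  exact ⟨x, fun y => LinearMap.congr_fun hx y⟩

/-- Since the rank is `8 > 0` everywhere, every prime lies in the support of `C` and contains the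
annihilator of some element. -/
theorem mem_prime_of_smul_eq_zero {r : R} (h : ∀ x : C, r • x = 0) (p : PrimeSpectrum R) :
    r ∈ p.asIdeal := by
  have hp : p ∈ Module.support R C := by
    rw [← Module.rankAtStalk_pos_iff_mem_support, OctonionAlgebra.rank_eq]
    norm_num
  rw [Module.mem_support_iff_exists_annihilator] at hp
  obtain ⟨m, hm⟩ := hp
  refine hm ?_
  rw [Submodule.mem_annihilator]
  exact fun n _ => h n

-- Multiplicativity and regularity make `1 - q(1)` annihilate `C`, hence nilpotent by the positive
-- rank; it is also idempotent, so it vanishes.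
variable (C) in
@[simp] theorem norm_one : octNorm R (1 : C) = 1 := by
  have h1 (x : C) : octNorm R (1 : C) * octNorm R x = octNorm R x := by
    rw [← norm_mul', one_mul]
  have h2 (x : C) : (1 - octNorm R (1 : C)) • x = 0 := by
    refine polar_ext (R := R) fun z => ?_
    rw [polar_smul_left, polar_zero_left, polar_eq]
    linear_combination -h1 (x + z) + h1 x + h1 z
  have h3 : IsNilpotent (1 - octNorm R (1 : C)) := by
    rw [nilpotent_iff_mem_prime]
    exact fun J hJ => mem_prime_of_smul_eq_zero R h2 ⟨J, hJ⟩
  have h4 : IsIdempotentElem (1 - octNorm R (1 : C)) := by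
    have := h1 1
    unfold IsIdempotentElem
    linear_combination this
  obtain ⟨n, hn⟩ := h3
  have h5 : 1 - octNorm R (1 : C) = 0 := by
    rcases n with _ | n
    · have h10 : (1 : R) = 0 := by simpa using hn
      rw [← one_mul (1 - _), h10, zero_mul]
    · rwa [h4.pow_succ_eq] at hn
  linear_combination -h5

theorem polar_mul_mul_left (x y z : C) :
    octPolar R (x * y) (x * z) = octNorm R x * octPolar R y z := by
  simp only [polar_eq, ← mul_add, norm_mul']; ring

theorem polar_mul_mul_right (x y z : C) :
    octPolar R (x * z) (y * z) = octPolar R x y * octNorm R z := by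
  simp only [polar_eq, ← add_mul, norm_mul']; ring

/-- Linearisation of `polar_mul_mul_left` in its left factor. The adjunctions and Moufang identities
below all come from this exchange law and nondegeneracy. -/
theorem polar_mul_add (x y z w : C) :
    octPolar R (x * y) (z * w) + octPolar R (x * w) (z * y) = octPolar R x z * octPolar R y w := by
  have h := polar_mul_mul_left R (x + z) y w
  rw [norm_add, add_mul, add_mul, polar_add_left, polar_add_right, polar_add_right,
    polar_mul_mul_left, polar_mul_mul_left, polar_comm R (z * y)] at h
  linear_combination h

theorem conj_apply (x : C) : octonionConj R C x = octPolar R x 1 • (1 : C) - x := rfl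

/-- The exchange law with one factor equal to `1`: conjugation gives the adjoint of a
multiplication. -/
theorem polar_mul_left (x y z : C) :
    octPolar R (x * y) z = octPolar R y (octonionConj R C x * z) := by
  have h := polar_mul_add R x y 1 z
  rw [one_mul, one_mul] at h
  rw [conj_apply, sub_mul, smul_mul_assoc, one_mul, polar_sub_right, polar_smul_right,
    polar_comm R y (x * z)]
  linear_combination h

theorem polar_mul_right (x y z : C) :
    octPolar R (x * y) z = octPolar R x (z * octonionConj R C y) := by
  have h := polar_mul_add R x y z 1
  rw [mul_one, mul_one] at h
  rw [conj_apply, mul_sub, mul_smul_comm, mul_one, polar_sub_right, polar_smul_right]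
  linear_combination h

@[simp] theorem conj_one : octonionConj R C (1 : C) = 1 := by
  rw [conj_apply, polar_self, norm_one, mul_one, two_smul]; abel

@[simp] theorem conj_conj (x : C) : octonionConj R C (octonionConj R C x) = x := by
  rw [conj_apply R x, map_sub, map_smul, conj_one, conj_apply]; abel

@[simp] theorem polar_conj_one (x : C) : octPolar R (octonionConj R C x) 1 = octPolar R x 1 := by
  rw [conj_apply, polar_sub_left, polar_smul_left, polar_self, norm_one]; ring

@[simp] theorem norm_conj (x : C) : octNorm R (octonionConj R C x) = octNorm R x := by
  rw [conj_apply, sub_eq_add_neg, norm_add, norm_smul, norm_one, polar_smul_left, polar_neg_right,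
    polar_comm R 1 x, octNorm, QuadraticMap.map_neg]
  ring

theorem polar_conj_conj (x y : C) :
    octPolar R (octonionConj R C x) (octonionConj R C y) = octPolar R x y := by
  simp only [polar_eq, ← map_add, norm_conj]

theorem polar_conj_left (x y : C) :
    octPolar R (octonionConj R C x) y = octPolar R x (octonionConj R C y) := by
  rw [← polar_conj_conj, conj_conj]

/-- Pair with an arbitrary `z` and move the outer factor across by adjunction; what remains is
multiplicativity of the norm. -/
theorem conj_mul_mul (x y : C) : octonionConj R C x * (x * y) = octNorm R x • y := by
  refine polar_ext (R := R) fun z => ?_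
  rw [polar_mul_left, conj_conj, polar_mul_mul_left, polar_smul_left]

theorem mul_conj_mul (x y : C) : x * (octonionConj R C x * y) = octNorm R x • y := by
  conv_lhs => rw [← conj_conj R x]
  rw [conj_conj R (octonionConj R C x), conj_mul_mul, norm_conj]

theorem mul_mul_conj (x y : C) : (x * y) * octonionConj R C y = octNorm R y • x := by
  refine polar_ext (R := R) fun z => ?_
  rw [polar_mul_right, conj_conj, polar_mul_mul_right, polar_smul_left, mul_comm]

theorem mul_conj_mul' (x y : C) : (x * octonionConj R C y) * y = octNorm R y • x := by
  conv_lhs => rw [← conj_conj R y]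
  rw [conj_conj R (octonionConj R C y), mul_mul_conj, norm_conj]

theorem conj_mul_self (x : C) : octonionConj R C x * x = octNorm R x • (1 : C) := by
  simpa using conj_mul_mul R x 1

theorem mul_conj_self (x : C) : x * octonionConj R C x = octNorm R x • (1 : C) := by
  simpa using mul_mul_conj R 1 x

theorem polar_mul_conj (x y z : C) :
    octPolar R x (y * octonionConj R C z) = octPolar R (x * z) y := by
  rw [polar_mul_right]

theorem polar_conj_mul (x y z : C) :
    octPolar R x (octonionConj R C y * z) = octPolar R (y * x) z := by
  rw [polar_mul_left]

theorem conj_mul (x y : C) :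
    octonionConj R C (x * y) = octonionConj R C y * octonionConj R C x := by
  refine polar_ext (R := R) fun z => ?_
  rw [polar_conj_left, polar_mul_left, ← conj_conj R (octonionConj R C z), ← conj_conj R z,
    polar_comm, conj_conj R (octonionConj R C z), conj_conj R z, polar_comm, polar_mul_conj,
    polar_mul_left, polar_comm]

/-- The right-hand side involves `x` and `y` only through `x * y`, so this closed form contains the
middle Moufang identity. -/
theorem mul_mul_mul_eq (c x y : C) : (c * x) * (y * c) =
    octPolar R (x * y) (octonionConj R C c) • c - octNorm R c • octonionConj R C (x * y) := by
  refine polar_ext (R := R) fun z => ?_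
  have h := polar_mul_add R c x z (octonionConj R C c * octonionConj R C y)
  have h1 : octPolar R (c * (octonionConj R C c * octonionConj R C y)) (z * x) =
      octNorm R c * octPolar R (octonionConj R C y * octonionConj R C x) z := by
    rw [mul_conj_mul, polar_smul_left, polar_comm R (octonionConj R C y), polar_mul_right,
      polar_comm R z]
  rw [polar_mul_right R (c * x) (y * c), conj_mul, conj_mul, polar_sub_left, polar_smul_left,
    polar_smul_left, ← polar_mul_conj R x (octonionConj R C c) y]
  linear_combination h - h1

theorem mul_mul_self_eq (c x : C) : (c * x) * c =
    octPolar R x (octonionConj R C c) • c - octNorm R c • octonionConj R C x := by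
  simpa using mul_mul_mul_eq R c x 1

/-- The left Moufang identity. -/
theorem moufang_left (c x y : C) :
    ((c * x) * c) * (octonionConj R C c * y) = octNorm R c • (c * (x * y)) := by
  refine polar_ext (R := R) fun z => ?_
  -- Tested against `z`, the left side is the first term of this exchange law. The cross term has
  -- the closed form of `mul_mul_mul_eq`, and the remaining equations expand `z̄` and `ȳ` as trace
  -- minus element.
  have h := polar_mul_add R (c * x) c z (octonionConj R C y * c)
  have e1 : octPolar R ((c * x) * c * (octonionConj R C c * y)) z =
      octPolar R ((c * x) * c) (z * (octonionConj R C y * c)) := by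
    rw [polar_mul_right, conj_mul, conj_conj]
  have e2 : octPolar R c (octonionConj R C y * c) = octNorm R c * octPolar R y 1 := by
    rw [polar_comm, ← polar_conj_one R y, polar_comm R _ (1 : C), mul_comm, polar_comm R (1 : C),
      ← polar_mul_mul_right, one_mul]
  have e3 : octPolar R (c * x * (octonionConj R C y * c)) (z * c) =
      octPolar R (x * octonionConj R C y) (octonionConj R C c) * (octPolar R z 1 * octNorm R c) -
      octNorm R c * octPolar R (y * octonionConj R C x) (z * c) := by
    rw [mul_mul_mul_eq R, polar_sub_left, polar_smul_left, polar_smul_left, conj_mul, conj_conj,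
      ← polar_mul_mul_right, one_mul, polar_comm R c]
  have e4 : octPolar R (y * octonionConj R C x) (z * c) =
      octPolar R (x * octonionConj R C y) (octonionConj R C c * octonionConj R C z) := by
    rw [← polar_conj_conj, conj_mul, conj_mul, conj_conj]
  have e5 : octPolar R (x * octonionConj R C y) (octonionConj R C c * octonionConj R C z) =
      octPolar R z 1 * octPolar R (x * octonionConj R C y) (octonionConj R C c) -
      octPolar R (c * (x * octonionConj R C y)) z := by
    rw [conj_apply R z, mul_sub, mul_smul_comm, mul_one, polar_sub_right, polar_smul_right,
      polar_conj_mul]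
  have e6 : octPolar R (c * (x * octonionConj R C y)) z =
      octPolar R y 1 * octPolar R (c * x) z - octPolar R (c * (x * y)) z := by
    rw [conj_apply R y, mul_sub, mul_smul_comm, mul_one, mul_sub, mul_smul_comm, polar_sub_left,
      polar_smul_left]
  rw [polar_smul_left, e1]
  linear_combination h - e3 + octPolar R (c * x) z * e2 + octNorm R c * (e4 + e5 - e6)

end OctonionAlgebra

/-- Both `x̄(xy)` and `(x̄x)y` equal `q(x)y`; replacing `x̄` by trace minus `x` cancels the trace
terms and leaves the alternative law. -/
theorem OctonionAlgebra.mul_self_mul (R : Type u) {C : Type u} [CommRing R] [NonAssocRing C]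
    [Module R C] [IsScalarTower R C C] [SMulCommClass R C C] [OctonionAlgebra R C] (x y : C) :
    x * (x * y) = (x * x) * y := by
  have h := conj_mul_mul R x y
  have h' := congrArg (· * y) (conj_mul_self R x)
  simp only [conj_apply, sub_mul, smul_mul_assoc, one_mul] at h h'
  rw [← h'] at h
  exact sub_right_injective h

theorem OctonionAlgebra.mul_mul_self (R : Type u) {C : Type u} [CommRing R] [NonAssocRing C]
    [Module R C] [IsScalarTower R C C] [SMulCommClass R C C] [OctonionAlgebra R C] (x y : C) :
    (y * x) * x = y * (x * x) := by
  have h := mul_mul_conj R y x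
  have h' := congrArg (y * ·) (mul_conj_self R x)
  simp only [conj_apply, mul_sub, mul_smul_comm, mul_one] at h h'
  rw [← h'] at h
  exact sub_right_injective h

/-- The middle Moufang identity. -/
theorem OctonionAlgebra.moufang_mid (R : Type u) {C : Type u} [CommRing R] [NonAssocRing C]
    [Module R C] [IsScalarTower R C C] [SMulCommClass R C C] [OctonionAlgebra R C] (c x y : C) :
    (c * x) * (y * c) = (c * (x * y)) * c := by
  rw [mul_mul_self_eq R c, mul_mul_mul_eq R]

end OctonionIdentities

/-! ### Base change of octonion algebras -/

section OctonionBaseChange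

/-- The bilinear form chosen to define the extension need not be symmetric, but its symmetrisation
is the polar form, which does not depend on the choice. -/
theorem QuadraticForm.polar_extendScalars_tmul {R : Type u} {M : Type v} [CommRing R]
    [AddCommGroup M] [Module R M] [Module.Projective R M] (q : QuadraticForm R M)
    (S : Type w) [CommRing S] [Algebra R S] (s t : S) (x y : M) :
    QuadraticMap.polarBilin (q.extendScalars S) (s ⊗ₜ x) (t ⊗ₜ y) =
      s * t * algebraMap R S (QuadraticMap.polarBilin q x y) := by
  have h : ∀ x y, q.exists_bilin.choose x y + q.exists_bilin.choose y x =
      QuadraticMap.polarBilin q x y := fun x y => by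
    conv_rhs => rw [← q.exists_bilin.choose_spec]
    rw [LinearMap.BilinMap.polarBilin_toQuadraticMap]
    rfl
  rw [QuadraticForm.extendScalars, LinearMap.BilinMap.polarBilin_toQuadraticMap,
    LinearMap.add_apply, LinearMap.add_apply, LinearMap.flip_apply,
    LinearMap.BilinForm.baseChange_tmul, LinearMap.BilinForm.baseChange_tmul, ← h]
  simp only [Algebra.smul_def, map_add]
  ring

theorem exists_dual_generators (R M : Type*) [CommRing R] [AddCommGroup M] [Module R M]
    [Module.Finite R M] [Module.Projective R M] :
    ∃ (n : ℕ) (e : Fin n → M) (f : Fin n → M →ₗ[R] R), ∀ x, x = ∑ i, f i x • e i := by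
  obtain ⟨n, f, g, -, -, h⟩ := Module.Finite.exists_comp_eq_id_of_projective R M
  refine ⟨n, fun i => f (Pi.single i 1), fun i => LinearMap.proj i ∘ₗ g, fun x => ?_⟩
  conv_lhs => rw [← LinearMap.id_apply (R := R) x, ← h, LinearMap.comp_apply,
    ← Finset.univ_sum_single (g x), map_sum]
  refine Finset.sum_congr rfl fun i _ => ?_
  rw [← map_smul, ← Pi.single_smul, smul_eq_mul, mul_one]
  rfl

theorem one_tmul_mul {R C S : Type*} [CommRing R] [NonUnitalNonAssocRing C] [Module R C]
    [IsScalarTower R C C] [SMulCommClass R C C] [CommRing S] [Algebra R S] (x y : C) :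
    (1 : S) ⊗ₜ[R] (x * y) = (1 ⊗ₜ x) * (1 ⊗ₜ y) := by
  rw [Algebra.TensorProduct.tmul_mul_tmul, one_mul]

variable {R C : Type u} [CommRing R] [NonAssocRing C] [Module R C]
  [IsScalarTower R C C] [SMulCommClass R C C] [OctonionAlgebra R C]
  (S : Type u) [CommRing S] [Algebra R S]

namespace OctonionAlgebra

variable (R C) in
/-- The polar form of `q_S`. -/
noncomputable def polarOver : LinearMap.BilinForm S (S ⊗[R] C) :=
  QuadraticMap.polarBilin (normOver R C S)

theorem polarOver_tmul (s t : S) (x y : C) :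
    polarOver R C S (s ⊗ₜ x) (t ⊗ₜ y) = s * t * algebraMap R S (octPolar R x y) :=
  QuadraticForm.polar_extendScalars_tmul _ _ _ _ _ _

theorem normOver_tmul (s : S) (x : C) :
    normOver R C S (s ⊗ₜ x) = s * s * algebraMap R S (octNorm R x) :=
  QuadraticForm.extendScalars_tmul _ _ _ _

theorem normOver_add (x y : S ⊗[R] C) :
    normOver R C S (x + y) = normOver R C S x + normOver R C S y + polarOver R C S x y := by
  rw [polarOver, QuadraticMap.polarBilin_apply_apply, QuadraticMap.polar]; ring

theorem polarOver_mul_add (x y z w : S ⊗[R] C) :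
    polarOver R C S (x * y) (z * w) + polarOver R C S (x * w) (z * y) =
      polarOver R C S x z * polarOver R C S y w := by
  induction x with
  | zero => simp
  | add x x' h h' => simp only [add_mul, map_add, LinearMap.add_apply]; linear_combination h + h'
  | tmul s x =>
  induction y with
  | zero => simp
  | add y y' h h' =>
    simp only [mul_add, map_add, LinearMap.add_apply]; linear_combination h + h'
  | tmul t y =>
  induction z with
  | zero => simp
  | add z z' h h' =>
    simp only [add_mul, map_add]; linear_combination h + h'
  | tmul s' z =>
  induction w with
  | zero => simp
  | add w w' h h' =>
    simp only [mul_add, map_add, LinearMap.add_apply]; linear_combination h + h'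
  | tmul t' w =>
  simp only [Algebra.TensorProduct.tmul_mul_tmul, polarOver_tmul]
  have h := congrArg (algebraMap R S) (polar_mul_add R x y z w)
  simp only [map_add, map_mul] at h
  linear_combination s * t * s' * t' * h

theorem polarOver_mul_mul_right (x y z : S ⊗[R] C) :
    polarOver R C S (x * z) (y * z) = polarOver R C S x y * normOver R C S z := by
  induction z with
  | zero => simp
  | add z z' h h' =>
    have key := polarOver_mul_add S x z y z'
    simp only [mul_add, map_add, LinearMap.add_apply, normOver_add]
    linear_combination h + h' + key
  | tmul t z =>
  induction x with
  | zero => simp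
  | add x x' h h' => simp only [add_mul, map_add, LinearMap.add_apply]; linear_combination h + h'
  | tmul s x =>
  induction y with
  | zero => simp
  | add y y' h h' => simp only [add_mul, map_add]; linear_combination h + h'
  | tmul s' y =>
  simp only [Algebra.TensorProduct.tmul_mul_tmul, polarOver_tmul, normOver_tmul]
  have h := congrArg (algebraMap R S) (polar_mul_mul_right R x y z)
  simp only [map_mul] at h
  linear_combination s * t * s' * t * h

/-- A pure left factor suffices: `normOver_mul` reduces to that case before it splits the right
factor. -/
theorem polarOver_tmul_mul_mul (s : S) (x : C) (y z : S ⊗[R] C) :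
    polarOver R C S (s ⊗ₜ x * y) (s ⊗ₜ x * z) =
      normOver R C S (s ⊗ₜ x) * polarOver R C S y z := by
  induction y with
  | zero => simp
  | add y y' h h' => simp only [mul_add, map_add, LinearMap.add_apply]; linear_combination h + h'
  | tmul t y =>
  induction z with
  | zero => simp
  | add y y' h h' => simp only [mul_add, map_add]; linear_combination h + h'
  | tmul t' z =>
  simp only [Algebra.TensorProduct.tmul_mul_tmul, polarOver_tmul, normOver_tmul]
  have h := congrArg (algebraMap R S) (polar_mul_mul_left R x y z)
  simp only [map_mul] at h
  linear_combination s * t * s * t' * h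

theorem normOver_mul (x y : S ⊗[R] C) :
    normOver R C S (x * y) = normOver R C S x * normOver R C S y := by
  induction x with
  | zero => simp
  | add x x' h h' =>
    rw [add_mul, normOver_add, normOver_add, h, h', polarOver_mul_mul_right]; ring
  | tmul s x =>
  induction y with
  | zero => simp
  | add y y' h h' =>
    rw [mul_add, normOver_add, normOver_add, h, h', polarOver_tmul_mul_mul]; ring
  | tmul t y =>
  rw [Algebra.TensorProduct.tmul_mul_tmul, normOver_tmul, normOver_tmul, normOver_tmul, norm_mul',
    map_mul]
  ring

/-- Represent the functionals of a dual generating system by vectors `vᵢ`. The expansion `x = ∑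
b(vᵢ, x) eᵢ` survives base change; it gives injectivity and an explicit preimage of each functional.
-/
theorem polarOver_bijective : Function.Bijective (polarOver R C S) := by
  obtain ⟨n, e, f, hef⟩ := exists_dual_generators R C
  choose v hv using fun i => exists_polar_eq R (f i)
  have key (x : S ⊗[R] C) :
      x = ∑ i, polarOver R C S (1 ⊗ₜ v i) x • ((1 : S) ⊗ₜ[R] e i) := by
    induction x with
    | zero => simp
    | add x y hx hy =>
      simp only [map_add, add_smul, Finset.sum_add_distrib]
      rw [← hx, ← hy]
    | tmul s x =>
      conv_lhs => rw [hef x, tmul_sum]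
      refine Finset.sum_congr rfl fun i _ => ?_
      rw [polarOver_tmul, hv, one_mul, smul_tmul', smul_eq_mul, mul_one, tmul_smul, smul_tmul',
        Algebra.smul_def, mul_comm]
  constructor
  · rw [← LinearMap.ker_eq_bot, LinearMap.ker_eq_bot']
    intro x hx
    rw [key x]
    refine Finset.sum_eq_zero fun i _ => ?_
    have : polarOver R C S (1 ⊗ₜ v i) x = polarOver R C S x (1 ⊗ₜ v i) :=
      QuadraticMap.polar_comm _ _ _
    rw [this, hx, LinearMap.zero_apply, zero_smul]
  · intro φ
    refine ⟨∑ i, φ (1 ⊗ₜ e i) • (1 ⊗ₜ v i), LinearMap.ext fun x => ?_⟩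
    conv_rhs => rw [key x]
    simp only [map_sum, map_smul, LinearMap.sum_apply, LinearMap.smul_apply, smul_eq_mul, mul_comm]

/-- The base change of an octonion algebra is an octonion algebra. -/
noncomputable instance baseChange : OctonionAlgebra S (S ⊗[R] C) where
  finite := inferInstance
  projective := inferInstance
  rank_eq p := by rw [Module.rankAtStalk_baseChange, OctonionAlgebra.rank_eq]
  norm := normOver R C S
  norm_mul := normOver_mul S
  regular := polarOver_bijective S

theorem octNorm_baseChange (x : S ⊗[R] C) : octNorm S x = normOver R C S x := rfl

theorem octPolar_baseChange (x y : S ⊗[R] C) : octPolar S x y = polarOver R C S x y := rfl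

@[simp] theorem octNorm_one_tmul (x : C) :
    octNorm S ((1 : S) ⊗ₜ[R] x) = algebraMap R S (octNorm R x) := by
  rw [octNorm_baseChange, normOver_tmul, one_mul, one_mul]

@[simp] theorem octPolar_one_tmul (x y : C) :
    octPolar S ((1 : S) ⊗ₜ[R] x) ((1 : S) ⊗ₜ[R] y) = algebraMap R S (octPolar R x y) := by
  rw [octPolar_baseChange, polarOver_tmul, one_mul, one_mul]

theorem octonionConj_baseChange : octonionConj S (S ⊗[R] C) = conjOver R C S := by
  refine TensorProduct.AlgebraTensorModule.curry_injective (LinearMap.ext_ring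
    (LinearMap.ext fun x => ?_))
  change octonionConj S (S ⊗[R] C) (1 ⊗ₜ x) = 1 ⊗ₜ octonionConj R C x
  rw [conj_apply, conj_apply, tmul_sub, Algebra.TensorProduct.one_def, octPolar_one_tmul,
    smul_tmul', tmul_smul, smul_tmul', smul_eq_mul, mul_one, Algebra.smul_def, mul_one]

variable {S} {T : Type u} [CommRing T] [Algebra R T] (φ : S →ₐ[R] T)

theorem octPolar_restr (x y : S ⊗[R] C) :
    octPolar T (restr C φ x) (restr C φ y) = φ (octPolar S x y) := by
  induction x with
  | zero => simp
  | add x x' h h' => simp [h, h']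
  | tmul s x =>
  induction y with
  | zero => simp
  | add y y' h h' => simp [h, h']
  | tmul t y =>
  rw [restr_tmul, restr_tmul, octPolar_baseChange, octPolar_baseChange, polarOver_tmul,
    polarOver_tmul, map_mul, map_mul, AlgHom.commutes]

theorem octNorm_restr (x : S ⊗[R] C) : octNorm T (restr C φ x) = φ (octNorm S x) := by
  induction x with
  | zero => simp
  | add x y hx hy =>
    rw [map_add, norm_add, norm_add, hx, hy, octPolar_restr, map_add, map_add]
  | tmul s x =>
    rw [restr_tmul, octNorm_baseChange, octNorm_baseChange, normOver_tmul, normOver_tmul, map_mul,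
      map_mul, AlgHom.commutes]

/-- The image of `C_S` spans `C_T`. Polarising, the bilinear forms agree on this image and hence
everywhere, and the norm follows by additivity. -/
theorem normOver_eq_of_restr (f : T ⊗[R] C →ₗ[T] T ⊗[R] C)
    (h : ∀ x : S ⊗[R] C, octNorm T (f (restr C φ x)) = octNorm T (restr C φ x))
    (x : T ⊗[R] C) : octNorm T (f x) = octNorm T x := by
  have hp : (QuadraticMap.polarBilin (norm (R := T) (C := T ⊗[R] C))).compl₁₂ f f =
      QuadraticMap.polarBilin (norm (R := T) (C := T ⊗[R] C)) := by
    refine extendEnd_ext C φ fun x => extendEnd_ext C φ fun y => ?_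
    change octPolar T (f (restr C φ x)) (f (restr C φ y)) = octPolar T (restr C φ x) (restr C φ y)
    rw [polar_eq, polar_eq, ← map_add, ← map_add, h, h, h]
  induction x with
  | zero => simp
  | add x y hx hy =>
    have := LinearMap.congr_fun (LinearMap.congr_fun hp x) y
    change octPolar T (f x) (f y) = octPolar T x y at this
    rw [map_add, norm_add, norm_add, hx, hy, this]
  | tmul t x =>
    have : t ⊗ₜ[R] x = t • restr C φ ((1 : S) ⊗ₜ[R] x) := by
      rw [restr_tmul, map_one, TensorProduct.smul_tmul', smul_eq_mul, mul_one]
    rw [this, map_smul, norm_smul, norm_smul, h]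

end OctonionAlgebra

end OctonionBaseChange

/-! ### Octonion algebras over residue fields -/

section OctonionFields

namespace OctonionAlgebra

section Field

variable {K V : Type u} [Field K] [NonAssocRing V] [Module K V]
  [IsScalarTower K V V] [SMulCommClass K V V] [OctonionAlgebra K V]

variable (K V) in
theorem finrank_eq : Module.finrank K V = 8 := by
  have h := OctonionAlgebra.rank_eq (R := K) (C := V) ⊥
  rwa [Module.rankAtStalk_eq_finrank_of_free] at h

/-- The norm does not vanish on the orthogonal complement of at most four vectors, one of which is
not isotropic. -/
theorem exists_orthogonal_norm_ne_zero {n : ℕ} (hn : n ≤ 4) (f : Fin n → V) (i : Fin n)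
    (hi : octNorm K (f i) ≠ 0) :
    ∃ v : V, (∀ j, octPolar K (f j) v = 0) ∧ octNorm K v ≠ 0 := by
  by_contra! h
  let B : LinearMap.BilinForm K V := QuadraticMap.polarBilin (norm (R := K) (C := V))
  have hB : B.Nondegenerate := by
    refine ⟨fun x hx => ?_, fun x hx => ?_⟩
    · exact polar_ext (R := K) fun z => (hx z).trans (polar_zero_left K z).symm
    · exact polar_ext (R := K) fun z =>
        (polar_comm K x z).trans ((hx z).trans (polar_zero_left K z).symm)
  have hB' : B.IsRefl := fun x y hxy => (polar_comm K y x).trans hxy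
  let W := Submodule.span K (Set.range f)
  have hW : Module.finrank K W ≤ 4 :=
    (finrank_range_le_card (R := K) f).trans (by simpa using hn)
  have hv (v : V) (hv : v ∈ B.orthogonal W) : octNorm K v = 0 :=
    h v fun j => hv (f j) (Submodule.subset_span ⟨j, rfl⟩)
  -- The norm is assumed to vanish on the orthogonal complement, so this complement is orthogonal to
  -- itself and lies in the double complement `W`.
  have hle : B.orthogonal W ≤ W := by
    conv_rhs => rw [← LinearMap.BilinForm.orthogonal_orthogonal hB hB' W]
    intro x hx y hy
    change octPolar K y x = 0
    rw [polar_eq, hv _ hx, hv _ hy, hv _ (add_mem hy hx)]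
    simp
  -- The complement has dimension `8 - dim W ≥ 4 ≥ dim W`. Equality would place the anisotropic
  -- vector `f i` in it.
  have heq : B.orthogonal W = W := Submodule.eq_of_le_of_finrank_le hle (by
    rw [LinearMap.BilinForm.finrank_orthogonal hB, finrank_eq K V]; lia)
  exact hi (hv _ (heq.symm ▸ Submodule.subset_span ⟨i, rfl⟩))

end Field

/-! ### Linearised identities, commutators and associators -/

section Linearized

variable (R : Type u) {C : Type u} [CommRing R] [NonAssocRing C] [Module R C]
  [IsScalarTower R C C] [SMulCommClass R C C] [OctonionAlgebra R C]

theorem conj_mul_mul_add (x y z : C) :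
    octonionConj R C x * (y * z) + octonionConj R C y * (x * z) = octPolar R x y • z := by
  have h := conj_mul_mul R (x + y) z
  rw [map_add, add_mul x, add_mul, mul_add, mul_add, conj_mul_mul, conj_mul_mul, norm_add, add_smul,
    add_smul] at h
  rw [← sub_eq_zero] at h ⊢
  rw [← h]; abel

theorem mul_mul_conj_add (x y z : C) :
    (z * x) * octonionConj R C y + (z * y) * octonionConj R C x = octPolar R x y • z := by
  have h := mul_mul_conj R z (x + y)
  rw [map_add, mul_add z, mul_add, add_mul, add_mul, mul_mul_conj, mul_mul_conj, norm_add, add_smul,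
    add_smul] at h
  rw [← sub_eq_zero] at h ⊢
  rw [← h]; abel

theorem mul_conj_add (x y : C) :
    x * octonionConj R C y + y * octonionConj R C x = octPolar R x y • (1 : C) := by
  simpa using mul_mul_conj_add R x y 1

theorem conj_eq_neg {x : C} (h : octPolar R 1 x = 0) : octonionConj R C x = -x := by
  rw [conj_apply, polar_comm, h, zero_smul, zero_sub]

theorem commutator_eq {u v : C} (h1 : octPolar R 1 v = 0) (hu : octPolar R u v = 0) :
    u * v - v * u = ((2 : R) • u - octPolar R u 1 • (1 : C)) * v := by
  have h := mul_conj_add R u v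
  rw [conj_eq_neg R h1, hu, zero_smul, conj_apply, mul_sub, mul_smul_comm, mul_one] at h
  rw [sub_mul, smul_mul_assoc, smul_mul_assoc, one_mul, two_smul, ← sub_eq_zero, ← h]
  simp only [mul_neg]
  abel

theorem norm_commutator {u v : C} (h1 : octPolar R 1 v = 0) (hu : octPolar R u v = 0) :
    octNorm R (u * v - v * u) =
      (4 * octNorm R u - octPolar R u 1 * octPolar R u 1) * octNorm R v := by
  rw [commutator_eq R h1 hu, norm_mul', sub_eq_add_neg, norm_add, ← neg_smul, norm_smul, norm_smul,
    norm_one, polar_smul_left, polar_smul_right]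
  ring

/-- As in Cayley–Dickson doubling, `x l = l x̄` whenever `x` is orthogonal to `l`. The linearised
relation then turns `u(vl)` into `(vu)l`. -/
theorem associator_eq {u v l : C} (h1 : octPolar R 1 l = 0) (hu : octPolar R u l = 0)
    (hv : octPolar R v l = 0) (hvu : octPolar R (v * u) l = 0) :
    associator u v l = (u * v - v * u) * l := by
  have key {x : C} (hx : octPolar R x l = 0) : x * l = l * octonionConj R C x := by
    have h := mul_conj_add R x l
    rw [conj_eq_neg R h1, hx, zero_smul, mul_neg] at h
    exact (neg_add_eq_zero.1 h)
  have h2 := conj_mul_mul_add R (octonionConj R C u) l (octonionConj R C v)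
  have h3 : octPolar R (octonionConj R C u) l = 0 := by
    rw [conj_apply, polar_sub_left, polar_smul_left, h1, hu, mul_zero, sub_zero]
  rw [conj_conj, conj_eq_neg R h1, h3, zero_smul, ← conj_mul, ← key hv, neg_mul, ← key hvu,
    add_neg_eq_zero] at h2
  rw [associator_apply, h2, sub_mul]

end Linearized

section Field

variable (K V : Type u) [Field K] [NonAssocRing V] [Module K V]
  [IsScalarTower K V V] [SMulCommClass K V V] [OctonionAlgebra K V]

/-- Take `u` with nonzero trace and discriminant, `v` orthogonal to `1, u`, and `l` orthogonal to
`1, u, v, vu`. The norm of the associator is then the product of the discriminant of `u` with the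
norms of `v` and `l`. -/
theorem exists_norm_associator_ne_zero_of_field :
    ∃ u v l : V, octPolar K u 1 ≠ 0 ∧ octNorm K (associator u v l) ≠ 0 := by
  obtain ⟨u, hu, hu'⟩ : ∃ u : V, octPolar K u 1 ≠ 0 ∧
      4 * octNorm K u - octPolar K u 1 * octPolar K u 1 ≠ 0 := by
    -- In characteristic two the discriminant is minus the square of the trace. Otherwise `u + 1`,
    -- with `u` anisotropic and orthogonal to `1`, has trace `2` and discriminant `4q(u)`.
    by_cases h2 : (2 : K) = 0
    · obtain ⟨u, hu⟩ : ∃ u : V, octPolar K u 1 ≠ 0 := by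
        by_contra! h
        have h10 : (1 : V) = 0 :=
          polar_ext (R := K) fun z => by rw [polar_comm, h, polar_zero_left]
        have := norm_one K V
        rw [h10, octNorm, QuadraticMap.map_zero] at this
        exact zero_ne_one this
      refine ⟨u, hu, ?_⟩
      rw [show (4 : K) = 2 * 2 by norm_num, h2, zero_mul, zero_mul, zero_sub, neg_ne_zero]
      exact mul_ne_zero hu hu
    · obtain ⟨u, hu, hu'⟩ := exists_orthogonal_norm_ne_zero (K := K) (V := V) (n := 1) (by norm_num)
        (fun _ => 1) 0 (by rw [norm_one]; exact one_ne_zero)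
      have hu := hu 0
      refine ⟨u + 1, ?_, ?_⟩
      · rwa [polar_add_left, polar_comm, hu, polar_self, norm_one, zero_add, mul_one]
      · rw [polar_add_left, polar_comm, hu, polar_self, norm_add, norm_one, polar_comm, hu]
        ring_nf
        rw [show (4 : K) = 2 * 2 by norm_num]
        exact mul_ne_zero hu' (mul_ne_zero h2 h2)
  obtain ⟨v, hv, hv'⟩ := exists_orthogonal_norm_ne_zero (K := K) (V := V) (n := 2) (by norm_num)
    ![1, u] 0 (by simp)
  obtain ⟨l, hl, hl'⟩ := exists_orthogonal_norm_ne_zero (K := K) (V := V) (n := 4) (by norm_num)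
    ![1, u, v, v * u] 0 (by simp)
  refine ⟨u, v, l, hu, ?_⟩
  have hl := associator_eq K (u := u) (v := v) (hl 0) (hl 1) (hl 2) (hl 3)
  rw [hl, norm_mul', norm_commutator K (u := u) (hv 0) (hv 1)]
  exact mul_ne_zero (mul_ne_zero hu' hv') hl'

/-- There is a non-isotropic vector outside of two given lines. -/
theorem exists_norm_ne_zero_of_field (x : V) :
    ∃ w : V, octNorm K w ≠ 0 ∧ w ∉ Submodule.span K {1} ∧ w ∉ Submodule.span K {x} := by
  by_contra! h
  let P := Submodule.span K (Set.range ![(1 : V), x])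
  have h1 : (1 : V) ∈ P := Submodule.subset_span ⟨0, rfl⟩
  have hx : x ∈ P := Submodule.subset_span ⟨1, rfl⟩
  have hP (v : V) (hv : v ∉ P) : octNorm K v = 0 := by
    by_contra hq
    exact hv (Submodule.span_le.2 (by simpa using hx) (h v hq fun hv1 =>
      hv (Submodule.span_le.2 (by simpa using h1) hv1)))
  -- Outside `P` the norm vanishes at both `v` and `v + 1`, which fixes the trace of `v`. Applying
  -- this to `v`, `v'` and `v' + v` gives `-2 = -1`.
  have hP1 (v : V) (hv : v ∉ P) : octPolar K v 1 = -1 := by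
    have := hP (v + 1) fun h => hv (by simpa using sub_mem h h1)
    rw [norm_add, hP v hv, norm_one] at this
    linear_combination this
  have hP2 : Module.finrank K P ≤ 2 :=
    (finrank_range_le_card (R := K) _).trans (by simp)
  obtain ⟨v, hv⟩ : ∃ v, v ∉ P := by
    by_contra! hall
    rw [Submodule.eq_top_iff'.2 hall, finrank_top, finrank_eq K V] at hP2
    norm_num at hP2
  obtain ⟨v', hv'⟩ : ∃ v', v' ∉ P ⊔ Submodule.span K {v} := by
    by_contra! hall
    have h3 := Submodule.finrank_add_le_finrank_add_finrank P (Submodule.span K {v})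
    rw [Submodule.eq_top_iff'.2 hall, finrank_top, finrank_eq K V] at h3
    have := finrank_span_le_card (R := K) ({v} : Set V)
    rw [Set.toFinset_singleton, Finset.card_singleton] at this
    lia
  have e1 := hP1 v hv
  have e2 := hP1 v' fun h => hv' (Submodule.mem_sup_left h)
  have e3 := hP1 (v' + v) fun h => hv' (by
    have h4 : v' + v - v ∈ P ⊔ Submodule.span K {v} :=
      sub_mem (Submodule.mem_sup_left h) (Submodule.mem_sup_right (Submodule.mem_span_singleton_self v))
    simpa using h4)
  rw [polar_add_left, e1, e2] at e3
  exact one_ne_zero (by linear_combination -e3 : (1 : K) = 0)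

end Field

/-! ### From residue fields back to the base ring -/

section ResidueField

variable {R C : Type u} [CommRing R] [NonAssocRing C] [Module R C]
  [IsScalarTower R C C] [SMulCommClass R C C] [OctonionAlgebra R C]

/-- Clearing denominators: the residue field is the fraction field of `R ⧸ p`. -/
theorem exists_smul_eq_one_tmul {R M : Type*} [CommRing R] [AddCommGroup M] [Module R M]
    (p : Ideal R) [p.IsPrime] (x : p.ResidueField ⊗[R] M) :
    ∃ r ∉ p, ∃ m : M, algebraMap R p.ResidueField r • x = 1 ⊗ₜ m := by
  induction x with
  | zero => exact ⟨1, p.one_notMem, 0, by simp⟩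
  | add x y hx hy =>
    obtain ⟨r, hr, m, hm⟩ := hx
    obtain ⟨s, hs, m', hm'⟩ := hy
    refine ⟨r * s, fun h => (Ideal.IsPrime.mem_or_mem ‹_› h).elim hr hs, s • m + r • m', ?_⟩
    rw [smul_add, tmul_add, tmul_smul, tmul_smul, ← hm, ← hm', map_mul, mul_smul, mul_smul,
      smul_comm, algebraMap_smul, algebraMap_smul, algebraMap_smul, algebraMap_smul]
  | tmul s m =>
    obtain ⟨a, b, hb, rfl⟩ := IsFractionRing.div_surjective (A := R ⧸ p) s
    obtain ⟨a, rfl⟩ := Ideal.Quotient.mk_surjective a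
    obtain ⟨b, rfl⟩ := Ideal.Quotient.mk_surjective b
    have hb' : b ∉ p := fun h => nonZeroDivisors.ne_zero hb (Ideal.Quotient.eq_zero_iff_mem.2 h)
    refine ⟨b, hb', a • m, ?_⟩
    rw [Ideal.algebraMap_quotient_residueField_mk, Ideal.algebraMap_quotient_residueField_mk,
      smul_tmul', tmul_smul, smul_tmul', smul_eq_mul, mul_div_cancel₀, Algebra.smul_def, mul_one]
    rwa [ne_eq, Ideal.algebraMap_residueField_eq_zero]

-- A local substitute for a basis: near each prime there are a trace and an associator norm that can
-- be cancelled. This drives the computation of the nucleus.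
variable (C) in
theorem exists_norm_associator_notMem (p : Ideal R) [p.IsPrime] :
    ∃ u v l : C, octPolar R u 1 ∉ p ∧ octNorm R (associator u v l) ∉ p := by
  obtain ⟨u, v, l, h1, h2⟩ :=
    exists_norm_associator_ne_zero_of_field p.ResidueField (p.ResidueField ⊗[R] C)
  obtain ⟨r, hr, u', hu⟩ := exists_smul_eq_one_tmul p u
  obtain ⟨s, hs, v', hv⟩ := exists_smul_eq_one_tmul p v
  obtain ⟨t, ht, l', hl⟩ := exists_smul_eq_one_tmul p l
  rw [← Ideal.algebraMap_residueField_eq_zero] at hr hs ht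
  refine ⟨u', v', l', ?_, ?_⟩
  · rw [← Ideal.algebraMap_residueField_eq_zero, ← octPolar_one_tmul, ← hu,
      ← Algebra.TensorProduct.one_def, polar_smul_left]
    exact mul_ne_zero hr h1
  · have : (1 : p.ResidueField) ⊗ₜ[R] associator u' v' l' =
        (algebraMap R p.ResidueField r * (algebraMap R p.ResidueField s *
          algebraMap R p.ResidueField t)) • associator u v l := by
      simp only [associator_apply, tmul_sub]
      rw [one_tmul_mul, one_tmul_mul, one_tmul_mul, one_tmul_mul, ← hu, ← hv, ← hl]
      simp only [smul_mul_assoc, mul_smul_comm, smul_sub, smul_smul]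
      congr 2 <;> ring
    rw [← Ideal.algebraMap_residueField_eq_zero, ← octNorm_one_tmul, this, norm_smul]
    have h3 := mul_ne_zero hr (mul_ne_zero hs ht)
    exact mul_ne_zero (mul_ne_zero h3 h3) h2

/-- The annihilator of `x - y` is contained in no maximal ideal, hence contains `1`. -/
theorem eq_of_forall_prime {R M : Type*} [CommRing R] [AddCommGroup M] [Module R M] {x y : M}
    (h : ∀ p : Ideal R, p.IsPrime → ∃ r ∉ p, r • x = r • y) : x = y := by
  rw [← sub_eq_zero]
  have h1 : LinearMap.ker (LinearMap.toSpanSingleton R M (x - y)) = ⊤ := by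
    by_contra hne
    obtain ⟨m, hm, hle⟩ := Ideal.exists_le_maximal _ hne
    obtain ⟨r, hr, hxy⟩ := h m hm.isPrime
    exact hr (hle (by simp [smul_sub, hxy]))
  simpa using (Ideal.eq_top_iff_one _).1 h1

end ResidueField

end OctonionAlgebra

end OctonionFields

/-! ### The nucleus of an octonion algebra -/

section Alternative

variable {A : Type*} [NonUnitalNonAssocRing A]

theorem associator_add_left (x x' y z : A) :
    associator (x + x') y z = associator x y z + associator x' y z := by
  simp only [associator_apply, add_mul]; abel

theorem associator_add_mid (x y y' z : A) :
    associator x (y + y') z = associator x y z + associator x y' z := by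
  simp only [associator_apply, add_mul, mul_add]; abel

theorem associator_add_right (x y z z' : A) :
    associator x y (z + z') = associator x y z + associator x y z' := by
  simp only [associator_apply, mul_add]; abel

variable (A) in
/-- An alternative ring: a not necessarily associative ring in which the associator vanishes as
soon as its first two or its last two arguments coincide. -/
def IsAlternative : Prop :=
  (∀ x y : A, associator x x y = 0) ∧ ∀ x y : A, associator x y y = 0

namespace IsAlternative

variable (h : IsAlternative A)

include h

theorem swap_left (x y z : A) : associator y x z = -associator x y z := by
  have h1 := h.1 (x + y) z
  rw [associator_add_left, associator_add_mid, associator_add_mid, h.1, h.1] at h1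
  rw [eq_neg_iff_add_eq_zero, ← h1]; abel

theorem swap_right (x y z : A) : associator x z y = -associator x y z := by
  have h1 := h.2 x (y + z)
  rw [associator_add_mid, associator_add_right, associator_add_right, h.2, h.2] at h1
  rw [eq_neg_iff_add_eq_zero, ← h1]; abel

theorem rotate (x y z : A) : associator z x y = associator x y z := by
  rw [h.swap_left x z y, h.swap_right x y z, neg_neg]

theorem flexible (x y : A) : (x * y) * x = x * (y * x) := by
  rw [← sub_eq_zero, ← associator_apply, h.swap_right, h.1, neg_zero]

end IsAlternative

/-- An element in the nucleus, in an alternative ring. -/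
def IsNuclear (n : A) : Prop := ∀ x y : A, associator x y n = 0

namespace IsNuclear

variable (h : IsAlternative A) {n : A} (hn : IsNuclear n)

include h hn

theorem mid (x y : A) : associator x n y = 0 := by
  rw [h.swap_right, hn, neg_zero]

theorem left (x y : A) : associator n x y = 0 := by
  rw [h.rotate, hn]

/-- In the Teichmüller identity, every other associator beginning with `n` vanishes. -/
theorem mul_associator_left (x y z : A) : n * associator x y z = associator (n * x) y z := by
  have := associator_cocycle n x y z
  rwa [hn.left h, hn.left h, hn.left h, zero_mul, add_zero, add_zero, sub_zero, sub_eq_zero]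
    at this

theorem mul_associator (x y z : A) : n * associator x y z = associator x y (n * z) := by
  rw [← h.rotate, hn.mul_associator_left h, h.rotate]

end IsNuclear

end Alternative

/-! ### Nuclear octonions commute and behave as scalars -/

namespace OctonionAlgebra

theorem isAlternative (R C : Type u) [CommRing R] [NonAssocRing C]
    [Module R C] [IsScalarTower R C C] [SMulCommClass R C C] [OctonionAlgebra R C] :
    IsAlternative C :=
  ⟨fun x y => by rw [associator_apply, mul_self_mul R, sub_self],
    fun x y => by rw [associator_apply, mul_mul_self R, sub_self]⟩

/-- A rewriting of the Moufang identity `((xz)x)y = x(z(xy))`, obtained here from the closed form of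
`(xz)x`. -/
theorem mul_associator_self (R : Type u) {C : Type u} [CommRing R] [NonAssocRing C]
    [Module R C] [IsScalarTower R C C] [SMulCommClass R C C] [OctonionAlgebra R C] (x y z : C) :
    x * associator x y z = associator x y (z * x) := by
  have h1 : ((x * z) * x) * y = x * (z * (x * y)) := by
    have h := conj_mul_mul_add R (octonionConj R C z) x y
    rw [conj_conj, ← eq_sub_iff_add_eq] at h
    rw [h, mul_sub, mul_smul_comm, mul_conj_mul, mul_mul_self_eq R, sub_mul, smul_mul_assoc,
      smul_mul_assoc, polar_conj_left]
  have h := isAlternative R C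
  rw [h.swap_right x (z * x) y, ← h.rotate, associator_apply, associator_apply, ← h.flexible,
    h1, mul_sub, neg_sub]

theorem smul_eq_zero_of_mul_eq_zero (R : Type u) {C : Type u} [CommRing R] [NonAssocRing C]
    [Module R C] [IsScalarTower R C C] [SMulCommClass R C C] [OctonionAlgebra R C] {x s : C} (h : x * s = 0) : octNorm R s • x = 0 := by
  rw [← mul_mul_conj, h, zero_mul]

/-- Both `n` and `x` can be moved inside the associator, to the last slot; in either order this
gives the same element, because `(nz)x = n(zx)`. -/
theorem commutator_mul_associator (R : Type u) {C : Type u} [CommRing R] [NonAssocRing C]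
    [Module R C] [IsScalarTower R C C] [SMulCommClass R C C] [OctonionAlgebra R C] 
    {n : C} (hn : IsNuclear n) (x y z : C) :
    (n * x - x * n) * associator x y z = 0 := by
  have h := isAlternative R C
  have h1 : x * (n * associator x y z) = n * (x * associator x y z) := by
    rw [hn.mul_associator h, mul_associator_self R, mul_associator_self R, hn.mul_associator h,
      sub_eq_zero.1 ((associator_apply _ _ _).symm.trans (hn.left h z x))]
  rw [sub_mul, sub_eq_zero, sub_eq_zero.1 ((associator_apply _ _ _).symm.trans (hn.left h _ _)),
    sub_eq_zero.1 ((associator_apply _ _ _).symm.trans (hn.mid h _ _)), h1]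

/-- Linearising `[n, x](x, v, l) = 0` at `x + u` trades `[n, x](u, v, l)` for `-[n, u](x, v, l)`.
The norm of `(u, v, l)` is cancelled twice, once for `[n, u]` and once for `[n, x]`, hence its
square. -/
theorem commutator_eq_zero (R : Type u) {C : Type u} [CommRing R] [NonAssocRing C]
    [Module R C] [IsScalarTower R C C] [SMulCommClass R C C] [OctonionAlgebra R C] 
    {n : C} (hn : IsNuclear n) (x : C) : n * x = x * n := by
  refine eq_of_forall_prime (R := R) fun p hp => ?_
  obtain ⟨u, v, l, -, hq⟩ := exists_norm_associator_notMem C p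
  refine ⟨octNorm R (associator u v l) * octNorm R (associator u v l),
    fun h => (hp.mem_or_mem h).elim hq hq, ?_⟩
  have h1 := commutator_mul_associator R hn u v l
  have h2 := commutator_mul_associator R hn (x + u) v l
  have h3 := commutator_mul_associator R hn x v l
  have h4 : octNorm R (associator u v l) • (n * u - u * n) = 0 :=
    smul_eq_zero_of_mul_eq_zero R h1
  have h5 : (n * x - x * n) * associator u v l = -((n * u - u * n) * associator x v l) := by
    rw [eq_neg_iff_add_eq_zero, ← h2, ← sub_eq_zero]
    rw [show n * (x + u) - (x + u) * n = (n * x - x * n) + (n * u - u * n) by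
      rw [mul_add, add_mul]; abel, associator_add_left, add_mul, mul_add, mul_add, h1, h3]
    abel
  have h6 : (octNorm R (associator u v l) • (n * x - x * n)) * associator u v l = 0 := by
    rw [smul_mul_assoc, h5, smul_neg, ← smul_mul_assoc, h4, zero_mul, neg_zero]
  have h7 := smul_eq_zero_of_mul_eq_zero R h6
  rwa [smul_smul, smul_sub, sub_eq_zero] at h7

variable (R : Type u) {C : Type u} [CommRing R] [NonAssocRing C] [Module R C]
  [IsScalarTower R C C] [SMulCommClass R C C] [OctonionAlgebra R C]

/-- The nucleus of an octonion algebra consists of scalars. -/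
theorem smul_eq_of_isNuclear {n : C} (hn : IsNuclear n) (x : C) :
    octPolar R x 1 • n = octPolar R x n • (1 : C) := by
  have h := isAlternative R C
  have h1 (x : C) : x * (octonionConj R C n - n) = octPolar R x n • (1 : C) - octPolar R x 1 • n := by
    rw [← mul_conj_add R x n, conj_apply R x, mul_sub, mul_sub n, mul_smul_comm, mul_one,
      commutator_eq_zero R hn x]
    abel
  have hm : IsNuclear (octonionConj R C n - n) := fun x y => by
    have h2 := hn x y
    rw [associator_apply, sub_eq_zero] at h2
    simp only [associator_apply, conj_apply, mul_sub, mul_smul_comm, mul_one, h2, sub_self]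
  -- By `h1` the claim amounts to `n̄ = n`. The difference is again nuclear, so the same associator
  -- tests apply to it.
  have h0 : octonionConj R C n - n = 0 := by
    refine eq_of_forall_prime (R := R) fun p hp => ?_
    obtain ⟨u, v, l, hu, hq⟩ := exists_norm_associator_notMem C p
    refine ⟨octNorm R (associator u v l) * octPolar R u 1,
      fun h => (hp.mem_or_mem h).elim hq hu, ?_⟩
    -- The combination of `u` and `v` has trace zero, so by `h1` its product with the nuclear
    -- element is a scalar and associates with everything. Extracting that element leaves a multiple
    -- of `(u, v, l)`.
    have h3 : associator ((octonionConj R C n - n) * (octPolar R u 1 • v - octPolar R v 1 • u)) u l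
        = 0 := by
      rw [commutator_eq_zero R hm, h1]
      simp only [polar_sub_left, polar_smul_left, associator_apply, sub_mul, smul_mul_assoc,
        one_mul]
      rw [mul_comm (octPolar R v 1) (octPolar R u 1), sub_self, zero_smul, zero_smul]
      abel
    rw [← hm.mul_associator_left h, sub_eq_add_neg (_ • v), ← neg_smul, associator_add_left] at h3
    have h4 (r : R) (x y z : C) : associator (r • x) y z = r • associator x y z := by
      simp only [associator_apply, smul_mul_assoc, smul_sub]
    rw [h4, h4, h.1, smul_zero, add_zero, h.swap_left u v l, smul_neg, mul_neg, neg_eq_zero,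
      mul_smul_comm, ← smul_mul_assoc] at h3
    have h5 := smul_eq_zero_of_mul_eq_zero R h3
    rw [smul_zero, mul_smul, h5]
  have h2 := h1 x
  rw [h0, mul_zero] at h2
  exact (sub_eq_zero.1 h2.symm).symm

/-- Right multiplication by a nuclear element commutes with all linear maps. -/
theorem linearMap_mul_of_isNuclear {n : C} (hn : IsNuclear n) (f : C →ₗ[R] C) (y : C) :
    f (y * n) = f y * n := by
  refine eq_of_forall_prime (R := R) fun p hp => ?_
  obtain ⟨u, v, l, hu, hq⟩ := exists_norm_associator_notMem C p
  refine ⟨octPolar R u 1, hu, ?_⟩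
  rw [← map_smul, ← mul_smul_comm, smul_eq_of_isNuclear R hn, mul_smul_comm, mul_one, map_smul,
    ← mul_smul_comm, smul_eq_of_isNuclear R hn, mul_smul_comm, mul_one]

end OctonionAlgebra

/-! ### Contractions and ideals of Clifford algebras -/

section CliffordContraction

open CliffordAlgebra

variable {R M : Type*} [CommRing R] [AddCommGroup M] [Module R M] {Q : QuadraticForm R M}

namespace CliffordAlgebra

variable (Q) in
/-- The span of the products of increasing sequences among the vectors `e 0, …, e (k - 1)`. -/
def initialSpan (e : ℕ → M) : ℕ → Submodule R (CliffordAlgebra Q)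
  | 0 => 1
  | k + 1 => initialSpan e k ⊔ (initialSpan e k).map (LinearMap.mulLeft R (ι Q (e k)))

theorem mem_initialSpan_succ {e : ℕ → M} {k : ℕ} {z : CliffordAlgebra Q} :
    z ∈ initialSpan Q e (k + 1) ↔
      ∃ x ∈ initialSpan Q e k, ∃ y ∈ initialSpan Q e k, x + ι Q (e k) * y = z := by
  simp [initialSpan, Submodule.mem_sup]

/-- Contraction is a skew derivation, so it kills products of vectors on which the functional
vanishes. -/
theorem contractLeft_initialSpan {e : ℕ → M} {n : ℕ} {d : Module.Dual R M}
    (h : ∀ i < n, d (e i) = 0) {z : CliffordAlgebra Q} (hz : z ∈ initialSpan Q e n) :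
    contractLeft d z = 0 := by
  induction n generalizing z with
  | zero =>
    obtain ⟨r, rfl⟩ := Submodule.mem_one.1 hz
    exact contractLeft_algebraMap Q d r
  | succ k ih =>
    obtain ⟨x, hx, y, hy, rfl⟩ := mem_initialSpan_succ.1 hz
    have h' : ∀ i < k, d (e i) = 0 := fun i hi => h i (hi.trans k.lt_succ_self)
    rw [map_add, contractLeft_ι_mul, ih h' hx, ih h' hy, h k k.lt_succ_self]
    simp

theorem ι_mul_mem_initialSpan {e : ℕ → M} {n i : ℕ} (hi : i < n) {z : CliffordAlgebra Q}
    (hz : z ∈ initialSpan Q e n) : ι Q (e i) * z ∈ initialSpan Q e n := by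
  induction n generalizing z with
  | zero => exact absurd hi (Nat.not_lt_zero i)
  | succ k ih =>
    obtain ⟨x, hx, y, hy, rfl⟩ := mem_initialSpan_succ.1 hz
    rw [mul_add, ← mul_assoc]
    rcases (Nat.lt_succ_iff.1 hi).eq_or_lt with rfl | hi
    · rw [ι_sq_scalar, ← Algebra.smul_def, add_comm (ι Q (e i) * x)]
      exact mem_initialSpan_succ.2 ⟨_, Submodule.smul_mem _ _ hy, _, hx, rfl⟩
    · rw [ι_mul_ι_comm, sub_mul, ← Algebra.smul_def, mul_assoc, sub_eq_add_neg, ← mul_neg,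
        ← add_assoc]
      exact mem_initialSpan_succ.2 ⟨_, add_mem (ih hi hx) (Submodule.smul_mem _ _ hy), _,
        neg_mem (ih hi hy), rfl⟩

theorem initialSpan_eq_top {e : ℕ → M} {n : ℕ}
    (h : Submodule.span R (e '' Set.Iio n) = ⊤) : initialSpan Q e n = ⊤ := by
  have h1 : (1 : CliffordAlgebra Q) ∈ initialSpan Q e n := by
    clear h
    induction n with
    | zero => exact Submodule.mem_one.2 ⟨1, map_one _⟩
    | succ k ih => exact mem_initialSpan_succ.2 ⟨1, ih, 0, zero_mem _, by simp⟩
  rw [Submodule.eq_top_iff']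
  intro z
  induction z using CliffordAlgebra.left_induction with
  | algebraMap r => rw [Algebra.algebraMap_eq_smul_one]; exact Submodule.smul_mem _ _ h1
  | add x y hx hy => exact add_mem hx hy
  | ι_mul x m hx =>
    have hm : m ∈ Submodule.span R (e '' Set.Iio n) := h ▸ Submodule.mem_top
    induction hm using Submodule.span_induction with
    | mem m hm =>
      obtain ⟨i, hi, rfl⟩ := hm
      exact ι_mul_mem_initialSpan hi hx
    | zero => simp
    | add m m' _ _ hm hm' => rw [map_add, add_mul]; exact add_mem hm hm'
    | smul r m _ hm => rw [map_smul, smul_mul_assoc]; exact Submodule.smul_mem _ _ hm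

/-- Write an element as `x + e_k y` with `x, y` in the preceding span. Contraction with `d k`
returns `y`, so by induction `y = 0`, then `x = 0`; triangular duality is enough. -/
theorem eq_bot_of_contractLeft_mem_of_dual {e : ℕ → M} {d : ℕ → Module.Dual R M} {n : ℕ}
    (hd : ∀ k < n, d k (e k) = 1 ∧ ∀ i < k, d k (e i) = 0)
    (he : Submodule.span R (e '' Set.Iio n) = ⊤) {K : Submodule R (CliffordAlgebra Q)}
    (hK : ∀ d, ∀ z ∈ K, contractLeft d z ∈ K)
    (h0 : ∀ r, algebraMap R (CliffordAlgebra Q) r ∈ K → algebraMap R (CliffordAlgebra Q) r = 0) :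
    K = ⊥ := by
  have key (k : ℕ) (hk : k ≤ n) (z) (hz : z ∈ K) (hz' : z ∈ initialSpan Q e k) : z = 0 := by
    induction k generalizing z with
    | zero =>
      obtain ⟨r, rfl⟩ := Submodule.mem_one.1 hz'
      exact h0 r hz
    | succ k ih =>
      obtain ⟨x, hx, y, hy, rfl⟩ := mem_initialSpan_succ.1 hz'
      have h1 := hK (d k) _ hz
      obtain ⟨h2, h3⟩ := hd k hk
      rw [map_add, contractLeft_ι_mul, contractLeft_initialSpan h3 hx,
        contractLeft_initialSpan h3 hy, h2, mul_zero, sub_zero, zero_add, one_smul] at h1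
      have hy0 := ih (Nat.le_of_succ_le hk) y h1 hy
      rw [hy0, mul_zero, add_zero] at hz ⊢
      exact ih (Nat.le_of_succ_le hk) x hz hx
  rw [Submodule.eq_bot_iff]
  exact fun z hz => key n le_rfl z hz (initialSpan_eq_top he ▸ Submodule.mem_top)

theorem contractLeft_map {M' : Type*} [AddCommGroup M'] [Module R M'] {Q' : QuadraticForm R M'}
    (j : Q →qᵢ Q') (d : Module.Dual R M') (z : CliffordAlgebra Q) :
    contractLeft d (CliffordAlgebra.map j z) =
      CliffordAlgebra.map j (contractLeft (d ∘ₗ j.toLinearMap) z) := by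
  induction z using CliffordAlgebra.left_induction with
  | algebraMap r => simp
  | add x y hx hy => simp [hx, hy]
  | ι_mul x m hx =>
    rw [map_mul, map_apply_ι, contractLeft_ι_mul, contractLeft_ι_mul, hx, map_sub, map_smul,
      map_mul, map_apply_ι]
    rfl

/-- A submodule of the Clifford algebra of a finite projective quadratic module vanishes if it is
stable under contractions and contains no nonzero scalars. -/
theorem eq_bot_of_contractLeft_mem [Module.Finite R M] [Module.Projective R M]
    {K : Submodule R (CliffordAlgebra Q)} (hK : ∀ d, ∀ z ∈ K, contractLeft d z ∈ K)
    (h0 : ∀ r, algebraMap R (CliffordAlgebra Q) r ∈ K → algebraMap R (CliffordAlgebra Q) r = 0) :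
    K = ⊥ := by
  obtain ⟨n, p, j, -, -, h⟩ := Module.Finite.exists_comp_eq_id_of_projective R M
  have hpj (x : M) : p (j x) = x := LinearMap.congr_fun h x
  -- `M` is a retract of a free module. With the form pulled back along `p`, both maps are
  -- isometries, and the Clifford algebra is a retract of one over a free module.
  let J : Q →qᵢ Q.comp p := ⟨j, fun x => by simp [hpj]⟩
  let P : Q.comp p →qᵢ Q := ⟨p, fun x => rfl⟩
  have hPJ (z : CliffordAlgebra Q) : CliffordAlgebra.map P (CliffordAlgebra.map J z) = z :=
    leftInverse_map_of_leftInverse J P hpj z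
  have hbot : K.map (CliffordAlgebra.map J).toLinearMap = ⊥ := by
    refine eq_bot_of_contractLeft_mem_of_dual (n := n)
      (e := fun k => if hk : k < n then Pi.single ⟨k, hk⟩ 1 else 0)
      (d := fun k => if hk : k < n then LinearMap.proj ⟨k, hk⟩ else 0) ?_ ?_ ?_ ?_
    · intro k hk
      refine ⟨by simp [hk], fun i hi => ?_⟩
      simp only [hk, hi.trans hk, dif_pos, LinearMap.proj_apply]
      exact Pi.single_eq_of_ne (by simpa [Fin.ext_iff] using hi.ne') _
    · rw [← (Pi.basisFun R (Fin n)).span_eq]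
      congr 1
      ext x
      constructor
      · rintro ⟨k, hk, rfl⟩
        exact ⟨⟨k, hk⟩, by simp [Set.mem_Iio.1 hk]⟩
      · rintro ⟨i, rfl⟩
        exact ⟨i, i.2, by simp⟩
    · rintro d _ ⟨z, hz, rfl⟩
      exact ⟨_, hK (d ∘ₗ j) z hz, (contractLeft_map J d z).symm⟩
    · rintro r ⟨z, hz, hzr⟩
      have hz' : z = algebraMap R _ r := by
        rw [← hPJ z, ← AlgHom.commutes (CliffordAlgebra.map P)]
        exact congrArg _ hzr
      rw [hz'] at hz
      rw [← AlgHom.commutes (CliffordAlgebra.map J), h0 r hz, map_zero]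
  rw [Submodule.eq_bot_iff]
  intro z hz
  have : CliffordAlgebra.map J z = 0 := (Submodule.eq_bot_iff _).1 hbot _ ⟨z, hz, rfl⟩
  rw [← hPJ z, this, map_zero]

/-- Contraction with a functional coming from the form is a twisted commutator, so two-sided ideals
stable under the grade involution are stable under it. -/
theorem contractLeft_polarBilin (v : M) (z : CliffordAlgebra Q) :
    contractLeft (QuadraticMap.polarBilin Q v) z = ι Q v * z - involute z * ι Q v := by
  induction z using CliffordAlgebra.left_induction with
  | algebraMap r =>
    rw [contractLeft_algebraMap, AlgHom.commutes, Algebra.commutes, sub_self]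
  | add x y hx hy => rw [map_add, hx, hy, map_add, mul_add, add_mul]; abel
  | ι_mul x m hx =>
    rw [contractLeft_ι_mul, hx, map_mul, involute_ι, ← mul_assoc, ι_mul_ι_comm v m, mul_sub, sub_mul,
      Algebra.smul_def, neg_mul, neg_mul, sub_neg_eq_add, mul_assoc, mul_assoc]
    change algebraMap R _ (QuadraticMap.polar Q v m) * x - _ = _
    abel

/-- A homomorphism from the Clifford algebra of a regular form on a finite projective module is
injective on the even subalgebra as soon as it is injective on scalars. -/
theorem eq_zero_of_map_eq_zero [Module.Finite R M] [Module.Projective R M]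
    (hQ : Function.Surjective (QuadraticMap.polarBilin Q : M →ₗ[R] M →ₗ[R] R))
    {A : Type*} [Ring A] [Algebra R A] (f : CliffordAlgebra Q →ₐ[R] A)
    (hf : Function.Injective (algebraMap R A)) {z : CliffordAlgebra Q} (hz : involute z = z)
    (hfz : f z = 0) : z = 0 := by
  -- The kernel alone need not be stable under the grade involution; both conditions together are,
  -- and by regularity every contraction is then a twisted commutator preserving `K`.
  let K : Submodule R (CliffordAlgebra Q) :=
    LinearMap.ker f.toLinearMap ⊓ LinearMap.ker (f.toLinearMap ∘ₗ involute.toLinearMap)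
  have hK : K = ⊥ := by
    refine eq_bot_of_contractLeft_mem ?_ ?_
    · rintro d y ⟨h1, h2⟩
      obtain ⟨v, rfl⟩ := hQ d
      have h1 : f y = 0 := h1
      have h2 : f (involute y) = 0 := h2
      rw [contractLeft_polarBilin]
      constructor
      · change f _ = 0
        simp [h1, h2]
      · change f (involute _) = 0
        simp [h1, h2]
    · rintro r ⟨h1, -⟩
      have h1 : f (algebraMap R _ r) = 0 := h1
      rw [AlgHom.commutes, map_eq_zero_iff _ hf] at h1
      rw [h1, map_zero]
  exact (Submodule.eq_bot_iff _).1 hK z ⟨hfz, by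
    change f (involute z) = 0
    rw [hz, hfz]⟩

end CliffordAlgebra

end CliffordContraction

/-! ### Isometric autotopies are special orthogonal -/

section Autotopy

open CliffordAlgebra

variable (R : Type u) {C : Type u} [CommRing R] [NonAssocRing C] [Module R C]
  [IsScalarTower R C C] [SMulCommClass R C C] [OctonionAlgebra R C]

namespace OctonionAlgebra

variable (C) in
/-- The map `c ↦ ((x, y) ↦ (c y, c̄ x))`. -/
def spinMap : C →ₗ[R] Module.End R (C × C) :=
  LinearMap.mk₂ R (fun c x => (c * x.2, octonionConj R C c * x.1))
    (fun c c' x => by simp [add_mul]) (fun r c x => by simp [smul_mul_assoc])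
    (fun c x y => by simp [mul_add]) (fun r c x => by simp [mul_smul_comm])

theorem spinMap_apply (c : C) (x : C × C) :
    spinMap R C c x = (c * x.2, octonionConj R C c * x.1) := rfl

variable (C) in
/-- The spinor representation of the Clifford algebra of the norm of an octonion algebra. -/
def spinRep : CliffordAlgebra (norm (R := R) (C := C)) →ₐ[R] Module.End R (C × C) :=
  CliffordAlgebra.lift _ ⟨spinMap R C, fun c => by
    refine LinearMap.ext fun x => ?_
    rw [Module.End.mul_apply, spinMap_apply, spinMap_apply, mul_conj_mul, conj_mul_mul]
    rfl⟩

theorem spinRep_ι (c : C) (x : C × C) :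
    spinRep R C (ι _ c) x = (c * x.2, octonionConj R C c * x.1) := by
  rw [spinRep, CliffordAlgebra.lift_ι_apply, spinMap_apply]

theorem spinRep_even {z : CliffordAlgebra (norm (R := R) (C := C))} (hz : z ∈ even norm) :
    (∀ x, (spinRep R C z (x, 0)).2 = 0) ∧ ∀ y, (spinRep R C z (0, y)).1 = 0 := by
  induction z, hz using CliffordAlgebra.even_induction with
  | algebraMap r => constructor <;> intro x <;> simp
  | add x y hx hy h h' =>
    constructor <;> intro x
    · simp [h.1, h'.1]
    · simp [h.2, h'.2]
  | ι_mul_ι_mul m₁ m₂ x hx h =>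
    constructor <;> intro y <;>
      rw [map_mul, map_mul, Module.End.mul_apply, Module.End.mul_apply, spinRep_ι, spinRep_ι]
    · simp [h.1]
    · simp [h.2]

/-- The centre of the even Clifford algebra acts by multiplications with elements of the
nucleus. -/
theorem exists_isNuclear_spinRep {z : CliffordAlgebra (norm (R := R) (C := C))}
    (hz : z ∈ even norm) (hc : ∀ w ∈ even (norm (R := R) (C := C)), z * w = w * z) :
    ∃ n m : C, IsNuclear n ∧ IsNuclear m ∧
      ∀ x y, spinRep R C z (x, y) = (x * n, y * m) := by
  obtain ⟨h1, h2⟩ := spinRep_even R hz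
  have comm (c d : C) (x : C × C) : spinRep R C z (spinRep R C (ι _ c) (spinRep R C (ι _ d) x)) =
      spinRep R C (ι _ c) (spinRep R C (ι _ d) (spinRep R C z x)) := by
    simp only [← Module.End.mul_apply, ← map_mul]
    rw [hc _ (ι_mul_ι_mem_evenOdd_zero _ c d), mul_assoc]
  -- The operator of `(c, 1)` is left multiplication by `c` on the first summand. A map commuting
  -- with all of these is right multiplication by its value at `1`, and that value must be nuclear.
  have hl (c x : C) : (spinRep R C z (c * x, 0)).1 = c * (spinRep R C z (x, 0)).1 := by
    have := congrArg Prod.fst (comm c 1 (x, 0))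
    simpa [spinRep_ι] using this
  have hr (c x : C) : (spinRep R C z (0, c * x)).2 = c * (spinRep R C z (0, x)).2 := by
    have := congrArg Prod.snd (comm 1 c (0, x))
    simpa [spinRep_ι] using this
  have hl1 (x : C) : (spinRep R C z (x, 0)).1 = x * (spinRep R C z (1, 0)).1 := by
    rw [← hl, mul_one]
  have hr1 (x : C) : (spinRep R C z (0, x)).2 = x * (spinRep R C z (0, 1)).2 := by
    rw [← hr, mul_one]
  refine ⟨(spinRep R C z (1, 0)).1, (spinRep R C z (0, 1)).2, fun x y => ?_, fun x y => ?_,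
    fun x y => ?_⟩
  · rw [associator_apply, ← hl1, ← hl1, hl, sub_self]
  · rw [associator_apply, ← hr1, ← hr1, hr, sub_self]
  · have : ((x, y) : C × C) = (x, 0) + (0, y) := by simp
    rw [this, map_add, ← hl1, ← hr1]
    exact Prod.ext (by simp [h2]) (by simp [h1])

/-- An isometric autotopy of an octonion algebra. -/
structure IsIsometricAutotopy (t₁ t₂ t₃ : C ≃ₗ[R] C) : Prop where
  map_mul : ∀ x y, t₁ (x * y) = t₂ x * t₃ y
  norm₁ : ∀ x, octNorm R (t₁ x) = octNorm R x
  norm₂ : ∀ x, octNorm R (t₂ x) = octNorm R x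
  norm₃ : ∀ x, octNorm R (t₃ x) = octNorm R x

variable (C) in
/-- The natural involution as a linear equivalence. -/
def conjEquiv : C ≃ₗ[R] C :=
  LinearEquiv.ofInvolutive (octonionConj R C) (conj_conj R)

/-- The conjugate of a linear automorphism by the natural involution. -/
def conjAut (t : C ≃ₗ[R] C) : C ≃ₗ[R] C := (conjEquiv R C).trans (t.trans (conjEquiv R C))

theorem conjAut_apply (t : C ≃ₗ[R] C) (x : C) :
    conjAut R t x = octonionConj R C (t (octonionConj R C x)) := rfl

@[simp] theorem conjAut_conjAut (t : C ≃ₗ[R] C) : conjAut R (conjAut R t) = t := by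
  ext x; simp [conjAut_apply]

theorem norm_conjAut {t : C ≃ₗ[R] C} (h : ∀ x, octNorm R (t x) = octNorm R x) (x : C) :
    octNorm R (conjAut R t x) = octNorm R x := by
  rw [conjAut_apply, norm_conj, h, norm_conj]

theorem polar_map_map {t : C →ₗ[R] C} (h : ∀ x, octNorm R (t x) = octNorm R x) (x y : C) :
    octPolar R (t x) (t y) = octPolar R x y := by
  rw [polar_eq, polar_eq, ← map_add, h, h, h]

namespace IsIsometricAutotopy

variable {R} {t₁ t₂ t₃ : C ≃ₗ[R] C} (h : IsIsometricAutotopy R t₁ t₂ t₃)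

include h

/-- A triality symmetry: move the left factor across the polar form and use that `t₁` and `t₃` are
isometries. Together with `swap` it brings every component, up to conjugation, to the middle
position. -/
theorem rotate : IsIsometricAutotopy R t₃ (conjAut R t₂) t₁ where
  map_mul x y := by
    refine polar_ext (R := R) fun z => ?_
    obtain ⟨z, rfl⟩ := t₃.surjective z
    rw [conjAut_apply, polar_mul_left R _ (t₁ y), conj_conj, ← h.map_mul]
    have h1 := polar_map_map R (t := t₁.toLinearMap) h.norm₁ y (octonionConj R C x * z)
    have h3 := polar_map_map R (t := t₃.toLinearMap) h.norm₃ (x * y) z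
    simp only [LinearEquiv.coe_coe] at h1 h3
    rw [h1, h3, polar_mul_left]
  norm₁ := h.norm₃
  norm₂ := norm_conjAut R h.norm₂
  norm₃ := h.norm₁

theorem swap : IsIsometricAutotopy R t₂ t₁ (conjAut R t₃) where
  map_mul x y := by
    refine polar_ext (R := R) fun z => ?_
    obtain ⟨z, rfl⟩ := t₂.surjective z
    rw [conjAut_apply, polar_mul_right R (t₁ x), conj_conj, ← h.map_mul]
    have h1 := polar_map_map R (t := t₁.toLinearMap) h.norm₁ x (z * octonionConj R C y)
    have h2 := polar_map_map R (t := t₂.toLinearMap) h.norm₂ (x * y) z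
    simp only [LinearEquiv.coe_coe] at h1 h2
    rw [h1, h2, polar_mul_right]
  norm₁ := h.norm₂
  norm₂ := h.norm₁
  norm₃ := norm_conjAut R h.norm₃

/-- The pair `g = (t₁, t₃)` conjugates the operator of `z` to that of `φ z`. For central `z` this
operator is right multiplication by nuclear elements, which commutes with `g`; faithfulness on the
even part gives `φ z = z`. -/
theorem actsTriviallyOnCentre : ActsTriviallyOnCentre (norm (R := R) (C := C)) t₂ := by
  refine ⟨h.norm₂, fun z hz hc => ?_⟩
  set φ := CliffordAlgebra.map (⟨t₂.toLinearMap, h.norm₂⟩ : (norm (R := R) (C := C)) →qᵢ norm) with hφ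
  let g : (C × C) ≃ₗ[R] C × C := LinearEquiv.prodCongr t₁ t₃
  have key (z) (x : C × C) : spinRep R C (φ z) (g x) = g (spinRep R C z x) := by
    induction z using CliffordAlgebra.left_induction generalizing x with
    | algebraMap r => simp [AlgHom.commutes]
    | add y z hy hz => simp [hy, hz]
    | ι_mul y m hy =>
      rw [_root_.map_mul, _root_.map_mul, _root_.map_mul, Module.End.mul_apply,
        Module.End.mul_apply, hy, hφ, map_apply_ι, spinRep_ι, spinRep_ι]
      refine Prod.ext (h.map_mul _ _).symm ?_
      -- The lower summand involves `m̄`, and the rotated autotopy supplies `t₃(m̄ x) = conj(t₂ m) ·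
      -- t₁ x`.
      have := h.rotate.map_mul (octonionConj R C m) (spinRep R C y x).1
      rw [conjAut_apply, conj_conj] at this
      exact this.symm
  rw [← sub_eq_zero]
  have hinv {z} (hz : z ∈ even (norm (R := R) (C := C))) : involute z = z :=
    involute_eq_of_mem_even hz
  have hinvφ (z) : involute (φ z) = φ (involute z) := by
    have : (involute.comp φ : _ →ₐ[R] _) = φ.comp involute := by
      ext m
      simp [hφ]
    exact AlgHom.congr_fun this z
  refine eq_zero_of_map_eq_zero OctonionAlgebra.regular.2 (spinRep R C) ?_ ?_ ?_
  -- Scalars are recovered from their action on `1` by pairing with an octonion whose trace is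
  -- locally invertible.
  · intro r s hrs
    refine eq_of_forall_prime (R := R) fun p hp => ?_
    obtain ⟨u, -, -, hu, -⟩ := exists_norm_associator_notMem C p
    have h1 : r • (1 : C) = s • (1 : C) :=
      congrArg Prod.fst (LinearMap.congr_fun hrs ((1, 1) : C × C))
    have h2 := congrArg (octPolar R u) h1
    rw [polar_smul_right, polar_smul_right, mul_comm, mul_comm s] at h2
    exact ⟨_, hu, h2⟩
  · rw [map_sub, hinvφ, hinv hz]
  · rw [map_sub, sub_eq_zero]
    refine LinearMap.ext fun x => ?_
    obtain ⟨⟨x, y⟩, rfl⟩ := g.surjective x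
    obtain ⟨n, m, hn, hm, hnm⟩ := exists_isNuclear_spinRep R hz hc
    rw [key, hnm]
    change _ = spinRep R C z (t₁ x, t₃ y)
    rw [hnm]
    exact Prod.ext (linearMap_mul_of_isNuclear R hn t₁.toLinearMap x)
      (linearMap_mul_of_isNuclear R hm t₃.toLinearMap y)

end IsIsometricAutotopy

end OctonionAlgebra

end Autotopy

/-! ### Transitivity of autotopies -/

section Transitivity

namespace OctonionAlgebra

/-! ### Moving values at `1` by autotopies of similitudes -/

section Reachable

variable (R : Type u) {C : Type u} [CommRing R] [NonAssocRing C] [Module R C]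
  [IsScalarTower R C C] [SMulCommClass R C C] [OctonionAlgebra R C]

theorem smulOfUnit_unit_apply {R M : Type*} [CommRing R] [AddCommGroup M] [Module R M] {r : R}
    (hr : IsUnit r) (x : M) : LinearEquiv.smulOfUnit (M := M) hr.unit x = r • x := rfl

/-- Left multiplication by an invertible octonion. -/
noncomputable def mulLeftEquiv {c : C} (hc : IsUnit (octNorm R c)) : C ≃ₗ[R] C :=
  LinearEquiv.ofBijective (LinearMap.mulLeft R c) ⟨fun x y hxy => by
    have h := congrArg (octonionConj R C c * ·) hxy
    simp only [LinearMap.mulLeft_apply, conj_mul_mul] at h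
    exact hc.smul_left_cancel.1 h, fun x => by
    obtain ⟨u, hu⟩ := hc
    refine ⟨octonionConj R C c * ((↑u⁻¹ : R) • x), ?_⟩
    rw [LinearMap.mulLeft_apply, mul_conj_mul, ← hu, smul_smul, Units.mul_inv, one_smul]⟩

theorem mulLeftEquiv_apply {c : C} (hc : IsUnit (octNorm R c)) (x : C) :
    mulLeftEquiv R hc x = c * x := rfl

/-- Right multiplication by an invertible octonion. -/
noncomputable def mulRightEquiv {c : C} (hc : IsUnit (octNorm R c)) : C ≃ₗ[R] C :=
  LinearEquiv.ofBijective (LinearMap.mulRight R c) ⟨fun x y hxy => by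
    have h := congrArg (· * octonionConj R C c) hxy
    simp only [LinearMap.mulRight_apply, mul_mul_conj] at h
    exact hc.smul_left_cancel.1 h, fun x => by
    obtain ⟨u, hu⟩ := hc
    refine ⟨((↑u⁻¹ : R) • x) * octonionConj R C c, ?_⟩
    rw [LinearMap.mulRight_apply, mul_conj_mul', ← hu, smul_smul, Units.mul_inv, one_smul]⟩

theorem mulRightEquiv_apply {c : C} (hc : IsUnit (octNorm R c)) (x : C) :
    mulRightEquiv R hc x = x * c := rfl

/-- `y` and `z` are the values at `1` of the second and third components of an autotopy whose
components are similitudes. -/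
def IsReachable (y z : C) : Prop :=
  ∃ t₁ t₂ t₃ : C ≃ₗ[R] C, (∀ x y, t₁ (x * y) = t₂ x * t₃ y) ∧
    (∃ m : R, ∀ x, octNorm R (t₂ x) = m * octNorm R x) ∧
    (∃ m : R, ∀ x, octNorm R (t₃ x) = m * octNorm R x) ∧ t₂ 1 = y ∧ t₃ 1 = z

variable (C) in
theorem isReachable_one : IsReachable R (1 : C) 1 :=
  ⟨.refl R C, .refl R C, .refl R C, fun _ _ => rfl, ⟨1, fun _ => (one_mul _).symm⟩,
    ⟨1, fun _ => (one_mul _).symm⟩, rfl, rfl⟩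

namespace IsReachable

variable {R} {y z : C} (h : IsReachable R y z)

include h

/-- The left Moufang identity, read as an autotopy whose first component carries the extra factor
`q(c)`. Allowing similitudes avoids having to take square roots of norms. -/
theorem mul_mul {c : C} (hc : IsUnit (octNorm R c)) :
    IsReachable R ((c * y) * c) (octonionConj R C c * z) := by
  obtain ⟨t₁, t₂, t₃, h1, ⟨m, hm⟩, ⟨m', hm'⟩, rfl, rfl⟩ := h
  refine ⟨t₁.trans ((mulLeftEquiv R hc).trans (LinearEquiv.smulOfUnit hc.unit)),
    t₂.trans ((mulLeftEquiv R hc).trans (mulRightEquiv R hc)),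
    t₃.trans (mulLeftEquiv R (c := octonionConj R C c) (by rwa [norm_conj])), fun x y => ?_,
    ⟨octNorm R c * m * octNorm R c, fun x => ?_⟩, ⟨octNorm R c * m', fun x => ?_⟩, rfl, rfl⟩
  · simp only [LinearEquiv.trans_apply, mulLeftEquiv_apply, mulRightEquiv_apply,
      smulOfUnit_unit_apply, h1]
    rw [moufang_left]
  · simp only [LinearEquiv.trans_apply, mulLeftEquiv_apply, mulRightEquiv_apply]
    rw [norm_mul', norm_mul', hm]; ring
  · simp only [LinearEquiv.trans_apply, mulLeftEquiv_apply]
    rw [norm_mul', norm_conj, hm', mul_assoc]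

theorem mul_left_right {d : C} (hd : IsUnit (octNorm R d)) : IsReachable R (d * y) (z * d) := by
  obtain ⟨t₁, t₂, t₃, h1, ⟨m, hm⟩, ⟨m', hm'⟩, rfl, rfl⟩ := h
  refine ⟨t₁.trans ((mulLeftEquiv R hd).trans (mulRightEquiv R hd)),
    t₂.trans (mulLeftEquiv R hd), t₃.trans (mulRightEquiv R hd), fun x y => ?_,
    ⟨octNorm R d * m, fun x => ?_⟩, ⟨m' * octNorm R d, fun x => ?_⟩, rfl, rfl⟩
  · simp only [LinearEquiv.trans_apply, mulLeftEquiv_apply, mulRightEquiv_apply, h1]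
    rw [moufang_mid R]
  · simp only [LinearEquiv.trans_apply, mulLeftEquiv_apply]
    rw [norm_mul', hm, mul_assoc]
  · simp only [LinearEquiv.trans_apply, mulRightEquiv_apply]
    rw [norm_mul', hm']; ring

theorem smul_smul {r s : R} (hr : IsUnit r) (hs : IsUnit s) : IsReachable R (r • y) (s • z) := by
  obtain ⟨t₁, t₂, t₃, h1, ⟨m, hm⟩, ⟨m', hm'⟩, rfl, rfl⟩ := h
  refine ⟨t₁.trans (LinearEquiv.smulOfUnit (hr.mul hs).unit), t₂.trans (LinearEquiv.smulOfUnit hr.unit),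
    t₃.trans (LinearEquiv.smulOfUnit hs.unit), fun x y => ?_,
    ⟨r * r * m, fun x => ?_⟩, ⟨s * s * m', fun x => ?_⟩, rfl, rfl⟩
  · simp only [LinearEquiv.trans_apply, smulOfUnit_unit_apply, h1, smul_mul_assoc, mul_smul_comm,
      _root_.smul_smul, mul_comm r]
  · simp only [LinearEquiv.trans_apply, smulOfUnit_unit_apply]
    rw [norm_smul, hm]; ring
  · simp only [LinearEquiv.trans_apply, smulOfUnit_unit_apply]
    rw [norm_smul, hm']; ring

/-- Evaluating at `1` shows that both multipliers equal `1`; the first component is then isometric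
because `x = x · 1`. -/
theorem exists_isIsometricAutotopy (hy : octNorm R y = 1) (hz : octNorm R z = 1) :
    ∃ t₁ t₂ t₃ : C ≃ₗ[R] C, IsIsometricAutotopy R t₁ t₂ t₃ ∧ t₂ 1 = y ∧ t₃ 1 = z := by
  obtain ⟨t₁, t₂, t₃, h1, ⟨m, hm⟩, ⟨m', hm'⟩, rfl, rfl⟩ := h
  have hm1 : m = 1 := by rw [← hy, hm, norm_one, mul_one]
  have hm1' : m' = 1 := by rw [← hz, hm', norm_one, mul_one]
  subst hm1 hm1'
  refine ⟨t₁, t₂, t₃, ⟨h1, fun x => ?_, fun x => by rw [hm, one_mul],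
    fun x => by rw [hm', one_mul]⟩, rfl, rfl⟩
  rw [← mul_one x, h1, norm_mul', hm, hm', norm_mul', one_mul, one_mul]

end IsReachable

variable {R}

/-- Put `d = (cw)z̄`, which is pure by the second orthogonality. The move by `d̄` takes `(1, z)` to
`(-q(d), q(z)cw)`, and the move by the pure element `c` takes this to `(q(d)q(c), q(z)q(c)w)`; unit
scalars are then divided out. -/
theorem IsReachable.trans_one {z w c : C} (h : IsReachable R 1 z) (hz : IsUnit (octNorm R z))
    (hw : IsUnit (octNorm R w)) (hc : IsUnit (octNorm R c)) (h1 : octPolar R 1 c = 0)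
    (h2 : octPolar R (z * octonionConj R C w) c = 0) : IsReachable R 1 w := by
  obtain ⟨d, hd⟩ : ∃ d, d = (c * w) * octonionConj R C z := ⟨_, rfl⟩
  have hdn : octNorm R d = octNorm R c * octNorm R w * octNorm R z := by
    rw [hd, norm_mul', norm_mul', norm_conj]
  have hd1 : octPolar R 1 d = 0 := by
    rw [hd, polar_mul_conj, one_mul, polar_comm, polar_mul_right, polar_comm, h2]
  have hdu : IsUnit (octNorm R d) := hdn ▸ (hc.mul hw).mul hz
  have sq {x : C} (hx : octPolar R 1 x = 0) : x * x = -(octNorm R x • (1 : C)) := by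
    rw [← conj_mul_self, conj_eq_neg R hx, neg_mul, neg_neg]
  have h3 := h.mul_mul (c := octonionConj R C d) (by rwa [norm_conj])
  rw [mul_one, conj_conj, conj_eq_neg R hd1, neg_mul_neg, sq hd1, hd, mul_conj_mul', ← hd] at h3
  have h4 := h3.mul_mul hc
  rw [mul_neg, mul_smul_comm, mul_one, neg_mul, smul_mul_assoc, sq h1, smul_neg, neg_neg,
    mul_smul_comm, conj_mul_mul, _root_.smul_smul, _root_.smul_smul] at h4
  obtain ⟨u, hu⟩ := hdu.mul hc
  obtain ⟨v, hv⟩ := hz.mul hc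
  have h5 := h4.smul_smul (u⁻¹).isUnit (v⁻¹).isUnit
  rwa [← hu, ← hv, _root_.smul_smul, _root_.smul_smul, Units.inv_mul, Units.inv_mul, one_smul,
    one_smul] at h5

/-- A sufficient condition for two octonions of norm `1` to be the values at `1` of the second and
third components of an isometric autotopy. -/
theorem exists_isIsometricAutotopy {α β w c d : C} (hα : octNorm R α = 1) (hβ : octNorm R β = 1)
    (hw : IsUnit (octNorm R w)) (hc : IsUnit (octNorm R c)) (hd : IsUnit (octNorm R d))
    (hc1 : octPolar R 1 c = 0) (hcw : octPolar R (octonionConj R C w) c = 0)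
    (hd1 : octPolar R 1 d = 0)
    (hdw : octPolar R (w * octonionConj R C (α * octonionConj R C β)) d = 0) :
    ∃ t₁ t₂ t₃ : C ≃ₗ[R] C, IsIsometricAutotopy R t₁ t₂ t₃ ∧ t₂ 1 = β ∧ t₃ 1 = α := by
  have h1 : IsReachable R 1 w := (isReachable_one R C).trans_one
    (by rw [norm_one]; exact isUnit_one) hw hc hc1 (by rwa [one_mul])
  have h2 : IsReachable R 1 (α * octonionConj R C β) := h1.trans_one hw
    (by rw [norm_mul', norm_conj, hα, hβ, one_mul]; exact isUnit_one) hd hd1 hdw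
  -- The middle Moufang move sends `(1, αβ̄)` to `(β, α)`, since `(αβ̄)β = α`.
  have h3 := h2.mul_left_right (d := β) (by rw [hβ]; exact isUnit_one)
  rw [mul_one, mul_conj_mul', hβ, one_smul] at h3
  exact h3.exists_isIsometricAutotopy hβ hα

end Reachable

/-! ### Local choice of the auxiliary octonions -/

section Local

variable {R C : Type u} [CommRing R] [NonAssocRing C] [Module R C]
  [IsScalarTower R C C] [SMulCommClass R C C] [OctonionAlgebra R C]

/-- Orthogonality is needed over `R`, not just modulo `p`. A solution from the residue field is
lifted and corrected by Cramer's rule; the corrections have coefficients in `p`, so the norm stays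
outside `p`. -/
theorem exists_pure_orthogonal_norm_notMem (p : Ideal R) [p.IsPrime] {z : C}
    (hz : (1 : p.ResidueField) ⊗ₜ[R] z ∉ Submodule.span p.ResidueField {1}) :
    ∃ c : C, octPolar R 1 c = 0 ∧ octPolar R z c = 0 ∧ octNorm R c ∉ p := by
  let κ := p.ResidueField
  -- Independence of `1` and `z` in the fibre and nondegeneracy give two vectors whose matrix of
  -- pairings with `1, z` is invertible at `p`.
  obtain ⟨u, v, huv⟩ : ∃ u v : C, octPolar R u 1 * octPolar R v z -
      octPolar R u z * octPolar R v 1 ∉ p := by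
    by_contra! h
    obtain ⟨u, -, -, hu, -⟩ := exists_norm_associator_notMem C p
    rw [← Ideal.algebraMap_residueField_eq_zero] at hu
    have h1 (v : κ ⊗[R] C) : octPolar κ ((algebraMap R κ (octPolar R u 1)) • ((1 : κ) ⊗ₜ z) -
        (algebraMap R κ (octPolar R u z)) • (1 : κ ⊗[R] C)) v = 0 := by
      induction v with
      | zero => simp
      | add x y hx hy => rw [polar_add_right, hx, hy, add_zero]
      | tmul s v =>
        rw [show s ⊗ₜ[R] v = s • ((1 : κ) ⊗ₜ[R] v) by rw [smul_tmul', smul_eq_mul, mul_one],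
          polar_smul_right, polar_sub_left, polar_smul_left, polar_smul_left,
          Algebra.TensorProduct.one_def, octPolar_one_tmul, octPolar_one_tmul, ← map_mul,
          ← map_mul, ← map_sub, polar_comm R z, polar_comm R 1,
          Ideal.algebraMap_residueField_eq_zero.2 (h u v), mul_zero]
    have h2 := polar_ext (R := κ) fun v => (h1 v).trans (polar_zero_left κ v).symm
    refine hz (Submodule.mem_span_singleton.2
      ⟨(algebraMap R κ (octPolar R u 1))⁻¹ * algebraMap R κ (octPolar R u z), ?_⟩)
    rw [mul_smul, ← sub_eq_zero.1 h2, smul_smul, inv_mul_cancel₀ hu, one_smul]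
  obtain ⟨e, he, he'⟩ := exists_orthogonal_norm_ne_zero (K := κ) (V := κ ⊗[R] C) (n := 2)
    (by norm_num) ![1, 1 ⊗ₜ z] 0 (by simp)
  obtain ⟨s, hs, c, hc⟩ := exists_smul_eq_one_tmul p e
  have e1 : octPolar R c 1 ∈ p := by
    rw [← Ideal.algebraMap_residueField_eq_zero, ← octPolar_one_tmul, ← hc, polar_smul_left,
      polar_comm, ← Algebra.TensorProduct.one_def]
    exact mul_eq_zero_of_right _ (he 0)
  have e2 : octPolar R c z ∈ p := by
    rw [← Ideal.algebraMap_residueField_eq_zero, ← octPolar_one_tmul, ← hc, polar_smul_left,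
      polar_comm]
    exact mul_eq_zero_of_right _ (he 1)
  have e3 : octNorm R c ∉ p := by
    rw [← Ideal.algebraMap_residueField_eq_zero] at hs ⊢
    rw [← octNorm_one_tmul, ← hc, norm_smul]
    exact mul_ne_zero (mul_ne_zero hs hs) he'
  let D := octPolar R u 1 * octPolar R v z - octPolar R u z * octPolar R v 1
  let α := octPolar R c 1 * octPolar R v z - octPolar R c z * octPolar R v 1
  let β := octPolar R u 1 * octPolar R c z - octPolar R u z * octPolar R c 1
  have hα : α ∈ p := sub_mem (p.mul_mem_right _ e1) (p.mul_mem_right _ e2)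
  have hβ : β ∈ p := sub_mem (p.mul_mem_left _ e2) (p.mul_mem_left _ e1)
  refine ⟨D • c - (α • u + β • v), ?_, ?_, fun hmem => ?_⟩
  · rw [polar_comm]
    simp only [polar_sub_left, polar_add_left, polar_smul_left, D, α, β]
    ring
  · rw [polar_comm]
    simp only [polar_sub_left, polar_add_left, polar_smul_left, D, α, β]
    ring
  · have hDc : octNorm R (D • c) ∈ p := by
      rw [← sub_add_cancel (D • c) (α • u + β • v), norm_add, norm_add R (α • u), norm_smul, norm_smul]
      refine add_mem (add_mem hmem (add_mem (add_mem ?_ ?_) ?_)) ?_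
      · exact p.mul_mem_right _ (p.mul_mem_right _ hα)
      · exact p.mul_mem_right _ (p.mul_mem_right _ hβ)
      · rw [polar_smul_left]; exact p.mul_mem_right _ hα
      · rw [polar_add_right, polar_smul_right, polar_smul_right]
        exact add_mem (p.mul_mem_right _ hα) (p.mul_mem_right _ hβ)
    rw [norm_smul] at hDc
    rcases Ideal.IsPrime.mem_or_mem ‹_› hDc with h | h
    · exact (Ideal.IsPrime.mem_or_mem ‹_› h).elim huv huv
    · exact e3 h

/-- Choose an anisotropic `w` off the lines of `1` and `x` in the fibre. Then neither `w̄` nor `w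
x̄` is a scalar there, as `(w x̄)x = w`, so both orthogonality problems are solvable. -/
theorem exists_transitivity_data (p : Ideal R) [p.IsPrime] {x : C} (hx : octNorm R x = 1) :
    ∃ w c d : C, octPolar R 1 c = 0 ∧ octPolar R (octonionConj R C w) c = 0 ∧
      octPolar R 1 d = 0 ∧ octPolar R (w * octonionConj R C x) d = 0 ∧
      octNorm R w * octNorm R c * octNorm R d ∉ p := by
  let κ := p.ResidueField
  obtain ⟨w', hw0, hw1, hw2⟩ := exists_norm_ne_zero_of_field κ (κ ⊗[R] C) (1 ⊗ₜ x)
  obtain ⟨s, hs, w, hw⟩ := exists_smul_eq_one_tmul p w'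
  rw [← Ideal.algebraMap_residueField_eq_zero] at hs
  have hw0' : octNorm R w ∉ p := by
    rw [← Ideal.algebraMap_residueField_eq_zero, ← octNorm_one_tmul, ← hw, norm_smul]
    exact mul_ne_zero (mul_ne_zero hs hs) hw0
  have hconj (y : C) : (1 : κ) ⊗ₜ[R] octonionConj R C y =
      octonionConj κ (κ ⊗[R] C) ((1 : κ) ⊗ₜ[R] y) := by
    rw [octonionConj_baseChange]; rfl
  have hspan {y : κ ⊗[R] C} (h : algebraMap R κ s • w' ∈ Submodule.span κ {y}) :
      w' ∈ Submodule.span κ {y} := by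
    have := Submodule.smul_mem _ (algebraMap R κ s)⁻¹ h
    rwa [smul_smul, inv_mul_cancel₀ hs, one_smul] at this
  obtain ⟨c, hc1, hc2, hc3⟩ := exists_pure_orthogonal_norm_notMem p (z := octonionConj R C w)
    fun h => hw1 (hspan (by
      obtain ⟨l, hl⟩ := Submodule.mem_span_singleton.1 h
      rw [hconj] at hl
      refine Submodule.mem_span_singleton.2 ⟨l, ?_⟩
      rw [hw, ← conj_conj κ ((1 : κ) ⊗ₜ[R] w), ← hl, map_smul, conj_one]))
  obtain ⟨d, hd1, hd2, hd3⟩ := exists_pure_orthogonal_norm_notMem p (z := w * octonionConj R C x)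
    fun h => hw2 (hspan (by
      obtain ⟨l, hl⟩ := Submodule.mem_span_singleton.1 h
      refine Submodule.mem_span_singleton.2 ⟨l, ?_⟩
      rw [one_tmul_mul, hconj] at hl
      have h3 := congrArg (· * ((1 : κ) ⊗ₜ[R] x)) hl
      simp only [smul_mul_assoc, one_mul, mul_conj_mul', octNorm_one_tmul, hx, map_one,
        one_smul] at h3
      rw [hw, h3]))
  refine ⟨w, c, d, hc1, hc2, hd1, hd2, fun h => ?_⟩
  rcases Ideal.IsPrime.mem_or_mem ‹_› h with h | h
  · exact (Ideal.IsPrime.mem_or_mem ‹_› h).elim hw0' hc3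
  · exact hd3 h

end Local

end OctonionAlgebra

end Transitivity

/-! ### The fibres of `Π` are torsors under the automorphism group -/

section FibreTorsor

theorem faithfullyFlat_pi {A : Type u} [CommRing A] {ι : Type*} [Finite ι] (T : ι → Type*)
    [∀ i, CommRing (T i)] [∀ i, Algebra A (T i)] [∀ i, Module.Flat A (T i)]
    (h : ∀ p : PrimeSpectrum A, ∃ i, p ∈ Set.range (PrimeSpectrum.comap (algebraMap A (T i)))) :
    Module.FaithfullyFlat A (∀ i, T i) := by
  classical
  have := Fintype.ofFinite ι
  have : Module.Flat A (∀ i, T i) :=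
    Module.Flat.of_linearEquiv (DFinsupp.linearEquivFunOnFintype (R := A) (M := T)).symm
  refine Module.FaithfullyFlat.of_comap_surjective fun p => ?_
  obtain ⟨i, q, rfl⟩ := h p
  exact ⟨PrimeSpectrum.comap (Pi.evalRingHom T i) q, rfl⟩

namespace OctonionAlgebra

section

variable {R C : Type u} [CommRing R] [NonAssocRing C] [Module R C]
  [IsScalarTower R C C] [SMulCommClass R C C] [OctonionAlgebra R C]

theorem conjAut_mul (f g : C ≃ₗ[R] C) : conjAut R (f * g) = conjAut R f * conjAut R g := by
  ext x
  simp [conjAut_apply]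

/-- An isometry fixing `1` preserves traces, hence commutes with the involution. -/
theorem conjAut_eq_self {g : C ≃ₗ[R] C} (hg : ∀ x, octNorm R (g x) = octNorm R x) (h1 : g 1 = 1) :
    conjAut R g = g := by
  ext x
  have := polar_map_map R (t := g.toLinearMap) hg (octonionConj R C x) 1
  simp only [LinearEquiv.coe_coe, h1] at this
  rw [conjAut_apply, conj_apply, this, polar_conj_one, conj_apply, map_sub, map_smul, h1,
    sub_sub_cancel]

theorem IsIsometricAutotopy.eq_mul {t₁ t₂ t₃ t₁' t₂' t₃' : C ≃ₗ[R] C}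
    (h : IsIsometricAutotopy R t₁ t₂ t₃) (h' : IsIsometricAutotopy R t₁' t₂' t₃')
    (h₂ : t₂' 1 = t₂ 1) (h₃ : t₃' 1 = t₃ 1) :
    (∀ x y, (t₁⁻¹ * t₁') (x * y) = (t₁⁻¹ * t₁') x * (t₁⁻¹ * t₁') y) ∧
      conjAut R (t₁⁻¹ * t₁') = t₁⁻¹ * t₁' ∧
      t₂' = t₂ * (t₁⁻¹ * t₁') ∧ t₃' = t₃ * (t₁⁻¹ * t₁') := by
  have hm (x y : C) : (t₁⁻¹ * t₁') (x * y) = t₂.symm (t₂' x) * t₃.symm (t₃' y) := by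
    change t₁.symm (t₁' (x * y)) = _
    rw [LinearEquiv.symm_apply_eq, h.map_mul, h'.map_mul, LinearEquiv.apply_symm_apply,
      LinearEquiv.apply_symm_apply]
  have e2 (x : C) : (t₁⁻¹ * t₁') x = t₂.symm (t₂' x) := by
    have := hm x 1
    rwa [h₃, LinearEquiv.symm_apply_apply, mul_one, mul_one] at this
  have e3 (x : C) : (t₁⁻¹ * t₁') x = t₃.symm (t₃' x) := by
    have := hm 1 x
    rwa [h₂, LinearEquiv.symm_apply_apply, one_mul, one_mul] at this
  refine ⟨fun x y => by rw [hm, ← e2, ← e3], conjAut_eq_self (fun x => ?_) ?_,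
    LinearEquiv.ext fun x => ?_, LinearEquiv.ext fun x => ?_⟩
  · rw [e2, ← h.norm₂, LinearEquiv.apply_symm_apply, h'.norm₂]
  · rw [e2, h₂, LinearEquiv.symm_apply_apply]
  · rw [LinearEquiv.mul_apply, e2, LinearEquiv.apply_symm_apply]
  · rw [LinearEquiv.mul_apply, e3, LinearEquiv.apply_symm_apply]

variable {S T : Type u} [CommRing S] [Algebra R S] [CommRing T] [Algebra R T]

theorem IsIsometricAutotopy.extendAut {t₁ t₂ t₃ : S ⊗[R] C ≃ₗ[S] S ⊗[R] C}
    (h : IsIsometricAutotopy S t₁ t₂ t₃) (φ : S →ₐ[R] T) :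
    IsIsometricAutotopy T (extendAut C φ t₁) (extendAut C φ t₂) (extendAut C φ t₃) where
  map_mul := by
    have key : (LinearMap.mul T (T ⊗[R] C)).compr₂ (_root_.extendAut C φ t₁).toLinearMap =
        (LinearMap.mul T (T ⊗[R] C)).compl₁₂ (_root_.extendAut C φ t₂).toLinearMap
          (_root_.extendAut C φ t₃).toLinearMap := by
      refine extendEnd_ext C φ fun x => extendEnd_ext C φ fun y => ?_
      simp only [LinearMap.compr₂_apply, LinearMap.compl₁₂_apply, LinearMap.mul_apply',
        LinearEquiv.coe_coe]
      rw [← restr_mul, extendAut_restr, extendAut_restr, extendAut_restr, h.map_mul, restr_mul]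
    exact fun x y => LinearMap.congr_fun (LinearMap.congr_fun key x) y
  norm₁ := normOver_eq_of_restr φ (_root_.extendAut C φ t₁).toLinearMap fun x => by
    rw [LinearEquiv.coe_coe, extendAut_restr, octNorm_restr, octNorm_restr, h.norm₁]
  norm₂ := normOver_eq_of_restr φ (_root_.extendAut C φ t₂).toLinearMap fun x => by
    rw [LinearEquiv.coe_coe, extendAut_restr, octNorm_restr, octNorm_restr, h.norm₂]
  norm₃ := normOver_eq_of_restr φ (_root_.extendAut C φ t₃).toLinearMap fun x => by
    rw [LinearEquiv.coe_coe, extendAut_restr, octNorm_restr, octNorm_restr, h.norm₃]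

theorem IsIsometricAutotopy.isSpecialOrthogonal {t₁ t₂ t₃ : S ⊗[R] C ≃ₗ[S] S ⊗[R] C}
    (h : IsIsometricAutotopy S t₁ t₂ t₃) : IsSpecialOrthogonal C S t₂ :=
  fun T _ _ φ => (h.extendAut (T := T) φ).actsTriviallyOnCentre

/-- The related triple attached to an isometric autotopy. -/
noncomputable def IsIsometricAutotopy.relatedTriple {t₁ t₂ t₃ : S ⊗[R] C ≃ₗ[S] S ⊗[R] C}
    (h : IsIsometricAutotopy S t₁ t₂ t₃) : RelatedTriple R C S where
  t₁ := t₁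
  t₂ := conjAut S t₂
  t₃ := conjAut S t₃
  so₁ := h.swap.isSpecialOrthogonal
  so₂ := h.rotate.isSpecialOrthogonal
  so₃ := h.rotate.swap.rotate.isSpecialOrthogonal
  related x y := by
    rw [h.map_mul, ← octonionConj_baseChange, ← conjAut_apply, ← conjAut_apply, conjAut_conjAut,
      conjAut_conjAut]

theorem norm_map_of_isSpecialOrthogonal {t : S ⊗[R] C ≃ₗ[S] S ⊗[R] C}
    (h : IsSpecialOrthogonal C S t) (x : S ⊗[R] C) : octNorm S (t x) = octNorm S x := by
  obtain ⟨ht, -⟩ := h S (AlgHom.id R S)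
  rw [extendAut_id] at ht
  exact ht x

theorem isIsometricAutotopy_of_relatedTriple (t : RelatedTriple R C S) :
    IsIsometricAutotopy S t.t₁ (conjAut S t.t₂) (conjAut S t.t₃) where
  map_mul x y := by
    rw [t.related, conjAut_apply, conjAut_apply, octonionConj_baseChange]
  norm₁ := norm_map_of_isSpecialOrthogonal t.so₁
  norm₂ := norm_conjAut S (norm_map_of_isSpecialOrthogonal t.so₂)
  norm₃ := norm_conjAut S (norm_map_of_isSpecialOrthogonal t.so₃)

variable {a b : C}

theorem conjAut_one_eq (t : S ⊗[R] C ≃ₗ[S] S ⊗[R] C) :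
    conjAut S t 1 = octonionConj S (S ⊗[R] C) (t 1) := by
  rw [conjAut_apply, conj_one]

theorem existsUnique_isTranslate (t t' : PiFibre R S a b) :
    ∃! g : S ⊗[R] C ≃ₗ[S] S ⊗[R] C, g ∈ octonionAut R C S ∧ t.IsTranslate g t' := by
  obtain ⟨h1, h2, h3, h4⟩ := (isIsometricAutotopy_of_relatedTriple t.1).eq_mul
    (isIsometricAutotopy_of_relatedTriple t'.1)
    (by rw [conjAut_one_eq, conjAut_one_eq, t.2.2, t'.2.2])
    (by rw [conjAut_one_eq, conjAut_one_eq, t.2.1, t'.2.1])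
  refine ⟨t.1.t₁⁻¹ * t'.1.t₁, ⟨h1, by rw [mul_inv_cancel_left], ?_, ?_⟩, ?_⟩
  · have := congrArg (conjAut S) h3
    rwa [conjAut_conjAut, conjAut_mul, conjAut_conjAut, h2] at this
  · have := congrArg (conjAut S) h4
    rwa [conjAut_conjAut, conjAut_mul, conjAut_conjAut, h2] at this
  · rintro g ⟨-, hg, -⟩
    rw [hg, inv_mul_cancel_left]

theorem nonempty_piFibre {w c d : S ⊗[R] C} (ha : octNorm R a = 1) (hb : octNorm R b = 1)
    (hw : IsUnit (octNorm S w)) (hc : IsUnit (octNorm S c)) (hd : IsUnit (octNorm S d))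
    (hc1 : octPolar S 1 c = 0) (hcw : octPolar S (octonionConj S (S ⊗[R] C) w) c = 0)
    (hd1 : octPolar S 1 d = 0)
    (hdw : octPolar S (w * octonionConj S (S ⊗[R] C)
      (1 ⊗ₜ (octonionConj R C a * b))) d = 0) : Nonempty (PiFibre R S a b) := by
  have hconj (y : C) : (1 : S) ⊗ₜ[R] octonionConj R C y =
      octonionConj S (S ⊗[R] C) ((1 : S) ⊗ₜ[R] y) := by
    rw [octonionConj_baseChange]; rfl
  -- Related triples carry the conjugated components, so the autotopy must take the values `b̄` and
  -- `ā`; the target `αβ̄` is then `āb`.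
  obtain ⟨t₁, t₂, t₃, h, h2, h3⟩ := exists_isIsometricAutotopy (R := S)
    (α := octonionConj S (S ⊗[R] C) (1 ⊗ₜ a)) (β := octonionConj S (S ⊗[R] C) (1 ⊗ₜ b))
    (by rw [norm_conj, octNorm_one_tmul, ha, map_one])
    (by rw [norm_conj, octNorm_one_tmul, hb, map_one])
    hw hc hd hc1 hcw hd1 (by rwa [conj_conj, ← hconj, ← one_tmul_mul])
  refine ⟨h.relatedTriple, ?_, ?_⟩
  · change conjAut S t₃ 1 = _
    rw [conjAut_one_eq, h3, conj_conj]
  · change conjAut S t₂ 1 = _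
    rw [conjAut_one_eq, h2, conj_conj]

end

section

variable {R C : Type u} [CommRing R] [NonAssocRing C] [Module R C]
  [IsScalarTower R C C] [SMulCommClass R C C] [OctonionAlgebra R C]

/-- The norm products of local transitivity data generate the unit ideal. Finitely many suffice, and
over the product of the corresponding localisations the data are assembled factor by factor. -/
theorem exists_faithfullyFlat_piFibre (a b : C) (ha : octNorm R a = 1) (hb : octNorm R b = 1) :
    ∃ (T : Type u) (_ : CommRing T) (_ : Algebra R T), Module.FaithfullyFlat R T ∧
      Algebra.FinitePresentation R T ∧ Nonempty (PiFibre R T a b) := by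
  classical
  have hx : octNorm R (octonionConj R C a * b) = 1 := by rw [norm_mul', norm_conj, ha, hb, one_mul]
  obtain ⟨x, hxx⟩ : ∃ x, x = octonionConj R C a * b := ⟨_, rfl⟩
  rw [← hxx] at hx
  let F : Set R := {f | ∃ w c d : C, octPolar R 1 c = 0 ∧ octPolar R (octonionConj R C w) c = 0 ∧
      octPolar R 1 d = 0 ∧ octPolar R (w * octonionConj R C x) d = 0 ∧
      octNorm R w * octNorm R c * octNorm R d = f}
  have hF : Ideal.span F = ⊤ := by
    by_contra hne
    obtain ⟨m, hm, hle⟩ := Ideal.exists_le_maximal _ hne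
    have := hm.isPrime
    obtain ⟨w, c, d, h1, h2, h3, h4, h5⟩ := exists_transitivity_data m hx
    exact h5 (hle (Ideal.subset_span ⟨w, c, d, h1, h2, h3, h4, rfl⟩))
  obtain ⟨s, hsF, hs⟩ := (Ideal.span_eq_top_iff_finite F).1 hF
  choose w c d h1 h2 h3 h4 h5 using fun f : s => hsF f.2
  let T : s → Type u := fun f => Localization.Away (f : R)
  have (f : s) : Algebra.FinitePresentation R (T f) :=
    IsLocalization.Away.finitePresentation (f : R)
  have (f : s) : Module.Flat R (T f) := IsLocalization.flat _ (Submonoid.powers (f : R))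
  refine ⟨∀ f, T f, inferInstance, inferInstance, faithfullyFlat_pi T fun p => ?_, inferInstance, ?_⟩
  · obtain ⟨f, hf, hfp⟩ : ∃ f ∈ s, f ∉ p.asIdeal := by
      by_contra! h
      exact p.2.ne_top (top_le_iff.1 (hs ▸ Ideal.span_le.2 h))
    refine ⟨⟨f, hf⟩, ?_⟩
    rw [PrimeSpectrum.localization_away_comap_range (T ⟨f, hf⟩) f]
    exact hfp
  · let glue (v : s → C) : (∀ f, T f) ⊗[R] C := ∑ f, Pi.single f 1 ⊗ₜ v f
    have hglue (v : s → C) (f : s) : restr C (Pi.evalAlgHom R T f) (glue v) = 1 ⊗ₜ v f := by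
      simp only [glue, map_sum, restr_tmul, Pi.evalAlgHom_apply]
      rw [Finset.sum_eq_single f]
      · rw [Pi.single_eq_same]
      · intro g _ hg
        rw [Pi.single_eq_of_ne hg.symm, zero_tmul]
      · simp
    have hconj {S : Type u} [CommRing S] [Algebra R S] (y : C) : (1 : S) ⊗ₜ[R] octonionConj R C y =
        octonionConj S (S ⊗[R] C) ((1 : S) ⊗ₜ[R] y) := by
      rw [octonionConj_baseChange]; rfl
    have hunit (f : s) : IsUnit (algebraMap R (T f) (octNorm R (w f)) *
        algebraMap R (T f) (octNorm R (c f)) * algebraMap R (T f) (octNorm R (d f))) := by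
      rw [← map_mul, ← map_mul, h5]
      exact IsLocalization.Away.algebraMap_isUnit (f : R)
    have hnorm (v : s → C) (f : s) : octNorm (∀ f, T f) (glue v) f =
        algebraMap R (T f) (octNorm R (v f)) := by
      rw [← octNorm_one_tmul, ← hglue, octNorm_restr]; rfl
    refine nonempty_piFibre (w := glue w) (c := glue c) (d := glue d) ha hb
      (Pi.isUnit_iff.2 fun f => ?_) (Pi.isUnit_iff.2 fun f => ?_) (Pi.isUnit_iff.2 fun f => ?_)
      (funext fun f => ?_) (funext fun f => ?_) (funext fun f => ?_) (funext fun f => ?_)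
    · rw [hnorm]
      exact isUnit_of_mul_isUnit_left (isUnit_of_mul_isUnit_left (hunit f))
    · rw [hnorm]
      exact isUnit_of_mul_isUnit_right (isUnit_of_mul_isUnit_left (hunit f))
    · rw [hnorm]
      exact isUnit_of_mul_isUnit_right (hunit f)
    · have := octPolar_restr (Pi.evalAlgHom R T f) (1 : (∀ f, T f) ⊗[R] C) (glue c)
      rw [hglue, restr_one, Algebra.TensorProduct.one_def, octPolar_one_tmul, h1, map_zero] at this
      exact this.symm
    · have := octPolar_restr (Pi.evalAlgHom R T f)
        (octonionConj (∀ f, T f) ((∀ f, T f) ⊗[R] C) (glue w)) (glue c)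
      rw [hglue, octonionConj_baseChange, restr_conjOver, ← octonionConj_baseChange, hglue, ← hconj,
        octPolar_one_tmul, h2, map_zero] at this
      rw [octonionConj_baseChange]
      exact this.symm
    · have := octPolar_restr (Pi.evalAlgHom R T f) (1 : (∀ f, T f) ⊗[R] C) (glue d)
      rw [hglue, restr_one, Algebra.TensorProduct.one_def, octPolar_one_tmul, h3, map_zero] at this
      exact this.symm
    · have := octPolar_restr (Pi.evalAlgHom R T f)
        (glue w * octonionConj (∀ f, T f) ((∀ f, T f) ⊗[R] C) (1 ⊗ₜ x)) (glue d)
      rw [hglue, restr_mul, hglue, ← hconj, restr_tmul, map_one, ← one_tmul_mul,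
        octPolar_one_tmul, h4, map_zero] at this
      rw [← hxx, ← hconj]
      exact this.symm

end

end OctonionAlgebra

end FibreTorsor

/-! ### Faithfully flat descent for elements -/

section Descent

section Unbundled

variable {R S M : Type u} [CommRing R] [CommRing S] [Algebra R S] [AddCommGroup M] [Module R M]
  {ι : Type} [Finite ι] (T : ι → Type u) [∀ i, CommRing (T i)] [∀ i, Algebra R (T i)]
  [∀ i, Algebra S (T i)] [∀ i, IsScalarTower R S (T i)]

/-- A finite decomposition of the identity through the `N' k` survives tensoring, so the projections
remain jointly injective. -/
theorem rTensor_ext {κ : Type*} [Fintype κ] {N : Type*} [AddCommGroup N] [Module R N]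
    {N' : κ → Type*} [∀ k, AddCommGroup (N' k)] [∀ k, Module R (N' k)] (p : ∀ k, N →ₗ[R] N' k)
    (s : ∀ k, N' k →ₗ[R] N) (h : ∀ n, ∑ k, s k (p k n) = n) {x y : N ⊗[R] M}
    (hxy : ∀ k, (p k).rTensor M x = (p k).rTensor M y) : x = y := by
  have h' : ∑ k, s k ∘ₗ p k = LinearMap.id := LinearMap.ext fun n => by
    rw [LinearMap.sum_apply]; exact h n
  have key (z : N ⊗[R] M) : z = ∑ k, (s k).rTensor M ((p k).rTensor M z) := by
    conv_lhs => rw [← LinearMap.id_apply (R := R) z, ← LinearMap.rTensor_id, ← h',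
      ← LinearMap.coe_rTensorHom, map_sum, LinearMap.sum_apply]
    refine Finset.sum_congr rfl fun k _ => ?_
    rw [LinearMap.coe_rTensorHom, LinearMap.rTensor_comp_apply]
  rw [key x, key y]
  exact Finset.sum_congr rfl fun k _ => by rw [hxy k]

theorem restr_pi_injective {x y : (∀ i, T i) ⊗[R] M}
    (h : ∀ i, restr M (Pi.evalAlgHom R T i) x = restr M (Pi.evalAlgHom R T i) y) : x = y := by
  classical
  have := Fintype.ofFinite ι
  exact rTensor_ext (N' := T) (fun i => (Pi.evalAlgHom R T i).toLinearMap)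
    (fun i => LinearMap.single R T i) (fun n => Finset.univ_sum_single n) h

variable (S) in
/-- The projection of the tensor square of a product onto the tensor product of two factors. -/
noncomputable def piTensorEval (i j : ι) : (∀ i, T i) ⊗[S] (∀ i, T i) →ₐ[R] T i ⊗[S] T j :=
  (Algebra.TensorProduct.map (Pi.evalAlgHom S T i) (Pi.evalAlgHom S T j)).restrictScalars R

theorem restr_pi_tensor_injective {x y : ((∀ i, T i) ⊗[S] (∀ i, T i)) ⊗[R] M}
    (h : ∀ i j, restr M (piTensorEval (R := R) S T i j) x =
      restr M (piTensorEval (R := R) S T i j) y) : x = y := by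
  classical
  have := Fintype.ofFinite ι
  refine rTensor_ext (κ := ι × ι)
    (fun k => (piTensorEval (R := R) S T k.1 k.2).toLinearMap)
    (fun k => (TensorProduct.map (LinearMap.single S T k.1)
      (LinearMap.single S T k.2)).restrictScalars R) (fun n => ?_) fun k => h k.1 k.2
  induction n with
  | zero => simp
  | add x y hx hy => simp only [map_add, Finset.sum_add_distrib, hx, hy]
  | tmul x y =>
    conv_rhs => rw [← Finset.univ_sum_single x, ← Finset.univ_sum_single y,
      TensorProduct.sum_tmul]
    rw [← Finset.univ_product_univ, Finset.sum_product]
    refine Finset.sum_congr rfl fun i _ => ?_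
    rw [TensorProduct.tmul_sum]
    rfl

theorem restr_pi_surjective (x : ∀ i, T i ⊗[R] M) :
    ∃ y : (∀ i, T i) ⊗[R] M, ∀ i, restr M (Pi.evalAlgHom R T i) y = x i := by
  classical
  have := Fintype.ofFinite ι
  refine ⟨∑ i, (LinearMap.single R T i).rTensor M (x i), fun i => ?_⟩
  rw [map_sum, Finset.sum_eq_single i]
  · change (LinearMap.proj i).rTensor M _ = _
    rw [← LinearMap.rTensor_comp_apply, LinearMap.proj_comp_single_same, LinearMap.rTensor_id,
      LinearMap.id_apply]
  · intro j _ hj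
    change (LinearMap.proj i).rTensor M _ = _
    rw [← LinearMap.rTensor_comp_apply, LinearMap.proj_comp_single_ne _ _ _ _ hj.symm,
      LinearMap.rTensor_zero, LinearMap.zero_apply]
  · simp

theorem restr_faithfullyFlat_injective (B : Type u) [CommRing B] [Algebra R B] [Algebra S B]
    [IsScalarTower R S B] [Module.FaithfullyFlat S B] [Module.Flat R M] :
    Function.Injective (restr M (IsScalarTower.toAlgHom R S B)) :=
  Module.Flat.rTensor_preserves_injective_linearMap _ (FaithfulSMul.algebraMap_injective S B)

/-- The Amitsur sequence `S → B → B ⊗[S] B` is exact and stays exact after tensoring over `R` with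
the flat module `M`. -/
theorem exists_restr_eq_of_faithfullyFlat (B : Type u) [CommRing B] [Algebra R B] [Algebra S B]
    [IsScalarTower R S B] [Module.FaithfullyFlat S B] [Module.Flat R M] (y : B ⊗[R] M)
    (h : restr M ((Algebra.TensorProduct.includeLeft : B →ₐ[S] B ⊗[S] B).restrictScalars R) y =
      restr M ((Algebra.TensorProduct.includeRight : B →ₐ[S] B ⊗[S] B).restrictScalars R) y) :
    ∃ x : S ⊗[R] M, restr M (IsScalarTower.toAlgHom R S B) x = y := by
  have hex : Function.Exact ((Algebra.linearMap S B).restrictScalars R)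
      ((Algebra.TensorProduct.includeLeftSubRight S B).restrictScalars R) :=
    Algebra.IsEffective.of_faithfullyFlat S B
  refine (Module.Flat.rTensor_exact M hex y).1 ?_
  rw [← sub_eq_zero] at h
  rw [← h]
  change _ = LinearMap.rTensor M _ y - LinearMap.rTensor M _ y
  rw [← LinearMap.sub_apply, ← LinearMap.rTensor_sub]
  rfl

variable [Module.Flat R M] [∀ i, Module.Flat S (T i)]

theorem eq_of_restr_eq
    (hT : ∀ p : PrimeSpectrum S, ∃ i, p ∈ Set.range (PrimeSpectrum.comap (algebraMap S (T i))))
    {x y : S ⊗[R] M} (h : ∀ i, restr M (IsScalarTower.toAlgHom R S (T i)) x =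
      restr M (IsScalarTower.toAlgHom R S (T i)) y) : x = y := by
  have := faithfullyFlat_pi T hT
  refine restr_faithfullyFlat_injective (∀ i, T i) (restr_pi_injective T fun i => ?_)
  rw [← restr_comp, ← restr_comp]
  exact h i

/-- The finite family is replaced by its product, a single faithfully flat algebra; agreement on all
`T i ⊗ T j` is the descent condition on its tensor square. -/
theorem exists_restr_eq
    (hT : ∀ p : PrimeSpectrum S, ∃ i, p ∈ Set.range (PrimeSpectrum.comap (algebraMap S (T i))))
    (x : ∀ i, T i ⊗[R] M)
    (h : ∀ i j, restr M ((Algebra.TensorProduct.includeLeft :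
        T i →ₐ[S] T i ⊗[S] T j).restrictScalars R) (x i) =
      restr M ((Algebra.TensorProduct.includeRight :
        T j →ₐ[S] T i ⊗[S] T j).restrictScalars R) (x j)) :
    ∃ a : S ⊗[R] M, ∀ i, restr M (IsScalarTower.toAlgHom R S (T i)) a = x i := by
  have := faithfullyFlat_pi T hT
  obtain ⟨y, hy⟩ := restr_pi_surjective (R := R) T x
  obtain ⟨a, rfl⟩ := exists_restr_eq_of_faithfullyFlat (S := S) (∀ i, T i) y <|
    restr_pi_tensor_injective T fun i j => by
      have h' := h i j
      rw [← hy i, ← hy j, ← restr_comp, ← restr_comp] at h'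
      rw [← restr_comp, ← restr_comp]
      convert h' using 2
      · ext z
        simp [piTensorEval, restr_tmul]
      · ext z
        simp [piTensorEval, restr_tmul]
  refine ⟨a, fun i => ?_⟩
  rw [← hy i, ← restr_comp]
  rfl

end Unbundled

end Descent

/-! ### Flat algebras define fppf sheaves -/

section AlgebraSheaf

variable {R : Type u} [CommRing R] (A : Type u) [NonUnitalNonAssocRing A] [Module R A]
  [Module.Flat R A]

theorem algebraFunctor_ext {X : (CommAlgCat.{u} R)ᵒᵖ} {Z : Sieve X} (hZ : IsFppfCover Z)
    {x y : X.unop ⊗[R] A} (h : ∀ ⦃Y : (CommAlgCat.{u} R)ᵒᵖ⦄ (f : Y ⟶ X), Z f →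
      restr A f.unop.hom x = restr A f.unop.hom y) : x = y := by
  obtain ⟨ι, hι, T, φ, hφZ, hφ, hs⟩ := hZ
  let (i : ι) : Algebra X.unop (T i) := (φ i).hom.toRingHom.toAlgebra
  have (i : ι) : IsScalarTower R X.unop (T i) :=
    IsScalarTower.of_algebraMap_eq fun r => ((φ i).hom.commutes r).symm
  have (i : ι) : Module.Flat X.unop (T i) := (hφ i).1
  exact eq_of_restr_eq (fun i => T i) hs fun i => h _ (hφZ i)

theorem exists_algebraFunctor_glue {X : CommAlgCat.{u} R} {ι : Type} [Finite ι]
    {T : ι → CommAlgCat.{u} R} (φ : ∀ i, X ⟶ T i) (hφ : ∀ i, (φ i).hom.toRingHom.Flat)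
    (hs : ∀ p : PrimeSpectrum X, ∃ i, p ∈ Set.range (PrimeSpectrum.comap (φ i).hom.toRingHom))
    (x : ∀ i, T i ⊗[R] A)
    (h : ∀ i j (U : CommAlgCat.{u} R) (f : T i ⟶ U) (g : T j ⟶ U), φ i ≫ f = φ j ≫ g →
      restr A f.hom (x i) = restr A g.hom (x j)) :
    ∃ a : X ⊗[R] A, ∀ i, restr A (φ i).hom a = x i := by
  let (i : ι) : Algebra X (T i) := (φ i).hom.toRingHom.toAlgebra
  have (i : ι) : IsScalarTower R X (T i) :=
    IsScalarTower.of_algebraMap_eq fun r => ((φ i).hom.commutes r).symm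
  have (i : ι) : Module.Flat X (T i) := hφ i
  obtain ⟨a, ha⟩ := exists_restr_eq (fun i => T i) hs x fun i j =>
    h i j (CommAlgCat.of R (T i ⊗[X] T j))
      (CommAlgCat.ofHom ((Algebra.TensorProduct.includeLeft :
        T i →ₐ[X] T i ⊗[X] T j).restrictScalars R))
      (CommAlgCat.ofHom ((Algebra.TensorProduct.includeRight :
        T j →ₐ[X] T i ⊗[X] T j).restrictScalars R)) (by
      ext s
      exact Algebra.TensorProduct.tmul_one_eq_one_tmul (A := T i) (B := T j) s)
  exact ⟨a, ha⟩

theorem isFppfSheaf_algebraFunctor : IsFppfSheaf (algebraFunctor R A) := by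
  rw [IsFppfSheaf, isSheaf_iff_isSheaf_of_type]
  intro X Z hZ
  have hZ' : IsFppfCover Z := hZ
  rw [← Presieve.isSeparatedFor_and_exists_isAmalgamation_iff_isSheafFor]
  refine ⟨fun x t₁ t₂ h₁ h₂ => ?_, fun x hx => ?_⟩
  · refine ULift.ext _ _ (algebraFunctor_ext A hZ' fun Y f hf => ?_)
    exact congrArg ULift.down ((h₁ f hf).trans (h₂ f hf).symm)
  · obtain ⟨ι, hι, T, φ, hφZ, hφ, hs⟩ := hZ'
    obtain ⟨a, ha⟩ := exists_algebraFunctor_glue A φ (fun i => (hφ i).1) hs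
      (fun i => (x (φ i).op (hφZ i)).down) fun i j U f g hfg =>
        congrArg ULift.down (hx f.op g.op (hφZ i) (hφZ j) (by rw [← op_comp, ← op_comp, hfg]))
    -- Gluing controls only the finite family. For any other arrow of `Z`, the restriction is
    -- checked on the pullback of the sieve generated by that family.
    let Z₀ : Sieve X := Sieve.ofArrows (fun i => op (T i)) fun i => (φ i).op
    have hZ₀ : Z₀ ∈ affineFppfTopology R X :=
      ⟨ι, hι, T, φ, fun i => Sieve.ofArrows_mk _ _ i, hφ, hs⟩
    refine ⟨ULift.up a, fun Y f hf => ULift.ext _ _ (algebraFunctor_ext A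
      ((affineFppfTopology R).pullback_stable f hZ₀) fun V g hg => ?_)⟩
    obtain ⟨i, k, hk⟩ := (Sieve.mem_ofArrows_iff _ _ _).1 hg
    have h₁ := congrArg ULift.down (hx g k hf (hφZ i) hk)
    refine Eq.trans ?_ h₁.symm
    change restr A g.unop.hom (restr A f.unop.hom a) =
      restr A k.unop.hom (x (φ i).op (hφZ i)).down
    rw [← ha i]
    have e : f.unop ≫ g.unop = φ i ≫ k.unop := congrArg Quiver.Hom.unop hk
    have e' := congrArg CommAlgCat.Hom.hom e
    rw [CommAlgCat.hom_comp, CommAlgCat.hom_comp] at e'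
    rw [← restr_comp, ← restr_comp, e']

end AlgebraSheaf

/-! ### Operations on sheaves and unital algebras -/

section SheafOps

variable {R : Type u} [CommRing R]

theorem IsFppfSheaf.ext {H : CommAlgCat.{u} R ⥤ Type w} (hH : IsFppfSheaf H)
    {S : CommAlgCat.{u} R} {Z : Sieve (op S)} (hZ : Z ∈ affineFppfTopology R (op S))
    {x y : H.obj S} (h : ∀ ⦃T : CommAlgCat.{u} R⦄ (φ : S ⟶ T), Z φ.op →
      H.map φ x = H.map φ y) : x = y :=
  (((isSheaf_iff_isSheaf_of_type _ _).1 hH Z hZ).isSeparatedFor).ext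
    fun _ f hf => h f.unop hf

theorem exists_toFppfSheafify_eq (G : CommAlgCat.{u} R ⥤ Type (u + 1)) {S : CommAlgCat.{u} R}
    (x : (fppfSheafify G).obj S) : ∃ Z ∈ affineFppfTopology R (op S),
      ∀ ⦃T : CommAlgCat.{u} R⦄ (φ : S ⟶ T), Z φ.op →
        ∃ y : G.obj T, (toFppfSheafify G).app T y = (fppfSheafify G).map φ x := by
  have h := ((affineFppfTopology R).W_iff_isLocallyBijective _).1
    ((affineFppfTopology R).W_toSheafify (asPresheaf G))
  obtain ⟨-, h⟩ := h
  refine ⟨_, Presheaf.imageSieve_mem _ (toSheafify (affineFppfTopology R) (asPresheaf G))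
    (U := op (op S)) x, fun T φ hφ => ?_⟩
  obtain ⟨y, hy⟩ := hφ
  exact ⟨y, hy⟩

/-- Sections of the associated sheaf come locally from `G`, and equality in a sheaf is local. -/
theorem fppfSheafify_hom_ext {G H : CommAlgCat.{u} R ⥤ Type (u + 1)} (hH : IsFppfSheaf H)
    {f g : fppfSheafify G ⟶ H} (h : ∀ S (x : G.obj S), f.app S ((toFppfSheafify G).app S x) =
      g.app S ((toFppfSheafify G).app S x)) : f = g := by
  ext S x
  change f.app S x = g.app S x
  obtain ⟨Z, hZ, hx⟩ := exists_toFppfSheafify_eq G x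
  refine hH.ext hZ fun T φ hφ => ?_
  obtain ⟨u, hu⟩ := hx φ hφ
  rw [← NatTrans.naturality_apply, ← NatTrans.naturality_apply, ← hu, h]

theorem AlgebraOps.IsHom.of_comp_toFppfSheafify {G H : CommAlgCat.{u} R ⥤ Type (u + 1)}
    {A : AlgebraOps G} {B : AlgebraOps H} (hH : IsFppfSheaf H) {f : fppfSheafify G ⟶ H}
    (hf : A.IsHom B (toFppfSheafify G ≫ f)) : A.sheafify.IsHom B f where
  app_add S x y := by
    obtain ⟨Z, hZ, hx⟩ := exists_toFppfSheafify_eq G x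
    obtain ⟨Z', hZ', hy⟩ := exists_toFppfSheafify_eq G y
    refine hH.ext ((affineFppfTopology R).intersection_covering hZ hZ') fun T φ hφ => ?_
    obtain ⟨u, hu⟩ := hx φ hφ.1
    obtain ⟨v, hv⟩ := hy φ hφ.2
    rw [← NatTrans.naturality_apply, A.sheafify.map_add, B.map_add, ← NatTrans.naturality_apply,
      ← NatTrans.naturality_apply, ← hu, ← hv, ← A.isHom_toFppfSheafify.app_add]
    exact hf.app_add T u v
  app_mul S x y := by
    obtain ⟨Z, hZ, hx⟩ := exists_toFppfSheafify_eq G x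
    obtain ⟨Z', hZ', hy⟩ := exists_toFppfSheafify_eq G y
    refine hH.ext ((affineFppfTopology R).intersection_covering hZ hZ') fun T φ hφ => ?_
    obtain ⟨u, hu⟩ := hx φ hφ.1
    obtain ⟨v, hv⟩ := hy φ hφ.2
    rw [← NatTrans.naturality_apply, A.sheafify.map_mul, B.map_mul, ← NatTrans.naturality_apply,
      ← NatTrans.naturality_apply, ← hu, ← hv, ← A.isHom_toFppfSheafify.app_mul]
    exact hf.app_mul T u v
  app_smul S s x := by
    obtain ⟨Z, hZ, hx⟩ := exists_toFppfSheafify_eq G x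
    refine hH.ext hZ fun T φ hφ => ?_
    obtain ⟨u, hu⟩ := hx φ hφ
    rw [← NatTrans.naturality_apply, A.sheafify.map_smul, B.map_smul, ← NatTrans.naturality_apply,
      ← hu, ← A.isHom_toFppfSheafify.app_smul]
    exact hf.app_smul T (φ.hom s) u

theorem AlgebraOps.IsHom.isUnitalAlgebra {G H : CommAlgCat.{u} R ⥤ Type w} {A : AlgebraOps G}
    {B : AlgebraOps H} {f : G ⟶ H} (hf : A.IsHom B f)
    (h : ∀ S, Function.Bijective (f.app S)) (hB : B.IsUnitalAlgebra) : A.IsUnitalAlgebra := by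
  intro S
  obtain ⟨_, _, h₁, h₂, hadd, hmul, hsmul⟩ := hB S
  let e : G.obj S ≃ H.obj S := Equiv.ofBijective _ (h S)
  let : NonAssocRing (G.obj S) := e.nonAssocRing
  let : Module S (G.obj S) := e.module S
  have e_add (x y : G.obj S) : e (x + y) = e x + e y := e.apply_symm_apply _
  have e_mul (x y : G.obj S) : e (x * y) = e x * e y := e.apply_symm_apply _
  have e_smul (s : S) (x : G.obj S) : e (s • x) = s • e x := e.apply_symm_apply _
  refine ⟨inferInstance, inferInstance, ⟨fun s x y => e.injective ?_⟩,
    ⟨fun s x y => e.injective ?_⟩, fun x y => e.injective ?_, fun x y => e.injective ?_,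
    fun s x => e.injective ?_⟩
  · simp only [smul_eq_mul, e_mul, e_smul, smul_mul_assoc]
  · simp only [smul_eq_mul, e_mul, e_smul, mul_smul_comm]
  · rw [e_add, hadd]
    exact (hf.app_add S x y).symm
  · rw [e_mul, hmul]
    exact (hf.app_mul S x y).symm
  · rw [e_smul, hsmul]
    exact (hf.app_smul S s x).symm

theorem isUnitalAlgebra_algebraFunctorOps (A : Type u) [NonUnitalNonAssocRing A] [Module R A]
    [IsScalarTower R A A] [SMulCommClass R A A] (e : A) (he : ∀ x, e * x = x)
    (he' : ∀ x, x * e = x) : (algebraFunctorOps R A).IsUnitalAlgebra := by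
  intro S
  have h₁ (x : S ⊗[R] A) : (1 : S) ⊗ₜ[R] e * x = x := by
    induction x with
    | zero => rw [mul_zero]
    | add x y hx hy => rw [mul_add, hx, hy]
    | tmul s x => rw [Algebra.TensorProduct.tmul_mul_tmul, one_mul, he]
  have h₂ (x : S ⊗[R] A) : x * (1 : S) ⊗ₜ[R] e = x := by
    induction x with
    | zero => rw [zero_mul]
    | add x y hx hy => rw [add_mul, hx, hy]
    | tmul s x => rw [Algebra.TensorProduct.tmul_mul_tmul, mul_one, he']
  let : NonAssocRing (S ⊗[R] A) :=
    { (inferInstance : NonUnitalNonAssocRing (S ⊗[R] A)) with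
      one := 1 ⊗ₜ e
      one_mul := h₁
      mul_one := h₂ }
  have h₃ : SMulCommClass S (ULift.{u + 1} (S ⊗[R] A)) (ULift.{u + 1} (S ⊗[R] A)) :=
    ⟨fun s x y => ULift.ext _ _ (mul_smul_comm s x.down y.down).symm⟩
  have h₄ : IsScalarTower S (ULift.{u + 1} (S ⊗[R] A)) (ULift.{u + 1} (S ⊗[R] A)) :=
    ⟨fun s x y => ULift.ext _ _ (smul_mul_assoc s x.down y.down)⟩
  exact ⟨(inferInstance : NonAssocRing (ULift.{u + 1} (S ⊗[R] A))),
    (inferInstance : Module S (ULift.{u + 1} (S ⊗[R] A))),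
    h₄, h₃, fun _ _ => rfl, fun _ _ => rfl, fun _ _ => rfl⟩

end SheafOps

/-! ### The comparison of the twist with the isotope -/

section Comparison

variable {R C : Type u} [CommRing R] [NonAssocRing C] [Module R C]

section

variable {S : Type u} [CommRing S] [Algebra R S]

variable (S) in
/-- The identity of `C_S`, as a linear equivalence onto the base change of the isotope. -/
noncomputable def isotopeEquiv (a b : C) : S ⊗[R] C ≃ₗ[S] S ⊗[R] Isotope a b :=
  (Isotope.of R a b).baseChange R S C (Isotope a b)

theorem restr_isotopeEquiv {T : Type u} [CommRing T] [Algebra R T] (φ : S →ₐ[R] T) (a b : C)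
    (x : S ⊗[R] C) : restr (Isotope a b) φ (isotopeEquiv S a b x) =
      isotopeEquiv T a b (restr C φ x) := by
  induction x with
  | zero => simp
  | add x y hx hy => simp only [map_add, hx, hy]
  | tmul s x => rfl

variable [IsScalarTower R C C] [SMulCommClass R C C]

theorem isotopeEquiv_mul (a b : C) (x y : S ⊗[R] C) :
    isotopeEquiv S a b ((x * (1 : S) ⊗ₜ[R] a) * ((1 : S) ⊗ₜ[R] b * y)) =
      isotopeEquiv S a b x * isotopeEquiv S a b y := by
  induction x with
  | zero => simp
  | add x x' hx hx' => simp only [add_mul, map_add, hx, hx']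
  | tmul s x =>
    induction y with
    | zero => simp
    | add y y' hy hy' => simp only [mul_add, map_add, hy, hy']
    | tmul t y =>
      simp only [Algebra.TensorProduct.tmul_mul_tmul, one_mul, mul_one]
      change (s * t) ⊗ₜ[R] Isotope.of R a b ((x * a) * (b * y)) =
        (s ⊗ₜ[R] Isotope.of R a b x) * (t ⊗ₜ[R] Isotope.of R a b y)
      rw [Algebra.TensorProduct.tmul_mul_tmul, Isotope.of_mul_of]

end

variable [IsScalarTower R C C] [SMulCommClass R C C] [OctonionAlgebra R C]

namespace OctonionAlgebra

/-- The unit is `b̄ ā`, the inverse of `ab`; the two cancellation laws verify it without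
associativity. -/
theorem isUnitalAlgebra_isotope {a b : C} (ha : octNorm R a = 1) (hb : octNorm R b = 1) :
    (algebraFunctorOps R (Isotope a b)).IsUnitalAlgebra := by
  refine isUnitalAlgebra_algebraFunctorOps (Isotope a b)
    (Isotope.of R a b (octonionConj R C b * octonionConj R C a)) (fun x => ?_) fun x => ?_
  · change (((octonionConj R C b * octonionConj R C a) * a) * (b * (show C from x)) : C) = x
    rw [mul_conj_mul', ha, one_smul, conj_mul_mul, hb, one_smul]
  · change (((show C from x) * a) * (b * (octonionConj R C b * octonionConj R C a)) : C) = x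
    rw [mul_conj_mul, hb, one_smul, mul_mul_conj, ha, one_smul]

variable {S : Type u} [CommRing S] [Algebra R S] {a b : C}

/-- Setting one argument of the autotopy equal to `1` expresses `t₁` through either other component;
cancelling `ā` or `b̄` recovers the two factors of the isotope product. -/
theorem PiFibre.isotopeEquiv_mul (t : PiFibre R S a b) (x y : S ⊗[R] C) :
    isotopeEquiv S a b (t.1.t₁ (x * y)) =
      isotopeEquiv S a b (t.1.t₁ x) * isotopeEquiv S a b (t.1.t₁ y) := by
  have h := isIsometricAutotopy_of_relatedTriple t.1
  have h₃ : conjAut S t.1.t₃ 1 = octonionConj S (S ⊗[R] C) (1 ⊗ₜ a) := by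
    rw [conjAut_one_eq, t.2.1]
  have h₂ : conjAut S t.1.t₂ 1 = octonionConj S (S ⊗[R] C) (1 ⊗ₜ b) := by
    rw [conjAut_one_eq, t.2.2]
  have hna : octNorm S ((1 : S) ⊗ₜ[R] a) = 1 := by
    rw [← norm_conj, ← h₃, h.norm₃, norm_one S]
  have hnb : octNorm S ((1 : S) ⊗ₜ[R] b) = 1 := by
    rw [← norm_conj, ← h₂, h.norm₂, norm_one S]
  have ex : t.1.t₁ x * 1 ⊗ₜ a = conjAut S t.1.t₂ x := by
    conv_lhs => rw [← mul_one x, h.map_mul, h₃]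
    rw [mul_conj_mul', hna, one_smul]
  have ey : 1 ⊗ₜ b * t.1.t₁ y = conjAut S t.1.t₃ y := by
    conv_lhs => rw [← one_mul y, h.map_mul, h₂]
    rw [mul_conj_mul, hnb, one_smul]
  rw [← _root_.isotopeEquiv_mul, ex, ey, h.map_mul]

/-- The map `(t, x) ↦ t₁(x)` on classes of pairs. -/
noncomputable def evalPreTwist : PreTwist R S a b → S ⊗[R] Isotope a b :=
  Quotient.lift (fun p => isotopeEquiv S a b (p.1.1.t₁ p.2)) (by
    rintro ⟨t, x⟩ ⟨u, y⟩ ⟨g, hg, ⟨h₁, -, -⟩, hx⟩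
    dsimp only at h₁ hx ⊢
    rw [hx, h₁]
    rfl)

/-- The automorphism relating `t` to `u` identifies any two pairs with the same value. -/
theorem evalPreTwist_injective :
    Function.Injective (evalPreTwist (R := R) (S := S) (a := a) (b := b)) := by
  rintro ⟨t, x⟩ ⟨u, y⟩ h
  obtain ⟨g, ⟨hg, ht⟩, -⟩ := existsUnique_isTranslate t u
  have h' : t.1.t₁ x = u.1.t₁ y := (isotopeEquiv S a b).injective h
  exact Quotient.sound ⟨g, hg, ht, t.1.t₁.injective (h'.trans (by rw [ht.1]; rfl))⟩

theorem evalPreTwist_add (p p' : PreTwist R S a b) :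
    evalPreTwist (p.add p') = evalPreTwist p + evalPreTwist p' := by
  obtain ⟨⟨t, x⟩, rfl⟩ := Quotient.exists_rep p
  obtain ⟨⟨u, y⟩, rfl⟩ := Quotient.exists_rep p'
  change isotopeEquiv S a b (t.1.t₁ (x + t.1.t₁.symm (u.1.t₁ y))) =
    isotopeEquiv S a b (t.1.t₁ x) + isotopeEquiv S a b (u.1.t₁ y)
  rw [map_add, map_add, LinearEquiv.apply_symm_apply]

theorem evalPreTwist_mul (p p' : PreTwist R S a b) :
    evalPreTwist (p.mul p') = evalPreTwist p * evalPreTwist p' := by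
  obtain ⟨⟨t, x⟩, rfl⟩ := Quotient.exists_rep p
  obtain ⟨⟨u, y⟩, rfl⟩ := Quotient.exists_rep p'
  change isotopeEquiv S a b (t.1.t₁ (x * t.1.t₁.symm (u.1.t₁ y))) =
    isotopeEquiv S a b (t.1.t₁ x) * isotopeEquiv S a b (u.1.t₁ y)
  rw [PiFibre.isotopeEquiv_mul, LinearEquiv.apply_symm_apply]

theorem evalPreTwist_smul (s : S) (p : PreTwist R S a b) :
    evalPreTwist (p.smul s) = s • evalPreTwist p := by
  obtain ⟨⟨t, x⟩, rfl⟩ := Quotient.exists_rep p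
  change isotopeEquiv S a b (t.1.t₁ (s • x)) = s • isotopeEquiv S a b (t.1.t₁ x)
  rw [map_smul, map_smul]

theorem evalPreTwist_map {T : Type u} [CommRing T] [Algebra R T] (φ : S →ₐ[R] T)
    (p : PreTwist R S a b) :
    evalPreTwist (p.map φ) = restr (Isotope a b) φ (evalPreTwist p) := by
  obtain ⟨⟨t, x⟩, rfl⟩ := Quotient.exists_rep p
  change isotopeEquiv T a b (extendAut C φ t.1.t₁ (restr C φ x)) =
    restr (Isotope a b) φ (isotopeEquiv S a b (t.1.t₁ x))
  rw [extendAut_restr, restr_isotopeEquiv]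

variable (R) in
/-- The map `(t, x) ↦ t₁(x)` as a morphism of functors. -/
noncomputable def preTwistHom (a b : C) :
    preTwistFunctor R a b ⟶ algebraFunctor R (Isotope a b) where
  app S := TypeCat.ofHom fun x => ULift.up (evalPreTwist x.down)
  naturality S T φ := by
    ext x
    exact congrArg ULift.up (evalPreTwist_map φ.hom x.down)

theorem isHom_preTwistHom (a b : C) :
    (preTwistOps R a b).IsHom (algebraFunctorOps R (Isotope a b)) (preTwistHom R a b) where
  app_add _ x y := congrArg ULift.up (evalPreTwist_add x.down y.down)
  app_mul _ x y := congrArg ULift.up (evalPreTwist_mul x.down y.down)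
  app_smul _ s x := congrArg ULift.up (evalPreTwist_smul s x.down)

theorem exists_cover_piFibre {a b : C} (ha : octNorm R a = 1) (hb : octNorm R b = 1)
    (S : CommAlgCat.{u} R) : ∃ (T : CommAlgCat.{u} R) (φ : S ⟶ T), Nonempty (PiFibre R T a b) ∧
      ∀ Z : Sieve (op S), Z φ.op → Z ∈ affineFppfTopology R (op S) := by
  obtain ⟨T, _, _, _, _, ⟨t⟩⟩ := exists_faithfullyFlat_piFibre a b ha hb
  refine ⟨CommAlgCat.of R (S ⊗[R] T), CommAlgCat.ofHom (Algebra.TensorProduct.includeLeft),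
    ⟨t.map Algebra.TensorProduct.includeRight⟩, fun Z hZ => ⟨Unit, inferInstance, _,
      fun _ => _, fun _ => hZ, fun _ => ⟨?_, ?_⟩, fun p => ⟨(), ?_⟩⟩⟩
  · exact RingHom.flat_algebraMap_iff.2 (inferInstance : Module.Flat S (S ⊗[R] T))
  · exact RingHom.finitePresentation_algebraMap.2
      (inferInstance : Algebra.FinitePresentation S (S ⊗[R] T))
  · exact PrimeSpectrum.comap_surjective_of_faithfullyFlat (A := S) (B := S ⊗[R] T) p

/-- The map is injective on sections, and surjective wherever the fibre has a point `t`, through `x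
↦ (t, t₁⁻¹(x))`. -/
theorem W_preTwistHom {a b : C} (ha : octNorm R a = 1) (hb : octNorm R b = 1) :
    (affineFppfTopology R).W ((unopUnop _).whiskerLeft (preTwistHom R a b)) := by
  rw [GrothendieckTopology.W_iff_isLocallyBijective]
  refine ⟨Presheaf.isLocallyInjective_of_injective _ _ fun X x y h => ?_, ⟨fun {U} s => ?_⟩⟩
  · exact ULift.ext _ _ (evalPreTwist_injective (congrArg ULift.down h))
  · obtain ⟨T, φ, ⟨t⟩, hφ⟩ := exists_cover_piFibre ha hb U.unop
    refine hφ _ ⟨ULift.up (PreTwist.mk t (t.1.t₁.symm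
      ((isotopeEquiv T a b).symm (restr _ φ.hom s.down)))), congrArg ULift.up ?_⟩
    change isotopeEquiv T a b (t.1.t₁ (t.1.t₁.symm ((isotopeEquiv T a b).symm _))) = _
    exact (congrArg (isotopeEquiv T a b) (t.1.t₁.apply_symm_apply _)).trans
      ((isotopeEquiv T a b).apply_symm_apply _)

/-- Both the canonical map and the evaluation map are local isomorphisms into sheaves. Each extends
uniquely along the other, and uniqueness makes the two extensions inverse. -/
theorem exists_twistIso {a b : C} (ha : octNorm R a = 1) (hb : octNorm R b = 1) :
    ∃ Θ : twist R a b ≅ algebraFunctor R (Isotope a b),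
      toFppfSheafify (preTwistFunctor R a b) ≫ Θ.hom = preTwistHom R a b := by
  have hF : IsFppfSheaf (algebraFunctor R (Isotope a b)) :=
    have : Module.Flat R (Isotope a b) := inferInstanceAs (Module.Flat R C)
    isFppfSheaf_algebraFunctor _
  let J := affineFppfTopology R
  let η := toSheafify J (asPresheaf (preTwistFunctor R a b))
  let θ : asPresheaf (preTwistFunctor R a b) ⟶ asPresheaf (algebraFunctor R (Isotope a b)) :=
    (unopUnop _).whiskerLeft (preTwistHom R a b)
  have hη : J.W η := J.W_toSheafify _
  have hθ : J.W θ := W_preTwistHom ha hb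
  have hη' : Presheaf.IsSheaf J (sheafify J (asPresheaf (preTwistFunctor R a b))) :=
    (presheafToSheaf J _ |>.obj _).property
  obtain ⟨f, hf⟩ := (hη _ hF).2 θ
  obtain ⟨g, hg⟩ := (hθ _ hη').2 η
  dsimp only at hf hg
  have hfg : f ≫ g = 𝟙 _ := (hη _ hη').1 (by
    dsimp only; rw [← Category.assoc, hf, hg, Category.comp_id])
  have hgf : g ≫ f = 𝟙 _ := (hθ _ hF).1 (by
    dsimp only; rw [← Category.assoc, hg, hf, Category.comp_id])
  let Φ : sheafify J (asPresheaf (preTwistFunctor R a b)) ≅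
    asPresheaf (algebraFunctor R (Isotope a b)) := ⟨f, g, hfg, hgf⟩
  refine ⟨(Functor.isoWhiskerLeft (opOp _) Φ), ?_⟩
  ext S x
  exact congrArg (fun m => m.app (op (op S)) x) hf

end OctonionAlgebra

end Comparison

open OctonionAlgebra in
theorem mainTheorem3 {R C : Type u} [CommRing R] [NonAssocRing C] [Module R C]
    [IsScalarTower R C C] [SMulCommClass R C C] [OctonionAlgebra R C]
    (a b : C) (ha : a ∈ unitSphere R C) (hb : b ∈ unitSphere R C) :
    ((∃ (T : Type u) (_ : CommRing T) (_ : Algebra R T), Module.FaithfullyFlat R T ∧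
        Algebra.FinitePresentation R T ∧ Nonempty (PiFibre R T a b)) ∧
      ∀ (S : Type u) [CommRing S] [Algebra R S] (t t' : PiFibre R S a b),
        ∃! g : S ⊗[R] C ≃ₗ[S] S ⊗[R] C, g ∈ octonionAut R C S ∧ t.IsTranslate g t') ∧
    (twistOps R a b).IsUnitalAlgebra ∧
    IsFppfSheaf (algebraFunctor R (Isotope a b)) ∧
    ∃ Θ : twist R a b ≅ algebraFunctor R (Isotope a b),
      (twistOps R a b).IsHom (algebraFunctorOps R (Isotope a b)) Θ.hom ∧
      (∀ (S : CommAlgCat.{u} R) (t : PiFibre R S a b) (x : S ⊗[R] C),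
        Θ.hom.app S (twistClass S t x) = toIsotope a b S (t.1.t₁ x)) ∧
      ∀ f : twist R a b ⟶ algebraFunctor R (Isotope a b),
        (∀ (S : CommAlgCat.{u} R) (t : PiFibre R S a b) (x : S ⊗[R] C),
          f.app S (twistClass S t x) = toIsotope a b S (t.1.t₁ x)) → f = Θ.hom := by
  have hF : IsFppfSheaf (algebraFunctor R (Isotope a b)) :=
    have : Module.Flat R (Isotope a b) := inferInstanceAs (Module.Flat R C)
    isFppfSheaf_algebraFunctor _
  obtain ⟨Θ, hΘ⟩ := exists_twistIso (R := R) ha hb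
  have hom : (twistOps R a b).IsHom (algebraFunctorOps R (Isotope a b)) Θ.hom :=
    AlgebraOps.IsHom.of_comp_toFppfSheafify hF (hΘ ▸ isHom_preTwistHom a b)
  have hmk (S : CommAlgCat.{u} R) (t : PiFibre R S a b) (x : S ⊗[R] C) :
      Θ.hom.app S (twistClass S t x) = toIsotope a b S (t.1.t₁ x) :=
    congrArg (fun m => m.app S (ULift.up (PreTwist.mk t x))) hΘ
  -- The algebra axioms on the twist are pulled back along the bijections `Θ.hom.app S`: where the
  -- fibre is empty, the presheaf of pairs has no zero or unit to start from.
  refine ⟨⟨exists_faithfullyFlat_piFibre a b ha hb, fun S _ _ t t' =>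
    existsUnique_isTranslate t t'⟩, hom.isUnitalAlgebra (fun S => ?_)
    (isUnitalAlgebra_isotope ha hb), hF, Θ, hom, hmk, fun f hf =>
      fppfSheafify_hom_ext hF fun S x => ?_⟩
  · exact (ConcreteCategory.isIso_iff_bijective (Θ.hom.app S)).1 inferInstance
  · obtain ⟨x⟩ := x
    obtain ⟨⟨t, x⟩, rfl⟩ := Quotient.exists_rep x
    exact (hf S t x).trans (hmk S t x).symm
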